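/- **Minimal polynomial solution of the level-one $D_r$ $q$KZ system.** Let $K$ be a field of characteristic $0$ (for instance $\mathbb C$, or $\mathbb C(q)$ with $q$ an indeterminate), let $q\in K$ with $q\neq 0$, $q^4\neq 1$, put $\beta=-(q+q^{-1})$, and let $r=2n+1$ with $n\ge 1$. *Patterns.* An open link pattern is a configuration of $r$ points on a line, connected in the upper half-plane without crossings, either in pairs by closed arches or to infinity by half-lines (open arches); $\pi_0$ is the pattern with open arches only. In the coloured picture of a pattern its closed arches are solid and its open arches are connected, in pairs of consecutive ones starting from the two rightmost, by dashed arches, so that exactly one point remains open. Let $V$ be the vector space over $K$ with basis the open link patterns. *Operators on $V$.* For $1\le i\le r-1$, $e_i$ glues the arches of the coloured picture that end at $i$ and $i+1$ and creates a new little solid arch between these points. Two dashed pieces glue to a solid arch, a dashed and a solid piece to a dashed arch, and what is glued to the open point becomes open; a solid loop is replaced by $\beta$, and a loop made of a dashed arch and the solid arch of $e_i$ by $0$. The involution $s$ switches the colour of the arch at the point $r$ if that arch is closed, and fixes the pattern if the point $r$ is open in the coloured picture; $e'_{r-1}=s\,e_{r-1}\,s$. The operator $e_0$ multiplies a pattern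 by $\beta$ if the point $1$ is open; otherwise, if $1$ is connected to $j$ and the point $o$ is open in the coloured picture, $e_0$ maps the pattern to the sum of the two patterns obtained by making $1$ open and connecting $j$ with $o$ by a solid, respectively by a dashed, arch. *System.* For an operator $e$ put $R(e;u)=\dfrac{(qu-q^{-1})+(u-1)e}{q-q^{-1}u}$. Let $\Psi=\sum_\pi \Psi_\pi\,\pi$ have entries $\Psi_\pi\in K[w_1,\dots,w_r]$, and let $m_j$ be the degree of $\Psi$ in $w_j$, that is, the maximum over $\pi$ of the degrees of the $\Psi_\pi$ in $w_j$. The system consists of the equations $$R\big(e_i;\tfrac{w_{i+1}}{w_i}\big)\Psi=\Psi(\dots,w_{i+1},w_i,\dots)\qquad(1\le i\le r-1),$$ $$(w_{r-1}w_r)^{-m_r}\,R\big(e'_{r-1};\tfrac1{w_rw_{r-1}}\big)\Psi=\Psi\big(w_1,\dots,w_{r-2},\tfrac1{w_r},\tfrac1{w_{r-1}}\big),$$ $$(q^3w_1)^{-m_1}\,R\big(e_0;q^6w_1^2\big)\Psi=\Psi\big(\tfrac1{q^6w_1},w_2,\dots,w_r\big).$$ **Theorem.** The system has a polynomial solution $\Psi$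 with the following properties. 1. The base entry is $\Psi_{\pi_0}=\prod_{1\le i<j\le r}(q\,w_i-q^{-1}w_j)$; its total degree is $r(r-1)/2$. 2. $\Psi$ has degree $r-1$ in each variable $w_j$, in particular $m_1=m_r=r-1$. 3. $w_r^{-m_r}\,s\Psi(w_1,\dots,w_r)=\Psi(w_1,\dots,w_{r-1},1/w_r)$. 4. The other entries are obtained from $\Psi_{\pi_0}$ in a triangular way: the patterns can be listed, beginning with $\pi_0$, such that for each $\pi\ne\pi_0$ there are an earlier pattern $\rho$ and one of the equations of the system, with operator $e\in\{e_0,e_1,\dots,e_{r-1},e'_{r-1}\}$, such that the coefficient of $\rho$ in $e\Psi$ contains $\Psi_\pi$ with a nonzero factor and otherwise only entries of patterns earlier than $\pi$; the $\rho$-component of this equation expresses $\Psi_\pi$ through earlier entries. 5. $\Psi$ is minimal: every nonzero polynomial solution $\Phi$ has $\Phi_{\pi_0}\ne0$, the total degree of $\Phi_{\pi_0}$ is at least $r(r-1)/2$, and $\Phi$ has degree at least $r-1$ in each variable. If $\Phi$ has degree exactly $r-1$ in some variable, then $\Phi=c\,\Psi$ with $c\in K$. -/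

import Mathlib

open MvPolynomial

namespace DqKZ

/-- `σ` describes an open link pattern on `r` points on a line: `σ i` is the other end of the
closed arch at `i`, and `σ i = i` if `i` carries an open arch (a half-line to infinity). Arches do
not cross, and no point with an open arch lies below a closed arch. -/
def IsOpenLinkPattern {r : ℕ} (σ : Fin r → Fin r) : Prop :=
  (∀ i, σ (σ i) = i) ∧
    ∀ i j, i < j → j < σ i → i < σ j ∧ σ j < σ i ∧ σ j ≠ j

instance {r : ℕ} : DecidablePred (IsOpenLinkPattern (r := r)) := fun σ => by
  unfold IsOpenLinkPattern; infer_instance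

/-- The open link patterns on `r` points. -/
abbrev OpenLinkPattern (r : ℕ) : Type := {σ : Fin r → Fin r // IsOpenLinkPattern σ}

/-- The open link pattern with only open arches. -/
def allOpen (r : ℕ) : OpenLinkPattern r :=
  ⟨id, fun _ => rfl, fun _ _ h h' => absurd (h.trans h') (lt_irrefl _)⟩

/-- A two-coloured diagram: the partner of each point (the point itself if it is open), and whether
the arch at that point is dashed. -/
abbrev ColoredDiagram (r : ℕ) : Type := (Fin r → Fin r) × (Fin r → Bool)

/-- `a < b` are two consecutive open points that get connected by a dashed arch when the open arches
are connected in pairs of consecutive ones, the two rightmost open arches forming a pair. -/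
def DashedPair {r : ℕ} (π : OpenLinkPattern r) (a b : Fin r) : Prop :=
  a < b ∧ π.1 a = a ∧ π.1 b = b ∧ (∀ c, a < c → c < b → π.1 c ≠ c) ∧
    Even (Finset.univ.filter fun c => b < c ∧ π.1 c = c).card

instance {r : ℕ} (π : OpenLinkPattern r) (a b : Fin r) : Decidable (DashedPair π a b) := by
  unfold DashedPair; infer_instance

/-- The points connected to `i` by a dashed arch (at most one). -/
def dashedPartners {r : ℕ} (π : OpenLinkPattern r) (i : Fin r) : Finset (Fin r) :=
  Finset.univ.filter fun j => DashedPair π i j ∨ DashedPair π j i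

/-- The coloured picture of an open link pattern: closed arches are solid, and the open arches are
connected in pairs by dashed arches. If `r` is odd, exactly one open point remains. -/
def colored {r : ℕ} (π : OpenLinkPattern r) : ColoredDiagram r :=
  (fun i => if h : (dashedPartners π i).Nonempty then (dashedPartners π i).min' h else π.1 i,
   fun i => decide (dashedPartners π i).Nonempty)

/-- Glue the arches that end at `a` and `b`, and create a new little solid arch between `a` and `b`
(for points `a`, `b` that are not connected to each other). Two dashed pieces compose to a solid
arch, a dashed and a solid one to a dashed arch; what is glued to the open arch becomes open. -/
def join {r : ℕ} (D : ColoredDiagram r) (a b : Fin r) : ColoredDiagram r :=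
  (fun i =>
    if i = a then b else if i = b then a
    else if i = D.1 a then (if D.1 b = b then i else D.1 b)
    else if i = D.1 b then (if D.1 a = a then i else D.1 a)
    else D.1 i,
   fun i =>
    if i = a ∨ i = b then false
    else if i = D.1 a ∨ i = D.1 b then
      (if D.1 a = a ∨ D.1 b = b then false else xor (D.2 a) (D.2 b))
    else D.2 i)

/-- Switch the colour (solid / dashed) of the arch at the rightmost point if it is closed; leave the
diagram invariant if it is open. -/
def switchLast {n : ℕ} (D : ColoredDiagram (2 * n + 1)) : ColoredDiagram (2 * n + 1) :=
  if D.1 (Fin.last _) = Fin.last _ then D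
  else (D.1, fun i => if i = Fin.last _ ∨ i = D.1 (Fin.last _) then !(D.2 i) else D.2 i)

/-- Cut the arch at the leftmost point: the leftmost point becomes open, and its former partner gets
connected to the formerly open point `o` by an arch whose colour is given by `c`. -/
def cutFirst {n : ℕ} (D : ColoredDiagram (2 * n + 1)) (o : Fin (2 * n + 1)) (c : Bool) :
    ColoredDiagram (2 * n + 1) :=
  (fun i => if i = 0 then 0 else if i = D.1 0 then o else if i = o then D.1 0 else D.1 i,
   fun i => if i = 0 then false else if i = D.1 0 ∨ i = o then c else D.2 i)

section

variable {K : Type*} [Field K]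

/-- The loop weight `β = -(q + q⁻¹)`. -/
noncomputable def loopWeight (q : K) : K := -(q + q⁻¹)

/-- The matrix of the Temperley–Lieb generator acting at the neighbouring points `a`, `b`; the entry
`(ρ, π)` is the coefficient of `ρ` in the image of `π`. A solid loop has weight `β`, a loop which is
half solid and half dashed has weight `0`. -/
noncomputable def eMatrix {r : ℕ} (q : K) (a b : Fin r) :
    Matrix (OpenLinkPattern r) (OpenLinkPattern r) K :=
  fun ρ π =>
    if (colored π).1 a = b then
      (if (colored π).2 a = true then 0 else if ρ = π then loopWeight q else 0)
    else if colored ρ = join (colored π) a b then 1 else 0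

/-- The matrix of the involution `s`. -/
def sMatrix (K : Type*) [Field K] (n : ℕ) :
    Matrix (OpenLinkPattern (2 * n + 1)) (OpenLinkPattern (2 * n + 1)) K :=
  fun ρ π => if colored ρ = switchLast (colored π) then 1 else 0

/-- The matrix of the boundary generator `e₀` at the leftmost point: weight `β` if that point is
open, and otherwise the sum, over both colours, of the diagrams obtained by cutting its arch. -/
noncomputable def eZeroMatrix {n : ℕ} (q : K) :
    Matrix (OpenLinkPattern (2 * n + 1)) (OpenLinkPattern (2 * n + 1)) K :=
  fun ρ π =>
    if (colored π).1 0 = 0 then (if ρ = π then loopWeight q else 0)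
    else if ∃ o c, (colored π).1 o = o ∧ colored ρ = cutFirst (colored π) o c then 1 else 0

/-- The last but one point, number `r - 1` for `r = 2 n + 1`. -/
def penult (n : ℕ) : Fin (2 * n + 1) := ⟨2 * n - 1, by omega⟩

/-- The nodes of the affinized diagram: the extra root `-2 z₁`, the roots `zᵢ - zᵢ₊₁`
(`i = 1, …, r - 1`), and the root `zᵣ₋₁ + zᵣ`. -/
inductive Node (n : ℕ) : Type
  | affine : Node n
  | bulk : Fin (2 * n) → Node n
  | last : Node n

/-- The generator attached to a node: `e₀`, `eᵢ`, and `e'ᵣ₋₁ = s eᵣ₋₁ s`. -/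
noncomputable def generator {n : ℕ} (q : K) :
    Node n → Matrix (OpenLinkPattern (2 * n + 1)) (OpenLinkPattern (2 * n + 1)) K
  | .affine => eZeroMatrix q
  | .bulk i => eMatrix q i.castSucc i.succ
  | .last => sMatrix K n * eMatrix q (penult n) (Fin.last _) * sMatrix K n

/-- The argument of the `R`-matrix attached to a node: `q⁶ w₁²`, `wᵢ₊₁ / wᵢ`, `1 / (wᵣ wᵣ₋₁)`. -/
def spectral {n : ℕ} (q : K) (w : Fin (2 * n + 1) → K) : Node n → K
  | .affine => q ^ 6 * w 0 ^ 2
  | .bulk i => w i.succ / w i.castSucc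
  | .last => 1 / (w (Fin.last _) * w (penult n))

/-- The action of a node on the spectral parameters: `w₁ ↦ 1 / (q⁶ w₁)`, `wᵢ ↔ wᵢ₊₁`, and
`wᵣ₋₁ ↔ 1 / wᵣ`. -/
def reflect {n : ℕ} (q : K) (w : Fin (2 * n + 1) → K) : Node n → (Fin (2 * n + 1) → K)
  | .affine => Function.update w 0 (1 / (q ^ 6 * w 0))
  | .bulk i => fun j => w (Equiv.swap i.castSucc i.succ j)
  | .last => Function.update (Function.update w (penult n) (1 / w (Fin.last _)))
      (Fin.last _) (1 / w (penult n))

/-- The factor by which the equation of a node is normalized, where `m₁` and `mᵣ` are the degrees of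
the solution in `w₁` and in `wᵣ`: `(q³ w₁) ^ m₁`, `1`, `(wᵣ₋₁ wᵣ) ^ mᵣ`. -/
def weight {n : ℕ} (q : K) (m₁ mᵣ : ℕ) (w : Fin (2 * n + 1) → K) : Node n → K
  | .affine => (q ^ 3 * w 0) ^ m₁
  | .bulk _ => 1
  | .last => (w (penult n) * w (Fin.last _)) ^ mᵣ

/-- The trigonometric `R`-matrix `((q u - q⁻¹) + (u - 1) e) / (q - q⁻¹ u)`. -/
noncomputable def rMatrix {ι : Type*} [DecidableEq ι] (q : K) (e : Matrix ι ι K) (u : K) :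
    Matrix ι ι K :=
  (q - q⁻¹ * u)⁻¹ • ((q * u - q⁻¹) • (1 : Matrix ι ι K) + (u - 1) • e)

/-- A vector of polynomials, indexed by the open link patterns, in `w₁, …, wᵣ`, `r = 2 n + 1`. -/
abbrev PolyVector (K : Type*) [Field K] (n : ℕ) : Type _ :=
  OpenLinkPattern (2 * n + 1) → MvPolynomial (Fin (2 * n + 1)) K

/-- The value of a vector of polynomials at a point. -/
noncomputable def value {n : ℕ} (Ψ : PolyVector K n) (w : Fin (2 * n + 1) → K) :
    OpenLinkPattern (2 * n + 1) → K :=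
  fun π => eval w (Ψ π)

/-- The degree of a vector of polynomials in the variable number `j`. -/
noncomputable def partialDegree {n : ℕ} (Ψ : PolyVector K n) (j : Fin (2 * n + 1)) : ℕ :=
  Finset.univ.sup fun π => (Ψ π).degreeOf j

/-- The normalizing factor with the degrees of `Ψ` itself. -/
noncomputable def selfWeight {n : ℕ} (q : K) (Ψ : PolyVector K n) (w : Fin (2 * n + 1) → K)
    (g : Node n) : K :=
  weight q (partialDegree Ψ 0) (partialDegree Ψ (Fin.last _)) w g

/-- `Ψ` solves the level one `D_r` qKZ system, `r = 2 n + 1`. Over an infinite field these identities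
at all points are the same as the identities of rational functions. -/
def IsSolution {n : ℕ} (q : K) (Ψ : PolyVector K n) : Prop :=
  ∀ (g : Node n) (w : Fin (2 * n + 1) → K), (∀ j, w j ≠ 0) →
    q - q⁻¹ * spectral q w g ≠ 0 →
    (selfWeight q Ψ w g)⁻¹ • (rMatrix q (generator q g) (spectral q w g)).mulVec (value Ψ w) =
      value Ψ (reflect q w g)

/-- The equation `wᵣ ^ (-mᵣ) s Ψ(w₁, …, wᵣ) = Ψ(w₁, …, wᵣ₋₁, 1 / wᵣ)`. -/
def SatisfiesInversion {n : ℕ} (Ψ : PolyVector K n) : Prop :=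
  ∀ w : Fin (2 * n + 1) → K, (∀ j, w j ≠ 0) →
    (w (Fin.last _) ^ partialDegree Ψ (Fin.last _))⁻¹ • (sMatrix K n).mulVec (value Ψ w) =
      value Ψ (Function.update w (Fin.last _) (1 / w (Fin.last _)))

/-- The entries of `Ψ` are obtained from the base entry in a triangular way: the patterns can be
listed, beginning with the one that has only open arches, so that for every other pattern `π` the
row of an earlier pattern `ρ` in one equation of the system contains `π` and otherwise only earlier
patterns, and hence expresses the entry of `π` through earlier entries. -/
def IsTriangular {n : ℕ} (q : K) (Ψ : PolyVector K n) : Prop :=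
  ∃ rank : OpenLinkPattern (2 * n + 1) → ℕ, Function.Injective rank ∧
    (∀ π, rank (allOpen _) ≤ rank π) ∧
    ∀ π, π ≠ allOpen _ → ∃ (g : Node n) (ρ : OpenLinkPattern (2 * n + 1)),
      rank ρ < rank π ∧ generator q g ρ π ≠ 0 ∧
      (∀ ρ', generator q g ρ ρ' ≠ 0 → rank ρ' ≤ rank π) ∧
      ∀ w : Fin (2 * n + 1) → K, (∀ j, w j ≠ 0) →
        spectral q w g ≠ 1 → q - q⁻¹ * spectral q w g ≠ 0 →
        value Ψ w π = (generator q g ρ π)⁻¹ *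
          (((q - q⁻¹ * spectral q w g) * selfWeight q Ψ w g * value Ψ (reflect q w g) ρ
              - (q * spectral q w g - q⁻¹) * value Ψ w ρ) / (spectral q w g - 1)
            - ∑ ρ' ∈ Finset.univ.filter (fun ρ' => rank ρ' < rank π),
                generator q g ρ ρ' * value Ψ w ρ')

end

end DqKZ

/-!
The solution is constructed in a spin chain and then transported to link patterns.

*Spin chain.* A coloured diagram is sent to a vector of `(K²)^{⊗ r}`, its `spinTensor`: a solid arch
pairs opposite spins, a dashed arch pairs equal spins, and an open point carries the sum of both
spins. Under this map the generators `eᵢ` become the usual Temperley–Lieb generators of the spin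
chain, `s` reverses the last spin, and `e₀` becomes an operator that acts on the first spin alone
(`spinVector_eMatrix`, `spinVector_sMatrix`, `spinVector_eZeroMatrix`). The map is injective, because
spin tensors are triangular with respect to the configurations with `-` at the right ends of the
arches (`spinVector_injective`).

*Solution in the spin chain.* The exchange relations say that the Temperley–Lieb generators act like
divided differences in the spectral parameters, and the relation for `s` that the reversal of the last
spin acts like the inversion of the last parameter. Divided differences and inversion represent the
Hecke algebra of type `B` with unequal parameters. The Laurent polynomial
`f = ∏ w_j ^ (-n) ∏ (q w_i - q⁻¹ w_j)` is a `q`-eigenfunction of all divided differences, so that it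
generates a family of functions, indexed by spin configurations, that satisfies all these relations
(`isSpinSolution_spinSolution`); the component with all spins `+` is `f`. Conversely, a solution of
the relations is determined by one component (`IsSpinSolution.eq_zero`).

*Descent to link patterns.* It must be shown that this family takes values in the span of the spin
tensors. The operator `chainOp` on the spin chain commutes with the Temperley–Lieb generators and
with the last spin reversal and fixes all spin tensors. Its fixed space has at most the dimension of
the space of patterns: its eigenvalues are `q`-integers whose multiplicities are bounded by numbers of
walks (`finrank_eigenspace_chainOp_le`), and there are enough patterns (`walkCount_le_card`). Hence a
vector fixed by `chainOp` is a combination of spin tensors, at least for `q = 2, 3, …`. The family is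
fixed by `chainOp` since its component with all spins `+` is, which is a linear relation between the
components with at most one spin `-`. These are explicit sums of residues (`spinSolution_flip`), and
the relation is Lagrange interpolation (`sum_residueWeight`). All quantities are Laurent polynomials
in `q`, which gives the result for every `q ≠ 0` (`spinVector_coord_spinSolution`).

*The equation of `e₀`.* The difference of both sides is again a solution of the relations away from
the first point, so that it suffices to look at the components with all spins `+` behind the first
point. The component with all spins `+` is a second case of Lagrange interpolation
(`spinSolution_flip_zero`), and the components with first spin `-` follow because the equation holds
both at a point and at its reflection (`IsGroundVector.affine`). The equation of `e'ᵣ₋₁` is an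
exchange relation between two inversions (`IsGroundVector.last`).

*Degrees, triangularity and minimality.* Divided differences preserve Laurent polynomials with
degrees between `-n` and `n` in each variable (`IsRegular`), which gives polynomials of degree `2 n`.
The order on patterns by the number of closed arches, and then by the binary number formed by the
right ends of the arches, is triangular for the generators (`exists_triangular_row`); hence a solution
is determined by its base entry. The exchange relations force the base entry of any solution to be a
multiple of the `q`-Vandermonde product, where `q ^ 4 ≠ 1` makes its linear factors coprime to those
of the reversed product (`minimality`).
-/

namespace DqKZ

/-! ### Coloured pictures of link patterns -/

/-- The combinatorial description of the coloured pictures of open link patterns: a planar matching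
with a single open point, in which covered arches are solid and all dashed arches lie to the right
of the open point. -/
structure IsColoredPicture {r : ℕ} (D : ColoredDiagram r) : Prop where
  invol : ∀ i, D.1 (D.1 i) = i
  color : ∀ i, D.2 (D.1 i) = D.2 i
  nest : ∀ i j, i < j → j < D.1 i → i < D.1 j ∧ D.1 j < D.1 i ∧ D.1 j ≠ j ∧ D.2 j = false
  exists_open : ∃ o, D.1 o = o
  open_unique : ∀ o o', D.1 o = o → D.1 o' = o' → o = o'
  open_solid : ∀ o, D.1 o = o → D.2 o = false
  open_lt_dashed : ∀ o j, D.1 o = o → D.2 j = true → o < j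

theorem even_card_of_involution {α : Type*} [DecidableEq α] (s : Finset α) (f : α → α)
    (hf : ∀ a ∈ s, f a ∈ s) (hff : ∀ a ∈ s, f (f a) = a) (hne : ∀ a ∈ s, f a ≠ a) :
    Even s.card := by
  have h : ∏ a ∈ s, (-1 : ℤ) = 1 :=
    Finset.prod_involution (fun a _ => f a) (fun a _ => by norm_num)
      (fun a ha _ => hne a ha) (fun a ha => hf a ha) (fun a ha => hff a ha)
  rw [Finset.prod_const] at h
  exact (neg_one_pow_eq_one_iff_even (by norm_num)).1 h

/-- The open points to the right of `b`. -/
abbrev opensAfter {r : ℕ} (π : OpenLinkPattern r) (b : Fin r) : Finset (Fin r) :=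
  Finset.univ.filter fun c => b < c ∧ π.1 c = c

theorem card_opensAfter_of_consecutive {r : ℕ} (π : OpenLinkPattern r) {b c : Fin r} (hbc : b < c)
    (hc : π.1 c = c) (h : ∀ d, b < d → d < c → π.1 d ≠ d) :
    (opensAfter π b).card = (opensAfter π c).card + 1 := by
  have : opensAfter π b = insert c (opensAfter π c) := by
    ext d
    simp only [Finset.mem_filter, Finset.mem_univ, true_and, Finset.mem_insert]
    constructor
    · rintro ⟨h1, h2⟩
      rcases lt_trichotomy d c with h3 | h3 | h3
      · exact absurd h2 (h d h1 h3)
      · exact Or.inl h3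
      · exact Or.inr ⟨h3, h2⟩
    · rintro (rfl | ⟨h1, h2⟩)
      · exact ⟨hbc, hc⟩
      · exact ⟨hbc.trans h1, h2⟩
  rw [this, Finset.card_insert_of_notMem]
  simp

theorem DashedPair.right_unique {r : ℕ} {π : OpenLinkPattern r} {a b b' : Fin r}
    (h : DashedPair π a b) (h' : DashedPair π a b') : b = b' := by
  rcases lt_trichotomy b b' with h1 | h1 | h1
  · exact absurd h.2.2.1 (h'.2.2.2.1 b h.1 h1)
  · exact h1
  · exact absurd h'.2.2.1 (h.2.2.2.1 b' h'.1 h1)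

theorem DashedPair.left_unique {r : ℕ} {π : OpenLinkPattern r} {a a' b : Fin r}
    (h : DashedPair π a b) (h' : DashedPair π a' b) : a = a' := by
  rcases lt_trichotomy a a' with h1 | h1 | h1
  · exact absurd h'.2.1 (h.2.2.2.1 a' h1 h'.1)
  · exact h1
  · exact absurd h.2.1 (h'.2.2.2.1 a h1 h.1)

/-- Consecutive open points are never paired on both sides, by the parity condition. -/
theorem DashedPair.not_chain {r : ℕ} {π : OpenLinkPattern r} {a b c : Fin r}
    (h : DashedPair π a b) (h' : DashedPair π b c) : False := by
  have h1 := card_opensAfter_of_consecutive π h'.1 h'.2.2.1 h'.2.2.2.1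
  have h2 : Even (opensAfter π b).card := h.2.2.2.2
  have h3 : Even (opensAfter π c).card := h'.2.2.2.2
  rw [h1] at h2
  exact (Nat.even_add_one.1 h2) h3

theorem colored_of_dashedPartners {r : ℕ} {π : OpenLinkPattern r} {i j : Fin r}
    (h : dashedPartners π i = {j}) : (colored π).1 i = j ∧ (colored π).2 i = true := by
  simp [colored, h]

theorem dashedPartners_left {r : ℕ} {π : OpenLinkPattern r} {a b : Fin r} (h : DashedPair π a b) :
    dashedPartners π a = {b} := by
  ext c
  simp only [dashedPartners, Finset.mem_filter, Finset.mem_univ, true_and, Finset.mem_singleton]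
  constructor
  · rintro (h' | h')
    · exact h'.right_unique h
    · exact (h'.not_chain h).elim
  · rintro rfl
    exact Or.inl h

theorem dashedPartners_right {r : ℕ} {π : OpenLinkPattern r} {a b : Fin r} (h : DashedPair π a b) :
    dashedPartners π b = {a} := by
  ext c
  simp only [dashedPartners, Finset.mem_filter, Finset.mem_univ, true_and, Finset.mem_singleton]
  constructor
  · rintro (h' | h')
    · exact (h.not_chain h').elim
    · exact h'.left_unique h
  · rintro rfl
    exact Or.inr h

theorem colored_of_forall_not {r : ℕ} {π : OpenLinkPattern r} {i : Fin r}
    (h : ∀ j, ¬ DashedPair π i j ∧ ¬ DashedPair π j i) :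
    (colored π).1 i = π.1 i ∧ (colored π).2 i = false := by
  have : dashedPartners π i = ∅ := by
    ext c; simp [dashedPartners, h c]
  simp [colored, this]

theorem colored_of_closed {r : ℕ} {π : OpenLinkPattern r} {i : Fin r} (hi : π.1 i ≠ i) :
    (colored π).1 i = π.1 i ∧ (colored π).2 i = false :=
  colored_of_forall_not fun _ => ⟨fun h => hi h.2.1, fun h => hi h.2.2.1⟩

/-- A point is the left end or the right end of a dashed arch, or belongs to no dashed arch. -/
theorem colored_cases {r : ℕ} (π : OpenLinkPattern r) (i : Fin r) :
    (∃ j, DashedPair π i j ∧ (colored π).1 i = j ∧ (colored π).2 i = true) ∨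
    (∃ j, DashedPair π j i ∧ (colored π).1 i = j ∧ (colored π).2 i = true) ∨
    ((∀ j, ¬ DashedPair π i j ∧ ¬ DashedPair π j i) ∧ (colored π).1 i = π.1 i ∧
      (colored π).2 i = false) := by
  by_cases h1 : ∃ j, DashedPair π i j
  · obtain ⟨j, hj⟩ := h1
    exact Or.inl ⟨j, hj, colored_of_dashedPartners (dashedPartners_left hj)⟩
  by_cases h2 : ∃ j, DashedPair π j i
  · obtain ⟨j, hj⟩ := h2
    exact Or.inr (Or.inl ⟨j, hj, colored_of_dashedPartners (dashedPartners_right hj)⟩)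
  push Not at h1 h2
  exact Or.inr (Or.inr ⟨fun j => ⟨h1 j, h2 j⟩, colored_of_forall_not fun j => ⟨h1 j, h2 j⟩⟩)

/-- An open point belongs to a dashed arch, unless it is the leftmost one and has an even number of open
points to its right. -/
theorem exists_dashedPair_or {r : ℕ} (π : OpenLinkPattern r) {i : Fin r} (hi : π.1 i = i) :
    (∃ j, DashedPair π i j ∨ DashedPair π j i) ∨
      (Even (opensAfter π i).card ∧ ∀ j, j < i → π.1 j ≠ j) := by
  by_cases hev : Even (opensAfter π i).card
  · by_cases hl : ∃ j, j < i ∧ π.1 j = j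
    · left
      have hne : (Finset.univ.filter fun j => j < i ∧ π.1 j = j).Nonempty := by
        obtain ⟨j, hj⟩ := hl; exact ⟨j, by simpa using hj⟩
      have hm := Finset.max'_mem _ hne
      have hM := fun d hd => Finset.le_max' (Finset.univ.filter fun j => j < i ∧ π.1 j = j) d hd
      set a := Finset.max' _ hne
      simp only [Finset.mem_filter, Finset.mem_univ, true_and] at hm hM
      refine ⟨a, Or.inr ⟨hm.1, hm.2, hi, fun c hc hc' h => ?_, hev⟩⟩
      exact absurd (hM c ⟨hc', h⟩) (not_le.2 hc)
    · right
      exact ⟨hev, fun j hj h => hl ⟨j, hj, h⟩⟩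
  · left
    have hne : (opensAfter π i).Nonempty := by
      rw [Finset.nonempty_iff_ne_empty]; rintro h; simp [h] at hev
    have hm := Finset.min'_mem _ hne
    have hM := fun d hd => Finset.min'_le (opensAfter π i) d hd
    set a := Finset.min' _ hne
    simp only [opensAfter, Finset.mem_filter, Finset.mem_univ, true_and] at hm hM
    have hcons : ∀ d, i < d → d < a → π.1 d ≠ d := fun d h1 h2 h3 =>
      absurd (hM d ⟨h1, h3⟩) (not_le.2 h2)
    refine ⟨a, Or.inl ⟨hm.1, hi, hm.2, hcons, ?_⟩⟩
    have := card_opensAfter_of_consecutive π hm.1 hm.2 hcons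
    by_contra hc
    exact hev (by rw [this]; exact Nat.even_add_one.2 hc)

/-- On an odd number of points there is an odd number of open arches. -/
theorem odd_card_opens {n : ℕ} (π : OpenLinkPattern (2 * n + 1)) :
    Odd (Finset.univ.filter fun c => π.1 c = c).card := by
  have h := Finset.card_filter_add_card_filter_not (s := (Finset.univ : Finset (Fin (2 * n + 1))))
    (fun c => π.1 c = c)
  have h2 : Even (Finset.univ.filter fun c => ¬ π.1 c = c).card := by
    apply even_card_of_involution _ π.1
    · intro a ha
      simp only [Finset.mem_filter, Finset.mem_univ, true_and] at ha ⊢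
      rw [π.2.1]; exact fun h => ha h.symm
    · intro a _; exact π.2.1 a
    · intro a ha; simpa using ha
  rw [Finset.card_univ, Fintype.card_fin] at h
  rcases Nat.even_or_odd (Finset.univ.filter fun c => π.1 c = c).card with h3 | h3
  · exfalso
    have := h3.add h2
    rw [h] at this
    exact absurd this (by simp)
  · exact h3

/-- The leftmost open point is the one that stays open in the coloured picture. -/
theorem exists_leftmost_open {n : ℕ} (π : OpenLinkPattern (2 * n + 1)) :
    ∃ o, π.1 o = o ∧ (∀ j, j < o → π.1 j ≠ j) ∧ Even (opensAfter π o).card := by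
  have hodd := odd_card_opens π
  have hne : (Finset.univ.filter fun c => π.1 c = c).Nonempty := by
    rw [← Finset.card_pos]; exact hodd.pos
  have hm := Finset.min'_mem _ hne
  have hM := fun d hd => Finset.min'_le (Finset.univ.filter fun c => π.1 c = c) d hd
  set a := Finset.min' _ hne
  simp only [Finset.mem_filter, Finset.mem_univ, true_and] at hm hM
  refine ⟨a, hm, fun j hj h => absurd (hM j h) (not_le.2 hj), ?_⟩
  have : (Finset.univ.filter fun c => π.1 c = c) = insert a (opensAfter π a) := by
    ext d
    simp only [Finset.mem_filter, Finset.mem_univ, true_and, Finset.mem_insert]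
    constructor
    · intro h
      rcases (hM d h).lt_or_eq with h1 | h1
      · exact Or.inr ⟨h1, h⟩
      · exact Or.inl h1.symm
    · rintro (rfl | h)
      · exact hm
      · exact h.2
  rw [this, Finset.card_insert_of_notMem (by simp), Nat.odd_add_one] at hodd
  exact Nat.not_odd_iff_even.1 hodd

theorem not_dashedPair_of_leftmost {r : ℕ} {π : OpenLinkPattern r} {o : Fin r}
    (h1 : ∀ j, j < o → π.1 j ≠ j) (h2 : Even (opensAfter π o).card) (j : Fin r) :
    ¬ DashedPair π o j ∧ ¬ DashedPair π j o := by
  constructor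
  · intro h
    have h3 := card_opensAfter_of_consecutive π h.1 h.2.2.1 h.2.2.2.1
    have h4 : Even (opensAfter π j).card := h.2.2.2.2
    rw [h3] at h2
    exact Nat.even_add_one.1 h2 h4
  · intro h
    exact h1 j h.1 h.2.1

theorem isColoredPicture_colored {n : ℕ} (π : OpenLinkPattern (2 * n + 1)) :
    IsColoredPicture (colored π) := by
  obtain ⟨o, ho, hol, hev⟩ := exists_leftmost_open π
  have hod := not_dashedPair_of_leftmost hol hev
  have hco := colored_of_forall_not hod
  -- the fixed points of the coloured picture
  have hfix : ∀ i, (colored π).1 i = i → i = o := by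
    intro i hi
    rcases colored_cases π i with ⟨j, h, h', _⟩ | ⟨j, h, h', _⟩ | ⟨h, h', _⟩
    · rw [hi] at h'; subst h'; exact absurd h.1 (lt_irrefl _)
    · rw [hi] at h'; subst h'; exact absurd h.1 (lt_irrefl _)
    · rw [hi] at h'
      rcases exists_dashedPair_or π h'.symm with ⟨j, hj⟩ | ⟨_, h2⟩
      · exact absurd hj (not_or.2 (h j))
      · rcases lt_trichotomy i o with h3 | h3 | h3
        · exact absurd h'.symm (hol i h3)
        · exact h3
        · exact absurd ho (h2 o h3)
  have hdash : ∀ i, (colored π).2 i = true → π.1 i = i ∧ i ≠ o := by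
    intro i hi
    rcases colored_cases π i with ⟨j, h, _⟩ | ⟨j, h, _⟩ | ⟨_, _, h⟩
    · exact ⟨h.2.1, by rintro rfl; exact (hod j).1 h⟩
    · exact ⟨h.2.2.1, by rintro rfl; exact (hod j).2 h⟩
    · rw [h] at hi; cases hi
  refine ⟨?_, ?_, ?_, ⟨o, hco.1.trans ho⟩, fun a b ha hb => (hfix a ha).trans (hfix b hb).symm, ?_, ?_⟩
  · intro i
    rcases colored_cases π i with ⟨j, h, h', _⟩ | ⟨j, h, h', _⟩ | ⟨_, h', _⟩
    · rw [h', (colored_of_dashedPartners (dashedPartners_right h)).1]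
    · rw [h', (colored_of_dashedPartners (dashedPartners_left h)).1]
    · by_cases hi : π.1 i = i
      · rw [h', hi, h', hi]
      · rw [h', (colored_of_closed (by rw [π.2.1]; exact Ne.symm hi)).1, π.2.1]
  · intro i
    rcases colored_cases π i with ⟨j, h, h', h''⟩ | ⟨j, h, h', h''⟩ | ⟨_, h', h''⟩
    · rw [h', h'', (colored_of_dashedPartners (dashedPartners_right h)).2]
    · rw [h', h'', (colored_of_dashedPartners (dashedPartners_left h)).2]
    · by_cases hi : π.1 i = i
      · rw [h', hi]
      · rw [h', h'', (colored_of_closed (by rw [π.2.1]; exact Ne.symm hi)).2]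
  · intro i j hij hj
    rcases colored_cases π i with ⟨k, h, h', _⟩ | ⟨k, h, h', _⟩ | ⟨_, h', _⟩
    · rw [h'] at hj ⊢
      have hjc := h.2.2.2.1 j hij hj
      obtain ⟨c1, c2⟩ := colored_of_closed hjc
      rw [c1]
      -- the arch at `j` can not cover an end of the dashed arch
      have hjj := π.2.1 j
      refine ⟨?_, ?_, hjc, c2⟩
      · by_contra hlt
        have hne : π.1 j ≠ i := by
          intro h2; rw [h2] at hjj; exact hij.ne (h.2.1.symm.trans hjj)
        have h3 := (π.2.2 (π.1 j) i (lt_of_le_of_ne (not_lt.1 hlt) hne) (by rw [hjj]; exact hij)).2.2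
        exact h3 h.2.1
      · by_contra hlt
        have hne : π.1 j ≠ k := by
          intro h2; rw [h2] at hjj; exact hj.ne (hjj.symm.trans h.2.2.1)
        have h3 := (π.2.2 j k hj (lt_of_le_of_ne (not_lt.1 hlt) hne.symm)).2.2
        exact h3 h.2.2.1
    · rw [h'] at hj; exact absurd (hij.trans hj) (not_lt.2 h.1.le)
    · rw [h'] at hj ⊢
      obtain ⟨h1, h2, h3⟩ := π.2.2 i j hij hj
      obtain ⟨c1, c2⟩ := colored_of_closed h3
      rw [c1]; exact ⟨h1, h2, h3, c2⟩
  · intro i hi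
    rw [hfix i hi]; exact hco.2
  · intro i j hi hj
    rw [hfix i hi]
    obtain ⟨h1, h2⟩ := hdash j hj
    rcases lt_trichotomy j o with h3 | h3 | h3
    · exact absurd h1 (hol j h3)
    · exact absurd h3 h2
    · exact h3

/-- Every picture that satisfies the combinatorial conditions is the coloured picture of the open
link pattern in which its dashed arches are opened. -/
theorem IsColoredPicture.exists_colored_eq {r : ℕ} {D : ColoredDiagram r}
    (hD : IsColoredPicture D) : ∃ π : OpenLinkPattern r, colored π = D := by
  obtain ⟨σ, c⟩ := D
  obtain ⟨h1, h2, h3, ⟨o, h4⟩, h5, h6, h7⟩ := hD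
  simp only at h1 h2 h3 h4 h5 h6 h7
  let π : OpenLinkPattern r := ⟨fun i => if c i then i else σ i, by
    constructor
    · intro i
      dsimp only
      by_cases hi : c i = true
      · simp [hi]
      · have : ¬ c (σ i) = true := by rw [h2]; exact hi
        simp [hi, this, h1]
    · intro i j hij hj
      dsimp only at hj ⊢
      by_cases hi : c i = true
      · simp only [hi, if_true] at hj; exact absurd hij (not_lt.2 hj.le)
      · simp only [hi] at hj ⊢
        obtain ⟨a1, a2, a3, a4⟩ := h3 i j hij hj
        simpa [a4] using ⟨a1, a2, a3⟩⟩
  have hπ : ∀ i, π.1 i = if c i then i else σ i := fun i => rfl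
  have hopen : ∀ i, π.1 i = i ↔ (c i = true ∨ i = o) := by
    intro i
    rw [hπ]
    by_cases hi : c i = true
    · simp [hi]
    · simp only [hi]
      exact ⟨fun h => Or.inr (h5 i o h h4), fun h => by
        rcases h with h | rfl
        · cases h
        · exact h4⟩
  have hne : ∀ i, c i = true → σ i ≠ i := fun i hi h => by rw [h6 i h] at hi; cases hi
  -- the dashed pairs of `π` are the dashed arches of `D`: by planarity an arch over consecutive open
  -- points is the expected one, and the parity holds since dashed arches pair off the points beyond
  have hpair : ∀ a b, DashedPair π a b ↔ (a < b ∧ c a = true ∧ σ a = b) := by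
    intro a b
    constructor
    · rintro ⟨hab, ha, hb, hcons, hev⟩
      have hbo : b ≠ o := by
        rintro rfl
        rcases (hopen a).1 ha with h | h
        · exact absurd (h7 b a h4 h) (not_lt.2 hab.le)
        · exact hab.ne h
      have hcb : c b = true := by
        rcases (hopen b).1 hb with h | h
        · exact h
        · exact absurd h hbo
      have hob := h7 o b h4 hcb
      have hσb : σ b < b := by
        by_contra hlt
        have hlt : b < σ b := lt_of_le_of_ne (not_lt.1 hlt) (hne b hcb).symm
        have hcσ : c (σ b) = true := by rw [h2]; exact hcb
        have he : Even ((opensAfter π b).erase (σ b)).card := by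
          apply even_card_of_involution _ σ
          · intro x hx
            simp only [Finset.mem_erase, Finset.mem_filter, Finset.mem_univ, true_and, hopen] at hx ⊢
            obtain ⟨hx1, hx2, hx3⟩ := hx
            have hcx : c x = true := by
              rcases hx3 with h | h
              · exact h
              · exact absurd (h ▸ hx2) (not_lt.2 hob.le)
            refine ⟨fun h => ?_, ?_, Or.inl (by rw [h2]; exact hcx)⟩
            · have := congrArg σ h; rw [h1, h1] at this; exact hx2.ne this.symm
            · rcases lt_trichotomy (σ x) b with h | h | h
              · have := (h3 (σ x) b h (by rw [h1]; exact hx2)).2.2.2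
                rw [this] at hcb; cases hcb
              · exact absurd (by rw [← h, h1]) hx1
              · exact h
          · intro x _; exact h1 x
          · intro x hx
            simp only [Finset.mem_erase, Finset.mem_filter, Finset.mem_univ, true_and, hopen] at hx
            rcases hx.2.2 with h | h
            · exact hne x h
            · exact absurd (h ▸ hx.2.1) (not_lt.2 hob.le)
        have hmem : σ b ∈ opensAfter π b := by
          simp only [Finset.mem_filter, Finset.mem_univ, true_and, hopen]
          exact ⟨hlt, Or.inl hcσ⟩
        have := Finset.card_erase_add_one hmem
        change Even (opensAfter π b).card at hev
        rw [← this] at hev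
        exact Nat.even_add_one.1 hev he
      have hba : σ b = a := by
        rcases lt_trichotomy (σ b) a with h | h | h
        · have := h3 (σ b) a h (by rw [h1]; exact hab)
          rcases (hopen a).1 ha with h' | rfl
          · rw [this.2.2.2] at h'; cases h'
          · exact absurd h4 this.2.2.1
        · exact h
        · exact absurd ((hopen (σ b)).2 (Or.inl (by rw [h2]; exact hcb))) (hcons _ h hσb)
      refine ⟨hab, ?_, ?_⟩
      · rw [← hba, h2]; exact hcb
      · rw [← hba, h1]
    · rintro ⟨hab, hca, rfl⟩
      have hcb : c (σ a) = true := by rw [h2]; exact hca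
      have hoa := h7 o a h4 hca
      refine ⟨hab, (hopen a).2 (Or.inl hca), (hopen _).2 (Or.inl hcb), ?_, ?_⟩
      · intro d hd hd' h
        have := h3 a d hd hd'
        rcases (hopen d).1 h with h' | rfl
        · rw [this.2.2.2] at h'; cases h'
        · exact this.2.2.1 h4
      · apply even_card_of_involution _ σ
        · intro x hx
          simp only [Finset.mem_filter, Finset.mem_univ, true_and, hopen] at hx ⊢
          obtain ⟨hx2, hx3⟩ := hx
          have hcx : c x = true := by
            rcases hx3 with h | h
            · exact h
            · exact absurd (h ▸ hx2) (not_lt.2 (hoa.trans hab).le)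
          refine ⟨?_, Or.inl (by rw [h2]; exact hcx)⟩
          rcases lt_trichotomy (σ x) (σ a) with h | h | h
          · have := (h3 (σ x) (σ a) h (by rw [h1]; exact hx2)).2.2.2
            rw [this] at hcb; cases hcb
          · have := congrArg σ h; rw [h1, h1] at this
            subst this; exact absurd (hab.trans hx2) (lt_irrefl _)
          · exact h
        · intro x _; exact h1 x
        · intro x hx
          simp only [Finset.mem_filter, Finset.mem_univ, true_and, hopen] at hx
          rcases hx.2 with h | h
          · exact hne x h
          · exact absurd (h ▸ hx.1) (not_lt.2 (hoa.trans hab).le)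
  refine ⟨π, ?_⟩
  have key : ∀ i, (colored π).1 i = σ i ∧ (colored π).2 i = c i := by
    intro i
    by_cases hi : c i = true
    · rcases lt_trichotomy i (σ i) with h | h | h
      · have := colored_of_dashedPartners (dashedPartners_left ((hpair i (σ i)).2 ⟨h, hi, rfl⟩))
        exact ⟨this.1, this.2.trans hi.symm⟩
      · exact absurd h.symm (hne i hi)
      · have := colored_of_dashedPartners (dashedPartners_right
          ((hpair (σ i) i).2 ⟨h, by rw [h2]; exact hi, h1 i⟩))
        exact ⟨this.1, this.2.trans hi.symm⟩
    · have := colored_of_forall_not (π := π) (i := i) fun j => by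
        rw [hpair, hpair]
        refine ⟨fun h => hi h.2.1, fun h => hi ?_⟩
        rw [← h.2.2, h2]; exact h.2.1
      refine ⟨by rw [this.1, hπ]; simp [hi], by rw [this.2]; simpa using hi⟩
  exact Prod.ext (funext fun i => (key i).1) (funext fun i => (key i).2)

theorem isOpen_iff_colored {r : ℕ} {π : OpenLinkPattern r} {i : Fin r} :
    π.1 i = i ↔ ((colored π).2 i = true ∨ (colored π).1 i = i) := by
  rcases colored_cases π i with ⟨j, h, h', h''⟩ | ⟨j, h, h', h''⟩ | ⟨_, h', h''⟩
  · simp [h'', h.2.1]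
  · simp [h'', h.2.2.1]
  · simp [h'', h']

theorem pattern_eq_of_colored {r : ℕ} (π : OpenLinkPattern r) (i : Fin r) :
    π.1 i = if (colored π).2 i then i else (colored π).1 i := by
  by_cases h : (colored π).2 i = true
  · simp only [h, if_true]; exact isOpen_iff_colored.2 (Or.inl h)
  · rcases colored_cases π i with ⟨j, _, _, h''⟩ | ⟨j, _, _, h''⟩ | ⟨_, h', _⟩
    · exact absurd h'' h
    · exact absurd h'' h
    · simp [h, h']

theorem colored_injective {r : ℕ} : Function.Injective (colored (r := r)) := by
  intro π π' h
  apply Subtype.ext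
  funext i
  rw [pattern_eq_of_colored, pattern_eq_of_colored, h]

/-! ### Operations on coloured pictures -/

theorem isColoredPicture_switchLast {n : ℕ} {D : ColoredDiagram (2 * n + 1)}
    (hD : IsColoredPicture D) : IsColoredPicture (switchLast D) := by
  unfold switchLast
  split_ifs with hl
  · exact hD
  obtain ⟨σ, c⟩ := D
  obtain ⟨h1, h2, h3, ⟨o, h4⟩, h5, h6, h7⟩ := hD
  simp only at *
  have hle : ∀ i : Fin (2 * n + 1), i ≤ Fin.last _ := Fin.le_last
  refine ⟨h1, ?_, ?_, ⟨o, h4⟩, h5, ?_, ?_⟩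
  · grind
  · intro i j hij hj
    obtain ⟨a1, a2, a3, a4⟩ := h3 i j hij hj
    have hjl : j ≠ Fin.last _ := fun h => absurd (hj.trans_le (hle _)) (by rw [h]; exact lt_irrefl _)
    have hjl' : j ≠ σ (Fin.last _) := by
      rintro rfl
      rw [h1] at a2
      exact absurd (hle (σ i)) (not_le.2 a2)
    simp [hjl, hjl', a1, a2, a3, a4]
  · grind
  · intro p j hp hj
    by_cases hjl : j = Fin.last _ ∨ j = σ (Fin.last _)
    · have hlo : Fin.last _ ≠ p := by grind
      have := lt_of_le_of_ne (hle p) hlo.symm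
      rcases hjl with rfl | rfl
      · exact this
      · by_contra hlt
        rcases (not_lt.1 hlt).lt_or_eq with h | h
        · have := h3 (σ (Fin.last _)) p h (by rw [h1]; exact this)
          exact this.2.2.1 hp
        · grind
    · simp only [hjl, if_false] at hj
      exact h7 p j hp hj

theorem isColoredPicture_cutFirst {n : ℕ} {D : ColoredDiagram (2 * n + 1)}
    (hD : IsColoredPicture D) (h0 : D.1 0 ≠ 0) {o : Fin (2 * n + 1)} (ho : D.1 o = o) (c : Bool) :
    IsColoredPicture (cutFirst D o c) := by
  obtain ⟨σ, k⟩ := D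
  obtain ⟨h1, h2, h3, -, h5, h6, h7⟩ := hD
  simp only [cutFirst] at *
  have hpos : ∀ i : Fin (2 * n + 1), i ≠ 0 → 0 < i := fun i hi => Fin.pos_of_ne_zero hi
  have hnn : ∀ i : Fin (2 * n + 1), ¬ i < 0 := fun i => Fin.not_lt_zero i
  generalize (0 : Fin (2 * n + 1)) = z at *
  have hzo : σ z < o := by
    have hoz : o ≠ z := fun h => h0 (h ▸ ho)
    rcases lt_trichotomy (σ z) o with h | h | h
    · exact h
    · exact absurd (by rw [← h, h1] at ho; exact ho.symm) h0
    · exact absurd ho (h3 z o (hpos _ hoz) h).2.2.1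
  refine ⟨?_, ?_, ?_, ⟨z, by simp⟩, ?_, ?_, ?_⟩
  · grind
  · grind
  · intro i j hij hj
    have hjz : j ≠ z := fun h => hnn i (h ▸ hij)
    by_cases hiz : i = z
    · simp only [hiz, if_true] at hj; exact absurd hj (hnn j)
    by_cases hi1 : i = σ z
    · subst hi1
      simp only [h0, if_false, if_true] at hj ⊢
      have hjs := hij.ne'
      have hjo := hj.ne
      simp only [hjz, hjs, hjo, if_false, or_self]
      have hfix : σ j ≠ j := fun h => hjo (h5 j o h ho)
      have e1 := h3 j o hj
      have e2 := h3 (σ j) (σ z)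
      rw [h1, h1] at e2
      have e3 := h7 o j ho
      have e4 : σ j ≠ σ z := fun h => hjz (by rw [← h1 j, h, h1])
      have e5 : σ j ≠ o := fun h => hjo (by rw [← h1 j, h, ho])
      grind
    by_cases hio : i = o
    · simp only [hio, if_true] at hj
      rw [if_neg (by grind), if_neg (by grind)] at hj
      exact absurd (hzo.trans (hio ▸ hij)) (not_lt.2 hj.le)
    · simp only [hiz, hi1, hio, if_false] at hj ⊢
      obtain ⟨a1, a2, a3, a4⟩ := h3 i j hij hj
      have hjo : j ≠ o := by rintro rfl; exact a3 ho
      have hjs : j ≠ σ z := by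
        rintro rfl; rw [h1] at a1; exact hnn _ a1
      simp only [hjz, hjo, hjs, if_false, or_self]
      exact ⟨a1, a2, a3, a4⟩
  · grind
  · grind
  · grind

/-- The arches of a planar matching stay nested when the arches at two neighbouring points `a < b`
are glued. -/
theorem nest_glue {r : ℕ} {σ : Fin r → Fin r} {k : Fin r → Bool} (h1 : ∀ i, σ (σ i) = i)
    (h3 : ∀ i j, i < j → j < σ i → i < σ j ∧ σ j < σ i ∧ σ j ≠ j ∧ k j = false)
    {a b : Fin r} (hab : a < b) (hcov : ∀ c, a < c → b ≤ c) (hne : σ a ≠ b)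
    (i j : Fin r) (hij : i < j) (hj : j < (join (σ, k) a b).1 i) :
    i < (join (σ, k) a b).1 j ∧ (join (σ, k) a b).1 j < (join (σ, k) a b).1 i ∧
      (join (σ, k) a b).1 j ≠ j ∧ (join (σ, k) a b).2 j = false := by
  have ea := h1 a
  have eb := h1 b
  have hinj : ∀ u v, σ u = v → u = σ v := fun u v h => by rw [← h, h1]
  have hne' : σ b ≠ a := fun h => hne (hinj b a h).symm
  have hxy : σ a ≠ σ b := fun h => hab.ne (by rw [← h1 a, h, h1])
  have hba := hab.ne'
  by_cases hia : i = a
  · subst hia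
    simp [join] at hj
    exact absurd (hcov j hij) (not_le.2 hj)
  by_cases hib : i = b
  · subst hib
    simp [join, hba] at hj
    exact absurd (hab.trans (hij.trans hj)) (lt_irrefl _)
  -- the glued arch, starting at the former partner of `a`
  by_cases hix : i = σ a
  · subst hix
    by_cases hyb : σ b = b
    · simp [join, hia, hib, hyb] at hj
      exact absurd hij (not_lt.2 hj.le)
    simp only [join, hia, hib, hyb, if_false, if_true] at hj ⊢
    have f1 := h3 (σ a) (σ b)
    have f2 := h3 b (σ a)
    have f3 := h3 (σ a) j hij
    have f4 := h3 b j
    rw [ea] at f1 f3 f2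
    rw [eb] at f1
    have hC : σ a < a ∧ b < σ b := by
      have c1 := hcov (σ a)
      have c2 := hcov (σ b)
      grind
    have hjy := hj.ne
    have hjx := hij.ne'
    by_cases hja : j = a
    · subst hja; simp only [if_true]; exact ⟨hC.1.trans hab, hC.2, hba, by simp⟩
    by_cases hjb : j = b
    · subst hjb; simp only [hja, if_true, if_false]
      exact ⟨hC.1, hab.trans hC.2, hab.ne, by simp⟩
    simp only [hja, hjb, hjx, hjy, if_false, or_self]
    have hjx' : σ j ≠ σ b := fun h => hjb (by rw [← h1 j, h, h1])
    rcases lt_trichotomy j a with h | h | h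
    · obtain ⟨g1, g2, g3, g4⟩ := f3 h
      exact ⟨g1, g2.trans (hab.trans hC.2), g3, g4⟩
    · exact absurd h hja
    · have hbj := lt_of_le_of_ne (hcov j h) (Ne.symm hjb)
      obtain ⟨g1, g2, g3, g4⟩ := f4 hbj hj
      exact ⟨hC.1.trans (hab.trans g1), g2, g3, g4⟩
  -- the glued arch, starting at the former partner of `b`
  by_cases hiy : i = σ b
  · subst hiy
    by_cases hxa : σ a = a
    · simp [join, hia, hib, hxa] at hj
      exact absurd hij (not_lt.2 hj.le)
    simp only [join, hia, hib, hxy.symm, hxa, if_false, if_true] at hj ⊢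
    have f1 := h3 (σ b) a
    have f2 := h3 a b hab
    have f3 := h3 (σ b) j hij
    have f4 := h3 a j
    have f5 := h3 j (σ a)
    have f6 := h3 (σ j) (σ b)
    rw [eb] at f1 f3 f6
    rw [ea] at f5
    rw [h1 j] at f6
    have hja : j ≠ a := by rintro rfl; have := hcov (σ j); grind
    have hjb : j ≠ b := by rintro rfl; grind
    have hjx := hj.ne
    have hjy := hij.ne'
    simp only [hja, hjb, hjx, hjy, if_false, or_self]
    have g1 : σ j ≠ σ a := fun h => hja (by rw [← h1 j, h, h1])
    have g2 : σ j ≠ σ b := fun h => hjb (by rw [← h1 j, h, h1])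
    have c1 := hcov (σ j)
    have c2 := hcov (σ b)
    have c3 := hcov (σ a)
    rcases lt_trichotomy (σ b) a with h | h | h
    · have hxa' : σ a < a := by grind
      have := f3 (by grind)
      refine ⟨this.1, ?_, this.2.2⟩
      by_contra hlt
      have := f5 hj (lt_of_le_of_ne (not_lt.1 hlt) g1.symm)
      grind
    · exact absurd h hne'
    · have hb : b < σ b := by
        refine lt_of_le_of_ne (c2 h) fun hb => ?_
        have := f2 (by grind)
        exact this.2.2.1 hb.symm
      have := f4 (by grind) hj
      refine ⟨?_, this.2⟩
      by_contra hlt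
      have := f6 (lt_of_le_of_ne (not_lt.1 hlt) g2) hij
      grind
  -- an arch that is not affected by the gluing covers both of `a`, `b` or none of them
  have hi' : (join (σ, k) a b).1 i = σ i := by simp [join, hia, hib, hix, hiy]
  rw [hi'] at hj ⊢
  obtain ⟨e1, e2, e3, e4⟩ := h3 i j hij hj
  have s1 : σ i ≠ a := fun h => hix (hinj _ _ h)
  have s2 : σ i ≠ b := fun h => hiy (hinj _ _ h)
  have ha : i < a → a < σ i → i < b ∧ b < σ i := fun h h' =>
    ⟨h.trans hab, lt_of_le_of_ne (hcov _ h') s2.symm⟩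
  have hb : i < b → b < σ i → i < a ∧ a < σ i := fun h h' => by
    refine ⟨lt_of_le_of_ne (not_lt.1 fun h2 => ?_) hia, hab.trans h'⟩
    exact absurd (hcov i h2) (not_le.2 h)
  by_cases hja : j = a
  · subst hja
    have := ha hij hj
    simp only [join, if_true]; exact ⟨this.1, this.2, hba, by simp⟩
  by_cases hjb : j = b
  · subst hjb
    have := hb hij hj
    simp only [join, hja, if_true, if_false]; exact ⟨this.1, this.2, hab.ne, by simp⟩
  by_cases hjx : j = σ a
  · subst hjx
    rw [ea] at e1 e2 e3
    obtain ⟨b1, b2⟩ := ha e1 e2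
    obtain ⟨d1, d2, d3, d4⟩ := h3 i b b1 b2
    obtain ⟨c1, c2, c3, c4⟩ := h3 i a e1 e2
    simp only [join, hja, hjb, d3, d4, c4, if_true, if_false, or_self]
    exact ⟨d1, d2, hxy.symm, by simp⟩
  by_cases hjy : j = σ b
  · subst hjy
    rw [eb] at e1 e2 e3
    obtain ⟨b1, b2⟩ := hb e1 e2
    obtain ⟨d1, d2, d3, d4⟩ := h3 i a b1 b2
    obtain ⟨c1, c2, c3, c4⟩ := h3 i b e1 e2
    simp only [join, hja, hjb, hjx, d3, d4, c4, if_true, if_false, or_true, or_self]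
    exact ⟨d1, d2, hxy, by simp⟩
  simp only [join, hja, hjb, hjx, hjy, if_false, or_self]
  exact ⟨e1, e2, e3, e4⟩

theorem isColoredPicture_join {r : ℕ} {D : ColoredDiagram r}
    (hD : IsColoredPicture D) {a b : Fin r} (hab : a < b) (hcov : ∀ c, a < c → b ≤ c)
    (hne : D.1 a ≠ b) : IsColoredPicture (join D a b) := by
  obtain ⟨σ, k⟩ := D
  obtain ⟨h1, h2, h3, ⟨o, h4⟩, h5, h6, h7⟩ := hD
  refine ⟨?_, ?_, nest_glue h1 h3 hab hcov hne, ?_, ?_, ?_, ?_⟩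
  all_goals simp only [join] at *
  · grind
  · grind
  · by_cases h : o = a
    · exact ⟨σ b, by grind⟩
    · by_cases h : o = b
      · exact ⟨σ a, by grind⟩
      · exact ⟨o, by grind⟩
  · grind
  · grind
  · intro p j hp hj
    have hja : j ≠ a := by rintro rfl; simp at hj
    have hjb : j ≠ b := by rintro rfl; simp at hj
    have hpa : p ≠ a := by rintro rfl; simp at hp; exact hab.ne' hp
    have hpb : p ≠ b := by rintro rfl; simp [hpa] at hp; exact hpa hp.symm
    have ea := h1 a
    have eb := h1 b
    have xa := h3 a b hab
    have yb := h3 (σ b) a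
    rw [eb] at yb
    have cj := hcov j
    have cx := hcov (σ a)
    have cy := hcov (σ b)
    simp only [hja, hjb, hpa, hpb, if_false, or_self] at hj hp
    by_cases hjc : j = σ a ∨ j = σ b
    · simp only [hjc, if_true] at hj
      by_cases ho : σ a = a ∨ σ b = b
      · simp [ho] at hj
      simp only [ho, if_false] at hj
      have hp' : σ p = p := by grind
      have ga := h7 p a hp'
      have gb := h7 p b hp'
      have gx := h7 p (σ a) hp'
      have gy := h7 p (σ b) hp'
      rw [h2] at gx gy
      have tx := h3 (σ a) p
      have ty := h3 (σ b) p
      rw [ea] at tx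
      rw [eb] at ty
      have cp := hcov p
      clear h3 h7 h5 h6 hcov
      rcases hka : k a <;> rcases hkb : k b <;> simp only [hka, hkb] at * <;> grind
    · simp only [hjc, if_false] at hj
      have hjx : j ≠ σ a := fun h => hjc (Or.inl h)
      have hjy : j ≠ σ b := fun h => hjc (Or.inr h)
      by_cases hpx : p = σ a
      · have hb : σ b = b := by by_contra hb; simp [hpx, hb] at hp; grind
        have := h7 b j hb hj
        grind
      by_cases hpy : p = σ b
      · have ha : σ a = a := by by_contra ha; simp [hpy, ha] at hp; grind
        have g1 := h7 a j ha hj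
        have g2 := h3 b j
        grind
      · simp only [hpx, hpy, if_false] at hp
        exact h7 p j hp hj

/-! ### The triangular order on the patterns -/

theorem succ_le_of_castSucc_lt {m : ℕ} (i : Fin m) (c : Fin (m + 1)) (h : i.castSucc < c) :
    i.succ ≤ c := Fin.castSucc_lt_iff_succ_le.1 h

theorem exists_colored_eq_join {n : ℕ} (π : OpenLinkPattern (2 * n + 1)) (i : Fin (2 * n))
    (h : (colored π).1 i.castSucc ≠ i.succ) :
    ∃ ρ : OpenLinkPattern (2 * n + 1), colored ρ = join (colored π) i.castSucc i.succ :=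
  (isColoredPicture_join (isColoredPicture_colored π) (Fin.castSucc_lt_succ)
    (succ_le_of_castSucc_lt i) h).exists_colored_eq

theorem exists_colored_eq_switchLast {n : ℕ} (π : OpenLinkPattern (2 * n + 1)) :
    ∃ ρ : OpenLinkPattern (2 * n + 1), colored ρ = switchLast (colored π) :=
  (isColoredPicture_switchLast (isColoredPicture_colored π)).exists_colored_eq

theorem exists_colored_eq_cutFirst {n : ℕ} (π : OpenLinkPattern (2 * n + 1))
    (h0 : (colored π).1 0 ≠ 0) {o : Fin (2 * n + 1)} (ho : (colored π).1 o = o) (c : Bool) :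
    ∃ ρ : OpenLinkPattern (2 * n + 1), colored ρ = cutFirst (colored π) o c :=
  (isColoredPicture_cutFirst (isColoredPicture_colored π) h0 ho c).exists_colored_eq

/-- The number of points on closed arches. -/
def closedCard {r : ℕ} (π : OpenLinkPattern r) : ℕ := (Finset.univ.filter fun p => π.1 p ≠ p).card

/-- The right end points of the closed arches. -/
def closers {r : ℕ} (π : OpenLinkPattern r) : Finset (Fin r) := Finset.univ.filter fun p => π.1 p < p

/-- The right end points of the closed arches, read as the binary digits of a number. -/
def closerWeight {r : ℕ} (π : OpenLinkPattern r) : ℕ := ∑ p ∈ closers π, 2 ^ (p : ℕ)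

theorem mem_closers {r : ℕ} {π : OpenLinkPattern r} {p : Fin r} : p ∈ closers π ↔ π.1 p < p := by
  simp [closers]

theorem sum_two_pow_lt {r : ℕ} (s : Finset (Fin r)) (m : ℕ) (h : ∀ p ∈ s, (p : ℕ) < m) :
    ∑ p ∈ s, 2 ^ (p : ℕ) < 2 ^ m := by
  have := Nat.geomSum_lt (m := 2) (n := m) (s := s.image fun p : Fin r => (p : ℕ)) le_rfl
    (by simpa using h)
  rwa [Finset.sum_image (fun a _ b _ h => Fin.ext h)] at this

theorem closerWeight_lt {r : ℕ} (π : OpenLinkPattern r) : closerWeight π < 2 ^ r :=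
  sum_two_pow_lt _ _ fun p _ => p.2

/-- Binary numbers are compared at the highest digit in which they differ. -/
theorem closerWeight_lt_closerWeight {r : ℕ} {π π' : OpenLinkPattern r} {x : Fin r}
    (hx : x ∈ closers π) (hx' : x ∉ closers π')
    (h : ∀ p, x < p → p ∈ closers π' → p ∈ closers π) : closerWeight π' < closerWeight π := by
  unfold closerWeight
  rw [← Finset.sum_filter_add_sum_filter_not (closers π') (fun p => p < x),
    ← Finset.sum_filter_add_sum_filter_not (closers π) (fun p => p < x)]
  have h1 : ∑ p ∈ (closers π').filter (fun p => p < x), 2 ^ (p : ℕ) < 2 ^ (x : ℕ) :=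
    sum_two_pow_lt _ _ fun p hp => (Finset.mem_filter.1 hp).2
  have h2 : 2 ^ (x : ℕ) + ∑ p ∈ (closers π').filter (fun p => ¬ p < x), 2 ^ (p : ℕ) ≤
      ∑ p ∈ (closers π).filter (fun p => ¬ p < x), 2 ^ (p : ℕ) := by
    rw [← Finset.sum_insert (a := x) (f := fun p : Fin r => 2 ^ (p : ℕ)) (by simp [hx'])]
    apply Finset.sum_le_sum_of_subset
    intro p hp
    rw [Finset.mem_insert, Finset.mem_filter] at hp
    rw [Finset.mem_filter]
    rcases hp with rfl | ⟨h3, h4⟩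
    · exact ⟨hx, lt_irrefl _⟩
    · have : p ≠ x := by rintro rfl; exact hx' h3
      exact ⟨h p (lt_of_le_of_ne (not_lt.1 h4) this.symm) h3, h4⟩
  omega

theorem isClosed_iff_colored {r : ℕ} {π : OpenLinkPattern r} {i : Fin r} :
    π.1 i ≠ i ↔ ((colored π).2 i = false ∧ (colored π).1 i ≠ i) := by
  rw [Ne, isOpen_iff_colored]; simp

theorem pattern_eq_of_colored_eq {r : ℕ} {π ρ : OpenLinkPattern r} {i : Fin r}
    (h1 : (colored ρ).1 i = (colored π).1 i) (h2 : (colored ρ).2 i = (colored π).2 i) :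
    ρ.1 i = π.1 i := by
  rw [pattern_eq_of_colored ρ, pattern_eq_of_colored π, h1, h2]

theorem pattern_eq_of_join {r : ℕ} {π ρ : OpenLinkPattern r} {a b : Fin r}
    (h : colored ρ = join (colored π) a b) {p : Fin r} (h1 : p ≠ a) (h2 : p ≠ b)
    (h3 : p ≠ (colored π).1 a) (h4 : p ≠ (colored π).1 b) : ρ.1 p = π.1 p := by
  apply pattern_eq_of_colored_eq <;> rw [h] <;> simp [join, h1, h2, h3, h4]

/-- Gluing does not decrease the number of points on closed arches: the points `a` and `b` become
closed, and at most one open arch replaces each of their former closed arches. -/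
theorem closedCard_le_of_join {n : ℕ} {π ρ : OpenLinkPattern (2 * n + 1)} {a b : Fin (2 * n + 1)}
    (hab : a ≠ b) (hne : (colored π).1 a ≠ b)
    (h : colored ρ = join (colored π) a b) : closedCard π ≤ closedCard ρ := by
  have hD := isColoredPicture_colored π
  have ea := hD.invol a
  have eb := hD.invol b
  have ha : ρ.1 a ≠ a := by
    rw [isClosed_iff_colored, h]; simp [join, hab.symm]
  have hb : ρ.1 b ≠ b := by
    rw [isClosed_iff_colored, h]; simp [join, hab, hab.symm]
  have key : ∀ p, π.1 p ≠ p → p ≠ (colored π).1 a → p ≠ (colored π).1 b → ρ.1 p ≠ p := by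
    intro p hp h1 h2
    by_cases hpa : p = a
    · rw [hpa]; exact ha
    by_cases hpb : p = b
    · rw [hpb]; exact hb
    rw [pattern_eq_of_join h hpa hpb h1 h2]; exact hp
  have hyx : (colored π).1 b ≠ (colored π).1 a := fun h => hab (by rw [← ea, ← h, eb])
  have hne' : (colored π).1 b ≠ a := fun h => hne (by rw [← h, eb])
  unfold closedCard
  have hset : ∀ (x : Fin (2 * n + 1)) (c : Fin (2 * n + 1)), π.1 x ≠ x → π.1 c = c → ρ.1 c ≠ c →
      (∀ p, π.1 p ≠ p → p ≠ x → ρ.1 p ≠ p) →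
      (Finset.univ.filter fun p => π.1 p ≠ p).card ≤ (Finset.univ.filter fun p => ρ.1 p ≠ p).card := by
    intro x c hx hc hc' hp
    have h1 : insert c ((Finset.univ.filter fun p => π.1 p ≠ p).erase x) ⊆
        Finset.univ.filter fun p => ρ.1 p ≠ p := by
      intro p
      simp only [Finset.mem_insert, Finset.mem_erase, Finset.mem_filter, Finset.mem_univ, true_and]
      rintro (rfl | ⟨h1, h2⟩)
      · exact hc'
      · exact hp p h2 h1
    have h2 := Finset.card_le_card h1
    rwa [Finset.card_insert_of_notMem (by simp [hc]), Finset.card_erase_add_one (by simpa using hx)] at h2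
  have hclx : π.1 a ≠ a → π.1 ((colored π).1 a) ≠ (colored π).1 a := by
    rw [isClosed_iff_colored, isClosed_iff_colored, hD.color, ea]
    exact fun h => ⟨h.1, h.2.symm⟩
  have hcly : π.1 b ≠ b → π.1 ((colored π).1 b) ≠ (colored π).1 b := by
    rw [isClosed_iff_colored, isClosed_iff_colored, hD.color, eb]
    exact fun h => ⟨h.1, h.2.symm⟩
  have hopx : π.1 a = a → π.1 ((colored π).1 a) = (colored π).1 a := by
    rw [isOpen_iff_colored, isOpen_iff_colored, hD.color, ea]
    exact fun h => h.imp id Eq.symm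
  have hopy : π.1 b = b → π.1 ((colored π).1 b) = (colored π).1 b := by
    rw [isOpen_iff_colored, isOpen_iff_colored, hD.color, eb]
    exact fun h => h.imp id Eq.symm
  by_cases hca : π.1 a = a <;> by_cases hcb : π.1 b = b
  · apply Finset.card_le_card
    intro p
    simp only [Finset.mem_filter, Finset.mem_univ, true_and]
    intro hp
    refine key p hp ?_ ?_
    · rintro rfl; exact hp (hopx hca)
    · rintro rfl; exact hp (hopy hcb)
  · refine hset ((colored π).1 b) a (hcly hcb) hca ha fun p hp h1 => key p hp ?_ h1
    rintro rfl; exact hp (hopx hca)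
  · refine hset ((colored π).1 a) b (hclx hca) hcb hb fun p hp h1 => key p hp h1 ?_
    rintro rfl; exact hp (hopy hcb)
  · apply Finset.card_le_card
    intro p
    simp only [Finset.mem_filter, Finset.mem_univ, true_and]
    intro hp
    replace hca := isClosed_iff_colored.1 hca
    replace hcb := isClosed_iff_colored.1 hcb
    by_cases hpa : p = a
    · rw [hpa]; exact ha
    by_cases hpb : p = b
    · rw [hpb]; exact hb
    by_cases hpx : p = (colored π).1 a
    · rw [isClosed_iff_colored, h]
      have hp2 : (join (colored π) a b).2 p = false := by
        simp only [join, hpa, hpb, ← hpx, hca, hcb, if_false, or_self]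
        simp
      have hp1 : (join (colored π) a b).1 p = (colored π).1 b := by
        simp only [join, hpa, hpb, ← hpx, hcb, if_false, if_true]
      exact ⟨hp2, by rw [hp1, hpx]; exact hyx⟩
    by_cases hpy : p = (colored π).1 b
    · rw [isClosed_iff_colored, h]
      have hca' := hca.2
      have hp2 : (join (colored π) a b).2 p = false := by
        simp only [join, hpa, hpb, hpx, ← hpy, hca, hcb, if_false, or_self]
        simp
      have hp1 : (join (colored π) a b).1 p = (colored π).1 a := by
        simp only [join, hpa, hpb, hpx, ← hpy, hca', if_false, if_true]
      exact ⟨hp2, by rw [hp1]; exact Ne.symm hpx⟩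
    · exact key p hp hpx hpy

section

variable {K : Type*} [Field K]

theorem eMatrix_ne_zero {r : ℕ} {q : K} {a b : Fin r} {ρ π : OpenLinkPattern r}
    (h : eMatrix q a b ρ π ≠ 0) :
    ((colored π).1 a = b ∧ (colored π).2 a = false ∧ ρ = π) ∨
      ((colored π).1 a ≠ b ∧ colored ρ = join (colored π) a b) := by
  unfold eMatrix at h
  split_ifs at h with h1 h2 h3 h4
  · exact absurd rfl h
  · exact Or.inl ⟨h1, by simpa using h2, h3⟩
  · exact absurd rfl h
  · exact Or.inr ⟨h1, h4⟩
  · exact absurd rfl h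

theorem eZeroMatrix_ne_zero {n : ℕ} {q : K} {ρ π : OpenLinkPattern (2 * n + 1)}
    (h : eZeroMatrix q ρ π ≠ 0) :
    ((colored π).1 0 = 0 ∧ ρ = π) ∨
      ((colored π).1 0 ≠ 0 ∧ ∃ o c, (colored π).1 o = o ∧ colored ρ = cutFirst (colored π) o c) := by
  unfold eZeroMatrix at h
  split_ifs at h with h1 h2 h3
  · exact Or.inl ⟨h1, h2⟩
  · exact absurd rfl h
  · exact Or.inr ⟨h1, h3⟩
  · exact absurd rfl h

/-- Cutting the first arch with a dashed reconnection loses no information: the new dashed arch is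
the leftmost one of the resulting picture. -/
theorem cutFirst_true_injective {n : ℕ} {D D' : ColoredDiagram (2 * n + 1)}
    (hD : IsColoredPicture D) (hD' : IsColoredPicture D') (h0 : D.1 0 ≠ 0) (h0' : D'.1 0 ≠ 0)
    {o o' : Fin (2 * n + 1)} (ho : D.1 o = o) (ho' : D'.1 o' = o')
    (h : cutFirst D o true = cutFirst D' o' true) : D = D' := by
  have hlt : ∀ {D : ColoredDiagram (2 * n + 1)} {o : Fin (2 * n + 1)}, IsColoredPicture D →
      D.1 0 ≠ 0 → D.1 o = o → D.1 0 < o := by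
    intro D o hD h0 ho
    by_contra hlt
    have hoz : o ≠ 0 := fun h => h0 (h ▸ ho)
    have hox : o ≠ D.1 0 := fun h => h0 (by rw [h, hD.invol] at ho; exact ho.symm)
    exact (hD.nest 0 o (Fin.pos_of_ne_zero hoz) (lt_of_le_of_ne (not_lt.1 hlt) hox)).2.2.1 ho
  have hmin : ∀ {D : ColoredDiagram (2 * n + 1)} {o : Fin (2 * n + 1)}, IsColoredPicture D →
      D.1 0 ≠ 0 → D.1 o = o → (cutFirst D o true).2 (D.1 0) = true ∧
        (cutFirst D o true).1 (D.1 0) = o ∧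
        ∀ p, (cutFirst D o true).2 p = true → D.1 0 ≤ p := by
    intro D o hD h0 ho
    refine ⟨by simp [cutFirst, h0], by simp [cutFirst, h0], fun p hp => ?_⟩
    by_contra hlt'
    have hlt' := not_le.1 hlt'
    simp only [cutFirst] at hp
    by_cases hp0 : p = 0
    · simp [hp0] at hp
    simp only [hp0, hlt'.ne, (hlt'.trans (hlt hD h0 ho)).ne, if_false, or_self] at hp
    have := (hD.nest 0 p (Fin.pos_of_ne_zero hp0) hlt').2.2.2
    rw [this] at hp; cases hp
  obtain ⟨a1, a2, a3⟩ := hmin hD h0 ho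
  obtain ⟨b1, b2, b3⟩ := hmin hD' h0' ho'
  have hj : D.1 0 = D'.1 0 := le_antisymm (a3 _ (h ▸ b1)) (b3 _ (h ▸ a1))
  have hoo : o = o' := by rw [← a2, ← b2, h, hj]
  subst hoo
  have hjo := (hlt hD h0 ho).ne'
  have ho0 : o ≠ 0 := fun h => h0 (h ▸ ho)
  have hz : ∀ {D : ColoredDiagram (2 * n + 1)}, IsColoredPicture D → D.1 o = o → D.2 0 = false := by
    intro D hD ho
    by_contra hc
    have := hD.open_lt_dashed o 0 ho (by simpa using hc)
    exact Fin.not_lt_zero _ this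
  have h1 : ∀ i, D.1 i = D'.1 i := by
    intro i
    by_cases hi0 : i = 0
    · rw [hi0, hj]
    by_cases hij : i = D.1 0
    · rw [hij, hD.invol, hj, hD'.invol]
    by_cases hio : i = o
    · rw [hio, ho, ho']
    have := congrFun (congrArg Prod.fst h) i
    simpa [cutFirst, hi0, hij, hio, ← hj] using this
  have h2 : ∀ i, D.2 i = D'.2 i := by
    intro i
    by_cases hi0 : i = 0
    · rw [hi0, hz hD ho, hz hD' ho']
    by_cases hij : i = D.1 0
    · rw [hij, hD.color, hj, hD'.color, hz hD ho, hz hD' ho']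
    by_cases hio : i = o
    · rw [hio, hD.open_solid o ho, hD'.open_solid o ho']
    have := congrFun (congrArg Prod.snd h) i
    simpa [cutFirst, hi0, hij, hio, ← hj] using this
  exact Prod.ext (funext h1) (funext h2)

/-- Cutting the first arch keeps the number of points on closed arches if the new arch is solid, up to
an increase, and lowers it by two if the new arch is dashed, which means open. -/
theorem closedCard_of_cutFirst {n : ℕ} {π ρ : OpenLinkPattern (2 * n + 1)} {o : Fin (2 * n + 1)}
    {c : Bool} (h0 : (colored π).1 0 ≠ 0) (ho : (colored π).1 o = o)
    (h : colored ρ = cutFirst (colored π) o c) :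
    (c = false → closedCard π ≤ closedCard ρ) ∧ (c = true → closedCard π = closedCard ρ + 2) := by
  have hD := isColoredPicture_colored π
  have hz : (colored π).2 0 = false := by
    by_contra hc
    exact Fin.not_lt_zero _ (hD.open_lt_dashed o 0 ho (by simpa using hc))
  have ho0 : o ≠ 0 := fun h => h0 (h ▸ ho)
  have hxo : (colored π).1 0 ≠ o := fun h => ho0 (by rw [← ho, ← h, hD.invol])
  have hj : (colored π).2 ((colored π).1 0) = false := by rw [hD.color, hz]
  have hπo : π.1 o = o := isOpen_iff_colored.2 (Or.inr ho)
  have hπ0 : π.1 0 ≠ 0 := isClosed_iff_colored.2 ⟨hz, h0⟩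
  have hπj : π.1 ((colored π).1 0) ≠ (colored π).1 0 :=
    isClosed_iff_colored.2 ⟨hj, by rw [hD.invol]; exact h0.symm⟩
  have hρ0 : ρ.1 0 = 0 := by rw [isOpen_iff_colored, h]; simp [cutFirst]
  have hrest : ∀ p, p ≠ 0 → p ≠ (colored π).1 0 → p ≠ o → ρ.1 p = π.1 p := by
    intro p h1 h2 h3
    apply pattern_eq_of_colored_eq <;> rw [h] <;> simp [cutFirst, h1, h2, h3]
  constructor
  · rintro rfl
    have hρo : ρ.1 o ≠ o := by
      rw [isClosed_iff_colored, h]; simp [cutFirst, ho0, hxo, hxo.symm]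
    have hρj : ρ.1 ((colored π).1 0) ≠ (colored π).1 0 := by
      rw [isClosed_iff_colored, h]; simp [cutFirst, h0, hxo.symm]
    unfold closedCard
    have h1 : insert o ((Finset.univ.filter fun p => π.1 p ≠ p).erase 0) ⊆
        Finset.univ.filter fun p => ρ.1 p ≠ p := by
      intro p
      simp only [Finset.mem_insert, Finset.mem_erase, Finset.mem_filter, Finset.mem_univ, true_and]
      rintro (rfl | ⟨h1, h2⟩)
      · exact hρo
      · by_cases hpj : p = (colored π).1 0
        · rw [hpj]; exact hρj
        · by_cases hpo : p = o
          · rw [hpo]; exact hρo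
          · rw [hrest p h1 hpj hpo]; exact h2
    have h2 := Finset.card_le_card h1
    rwa [Finset.card_insert_of_notMem (by simp [hπo]), Finset.card_erase_add_one (by simpa using hπ0)] at h2
  · rintro rfl
    have hρo : ρ.1 o = o := by
      rw [isOpen_iff_colored, h]; simp [cutFirst, ho0]
    have hρj : ρ.1 ((colored π).1 0) = (colored π).1 0 := by
      rw [isOpen_iff_colored, h]; simp [cutFirst, h0]
    unfold closedCard
    have h1 : (Finset.univ.filter fun p => π.1 p ≠ p) =
        insert 0 (insert ((colored π).1 0) (Finset.univ.filter fun p => ρ.1 p ≠ p)) := by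
      ext p
      simp only [Finset.mem_insert, Finset.mem_filter, Finset.mem_univ, true_and]
      by_cases hp0 : p = 0
      · simp [hp0, hπ0]
      by_cases hpj : p = (colored π).1 0
      · rw [hpj]; simp [hπj]
      by_cases hpo : p = o
      · rw [hpo]; simp [ho0, hπo, hρo, hxo.symm]
      · rw [hrest p hp0 hpj hpo]; simp [hp0, hpj]
    rw [h1, Finset.card_insert_of_notMem (by simp [h0.symm, hρ0]),
      Finset.card_insert_of_notMem (by simp [hρj])]

/-- The order in which the entries are computed: first by the number of closed arches, then by the
binary number whose digits are the right end points of the closed arches. -/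
noncomputable def patternRank {r : ℕ} (π : OpenLinkPattern r) : ℕ :=
  (closedCard π * 2 ^ r + closerWeight π) * Fintype.card (OpenLinkPattern r) +
    Fintype.equivFin (OpenLinkPattern r) π

theorem patternRank_lt_of_lt {r : ℕ} {π π' : OpenLinkPattern r}
    (h : closedCard π' * 2 ^ r + closerWeight π' < closedCard π * 2 ^ r + closerWeight π) :
    patternRank π' < patternRank π := by
  unfold patternRank
  have h1 := (Fintype.equivFin (OpenLinkPattern r) π').2
  have h2 := Nat.mul_le_mul_right (Fintype.card (OpenLinkPattern r)) (Nat.succ_le_of_lt h)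
  rw [Nat.succ_mul] at h2
  omega

theorem patternRank_lt_of_closedCard_lt {r : ℕ} {π π' : OpenLinkPattern r}
    (h : closedCard π' < closedCard π) : patternRank π' < patternRank π := by
  apply patternRank_lt_of_lt
  have h1 := closerWeight_lt π'
  have h2 := Nat.mul_le_mul_right (2 ^ r) (Nat.succ_le_of_lt h)
  rw [Nat.succ_mul] at h2
  omega

theorem patternRank_lt_of_closerWeight_lt {r : ℕ} {π π' : OpenLinkPattern r}
    (h : closedCard π' ≤ closedCard π) (h' : closerWeight π' < closerWeight π) :
    patternRank π' < patternRank π := by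
  apply patternRank_lt_of_lt
  have h2 := Nat.mul_le_mul_right (2 ^ r) h
  omega

theorem patternRank_injective (r : ℕ) : Function.Injective (patternRank (r := r)) := by
  intro π π' h
  have h1 := (Fintype.equivFin (OpenLinkPattern r) π).2
  have h2 := (Fintype.equivFin (OpenLinkPattern r) π').2
  have := congrArg (· % Fintype.card (OpenLinkPattern r)) h
  simp only [patternRank, Nat.mul_add_mod_self_right, Nat.mod_eq_of_lt h1, Nat.mod_eq_of_lt h2] at this
  exact (Fintype.equivFin _).injective (Fin.ext this)

theorem eq_allOpen_iff {r : ℕ} {π : OpenLinkPattern r} : π = allOpen r ↔ ∀ p, π.1 p = p :=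
  ⟨fun h p => by rw [h]; rfl, fun h => Subtype.ext (funext h)⟩

theorem patternRank_allOpen_le {r : ℕ} (π : OpenLinkPattern r) :
    patternRank (allOpen r) ≤ patternRank π := by
  by_cases h : π = allOpen r
  · rw [h]
  apply (patternRank_lt_of_closedCard_lt _).le
  have : closedCard (allOpen r) = 0 := by
    simp [closedCard, allOpen]
  rw [this]
  rw [eq_allOpen_iff] at h
  push Not at h
  obtain ⟨p, hp⟩ := h
  exact Finset.card_pos.2 ⟨p, by simpa using hp⟩

/-- Every pattern other than the one with open arches only is the unique latest pattern in a row of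
the matrix of one of the generators. -/
theorem exists_triangular_row {n : ℕ} (q : K) {π : OpenLinkPattern (2 * n + 1)}
    (hπ : π ≠ allOpen _) : ∃ (g : Node n) (ρ : OpenLinkPattern (2 * n + 1)),
      patternRank ρ < patternRank π ∧ generator q g ρ π ≠ 0 ∧
      ∀ ρ', generator q g ρ ρ' ≠ 0 → patternRank ρ' ≤ patternRank π := by
  have hD := isColoredPicture_colored π
  by_cases h0 : π.1 0 = 0
  · -- glue the first closed arch with the open point before it
    rw [Ne, eq_allOpen_iff] at hπ
    push Not at hπ
    obtain ⟨b, hm, hM⟩ : ∃ b, π.1 b ≠ b ∧ ∀ d, π.1 d ≠ d → b ≤ d := by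
      have hne : (Finset.univ.filter fun p => π.1 p ≠ p).Nonempty := by
        obtain ⟨p, hp⟩ := hπ; exact ⟨p, by simpa using hp⟩
      exact ⟨_, (Finset.mem_filter.1 (Finset.min'_mem _ hne)).2,
        fun d hd => Finset.min'_le (Finset.univ.filter fun p => π.1 p ≠ p) d (by simpa using hd)⟩
    have hb0 : b ≠ 0 := by rintro rfl; exact hm h0
    obtain ⟨i, rfl⟩ := Fin.exists_succ_eq.2 hb0
    have hab : i.castSucc < i.succ := Fin.castSucc_lt_succ
    have hcov := succ_le_of_castSucc_lt i
    generalize hA : i.castSucc = a at *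
    generalize hB : i.succ = b at *
    have ha : π.1 a = a := by
      by_contra h; exact absurd (hM a h) (not_le.2 hab)
    obtain ⟨c1, c2⟩ := isClosed_iff_colored.1 hm
    have hx : (colored π).1 b = π.1 b := (colored_of_closed hm).1
    have hxb : b < π.1 b := by
      refine lt_of_le_of_ne (hM _ ?_) hm.symm
      rw [π.2.1]; exact hm.symm
    have hne : (colored π).1 a ≠ b := by
      intro h
      have h1 := hD.invol a
      rw [h, hx] at h1
      exact absurd (h1 ▸ hxb) (not_lt.2 hab.le)
    have hxa : π.1 b ≠ a := fun h => absurd (h ▸ hxb) (not_lt.2 hab.le)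
    obtain ⟨ρ, hρ⟩ := (isColoredPicture_join hD hab hcov hne).exists_colored_eq
    have hca : (colored π).2 a = true ∨ (colored π).1 a = a := isOpen_iff_colored.1 ha
    have hxxa : π.1 b ≠ (colored π).1 a := fun h => hab.ne (by
      have := hD.invol a
      rw [← h, ← hx, hD.invol] at this; exact this.symm)
    -- the pattern `ρ`
    have ρa : ρ.1 a = b := by rw [pattern_eq_of_colored, hρ]; simp [join]
    have ρb : ρ.1 b = a := by rw [pattern_eq_of_colored, hρ]; simp [join, hab.ne']
    have ρx : ρ.1 (π.1 b) = π.1 b := by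
      rw [isOpen_iff_colored, hρ]
      rcases hca with h | h
      · by_cases haa : (colored π).1 a = a
        · right; simp [join, hx, hxa, hm, haa]
        · left; simp [join, hx, hxa, hm, c1, h, haa]
      · right; simp [join, hx, hxa, hm, h]
    have ρo : ∀ p, p ≠ a → p ≠ b → p ≠ π.1 b → ρ.1 p = π.1 p := by
      intro p h1 h2 h3
      by_cases h4 : p = (colored π).1 a
      · rcases hca with h | h
        · have haa : (colored π).1 a ≠ a := fun haa => h1 (h4.trans haa)
          rw [isOpen_iff_colored.2 (Or.inl (by rw [h4, hD.color]; exact h) : (colored π).2 p = true ∨ _)]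
          rw [isOpen_iff_colored, hρ]
          left
          simp [join, h1, h2, ← h4, c1, c2, h]
        · exact absurd (h4.trans h) h1
      · exact pattern_eq_of_join hρ h1 h2 h4 (hx ▸ h3)
    have hcard : closedCard ρ = closedCard π := by
      have e1 : insert (π.1 b) (Finset.univ.filter fun p => ρ.1 p ≠ p) =
          insert a (Finset.univ.filter fun p => π.1 p ≠ p) := by
        ext p
        simp only [Finset.mem_insert, Finset.mem_filter, Finset.mem_univ, true_and]
        by_cases h1 : p = a
        · rw [h1]; simp [ρa, hab.ne']
        by_cases h2 : p = b
        · rw [h2]; simp [ρb, hm, hab.ne]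
        by_cases h3 : p = π.1 b
        · rw [h3]; simp [π.2.1, hm.symm]
        · simp [h1, h3, ρo p h1 h2 h3]
      have e2 := congrArg Finset.card e1
      rw [Finset.card_insert_of_notMem (by simp [ρx]),
        Finset.card_insert_of_notMem (by simp [ha])] at e2
      simpa [closedCard] using e2
    have hxcl : π.1 b ∈ closers π := by rw [mem_closers, π.2.1]; exact hxb
    refine ⟨.bulk i, ρ, ?_, ?_, ?_⟩
    · apply patternRank_lt_of_closerWeight_lt hcard.le
      refine closerWeight_lt_closerWeight hxcl (by rw [mem_closers, ρx]; exact lt_irrefl _) ?_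
      intro p hp h
      rw [mem_closers] at h ⊢
      rwa [ρo p (by rintro rfl; exact absurd (hab.trans hxb) (not_lt.2 hp.le))
        (by rintro rfl; exact absurd hxb (not_lt.2 hp.le)) hp.ne'] at h
    · simp only [generator, hA, hB, eMatrix, hne, if_false]
      simp [hρ]
    · -- a pattern with larger right ends than `π` would have an arch that ends at the partner of `b`
      -- before the gluing, but this point is open in `ρ`
      intro ρ' h
      simp only [generator, hA, hB] at h
      by_cases hρπ : ρ' = π
      · rw [hρπ]
      refine le_of_lt ?_
      rcases eMatrix_ne_zero h with ⟨h1, h2, rfl⟩ | ⟨h1, h2⟩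
      · apply patternRank_lt_of_closerWeight_lt hcard.le
        refine closerWeight_lt_closerWeight hxcl (by rw [mem_closers, ρx]; exact lt_irrefl _) ?_
        intro p hp h
        rw [mem_closers] at h ⊢
        rwa [ρo p (by rintro rfl; exact absurd (hab.trans hxb) (not_lt.2 hp.le))
          (by rintro rfl; exact absurd hxb (not_lt.2 hp.le)) hp.ne'] at h
      · apply patternRank_lt_of_closerWeight_lt
          ((closedCard_le_of_join hab.ne h1 h2).trans hcard.le)
        have hD' := isColoredPicture_colored ρ'
        have ia := hD'.invol a
        have ib := hD'.invol b
        have hab' : (colored ρ').1 b ≠ a := fun h => h1 (by rw [← h, ib])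
        have hneq : (colored ρ').1 a ≠ (colored ρ').1 b := fun h => hab.ne (by rw [← ia, h, ib])
        refine closerWeight_lt_closerWeight hxcl ?_ ?_
        · rw [mem_closers]
          intro hlt
          obtain ⟨d1, d2⟩ := isClosed_iff_colored.1 hlt.ne
          have d3 := (colored_of_closed hlt.ne).1
          have hxA : π.1 b ≠ (colored ρ').1 a ∨ (colored ρ').1 a = a := by
            by_contra hcon
            push Not at hcon
            obtain ⟨hcon, hcon'⟩ := hcon
            have hcov' := hD'.nest a b hab (by rw [← hcon]; exact hxb)
            have hk : (colored ρ').2 a = false := by rw [← hD'.color, ← hcon]; exact d1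
            have hp2 : (join (colored ρ') a b).2 (π.1 b) = false := by
              simp only [join, hxa, hm, ← hcon, hcov'.2.2.1, hcov'.2.2.2, hk, if_false, or_self]
              simp
            have hp1 : (join (colored ρ') a b).1 (π.1 b) = (colored ρ').1 b := by
              simp only [join, hxa, hm, ← hcon, hcov'.2.2.1, if_false, if_true]
            have := isOpen_iff_colored.1 ρx
            rw [h2, hp1, hp2] at this
            rcases this with h | h
            · cases h
            · exact hneq (hcon.symm.trans h.symm)
          by_cases hxB : π.1 b = (colored ρ').1 b
          · apply hρπ
            have hb2 : (colored ρ').2 b = false := by rw [← hD'.color, ← hxB]; exact d1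
            have hxx : (colored ρ').1 a ≠ π.1 b := fun h => hneq (h.trans hxB)
            have ha' : ρ'.1 a = a := by
              rw [isOpen_iff_colored]
              by_contra hcon
              push Not at hcon
              have := isOpen_iff_colored.1 ρx
              rw [h2] at this
              simp [join, hxa, hm, ← hxB, hxx.symm, hcon.2, hb2, hcon.1, hxx] at this
            have hca' := isOpen_iff_colored.1 ha'
            have hb' : ρ'.1 b = π.1 b := by
              rw [pattern_eq_of_colored, hb2, hxB]; rfl
            apply Subtype.ext
            funext p
            by_cases g1 : p = a
            · rw [g1, ha', ha]
            by_cases g2 : p = b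
            · rw [g2, hb']
            by_cases g3 : p = π.1 b
            · rw [g3, ← hb', ρ'.2.1, hb', π.2.1]
            rw [← ρo p g1 g2 g3]
            by_cases g4 : p = (colored ρ').1 a
            · have haa : (colored ρ').1 a ≠ a := fun haa => g1 (g4.trans haa)
              have hk : (colored ρ').2 a = true := hca'.resolve_right haa
              rw [isOpen_iff_colored.2 (Or.inl (by rw [g4, hD'.color]; exact hk) : (colored ρ').2 p = true ∨ _)]
              symm
              rw [isOpen_iff_colored, h2]
              left
              simp [join, g1, g2, ← g4, hb2, hk, ← hxB, hm]
            · exact (pattern_eq_of_join h2 g1 g2 g4 (hxB ▸ g3)).symm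
          · have := ρx
            by_cases haa : π.1 b = (colored ρ').1 a
            · rcases hxA with hh | hh
              · exact hh haa
              · exact hxa (haa.trans hh)
            rw [pattern_eq_of_join h2 hxa hm haa hxB] at this
            exact hlt.ne this
        · intro p hp hlt
          rw [mem_closers] at hlt
          have hpa : p ≠ a := by rintro rfl; exact absurd (hab.trans hxb) (not_lt.2 hp.le)
          have hpb : p ≠ b := by rintro rfl; exact absurd hxb (not_lt.2 hp.le)
          obtain ⟨d1, d2⟩ := isClosed_iff_colored.1 hlt.ne
          have goal : ρ.1 p < p := by
            by_cases hpA : p = (colored ρ').1 a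
            · have hcov' := hD'.nest a b hab (by rw [← hpA]; exact hxb.trans hp)
              rw [pattern_eq_of_colored, h2]
              have hk : (colored ρ').2 a = false := by rw [← hD'.color, ← hpA]; exact d1
              simp only [join, hpa, hpb, ← hpA, hcov'.2.2.1, hcov'.2.2.2, hk]
              simp [hcov'.2.1.trans_eq hpA.symm]
            by_cases hpB : p = (colored ρ').1 b
            · exfalso
              obtain ⟨g1, g2, g3, g4⟩ := hD'.nest b (π.1 b) hxb (by rw [← hpB]; exact hp)
              have g5 : π.1 b ≠ (colored ρ').1 a := by
                intro h; rw [h, ia] at g1; exact absurd g1 (not_lt.2 hab.le)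
              have g6 : π.1 b ≠ (colored ρ').1 b := by
                intro h; rw [h, ib] at g1; exact lt_irrefl _ g1
              have := ρx
              rw [pattern_eq_of_join h2 hxa hm g5 g6] at this
              exact (isClosed_iff_colored.2 ⟨g4, g3⟩) this
            rwa [pattern_eq_of_join h2 hpa hpb hpA hpB]
          rw [mem_closers]
          rwa [ρo p hpa hpb hp.ne'] at goal
  · -- cut the arch of the first point, with a dashed reconnection
    obtain ⟨o, ho⟩ := hD.exists_open
    obtain ⟨c1, c2⟩ := isClosed_iff_colored.1 h0
    obtain ⟨ρ, hρ⟩ := exists_colored_eq_cutFirst π c2 ho true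
    have hlt := (closedCard_of_cutFirst c2 ho hρ).2 rfl
    refine ⟨.affine, ρ, patternRank_lt_of_closedCard_lt (by omega), ?_, ?_⟩
    · simp only [generator, eZeroMatrix, c2, if_false]
      rw [if_pos ⟨o, true, ho, hρ⟩]
      exact one_ne_zero
    · intro ρ' h
      rcases eZeroMatrix_ne_zero h with ⟨_, rfl⟩ | ⟨h1, o', c', ho', h2⟩
      · exact (patternRank_lt_of_closedCard_lt (by omega)).le
      · cases c'
        · have := (closedCard_of_cutFirst h1 ho' h2).1 rfl
          exact (patternRank_lt_of_closedCard_lt (by omega)).le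
        · have := cutFirst_true_injective hD (isColoredPicture_colored ρ') c2 h1 ho ho'
            (hρ.symm.trans h2)
          rw [colored_injective this]

end

/-! ### The `q`-Vandermonde product -/

section

variable {K : Type*} [Field K]

/-- The linear form `q wᵢ - q⁻¹ wⱼ`. -/
noncomputable def qForm {σ : Type*} (q : K) (i j : σ) : MvPolynomial σ K :=
  C q * X i - C q⁻¹ * X j

/-- The `q`-deformed Vandermonde product. -/
noncomputable def qVandermonde (r : ℕ) (q : K) : MvPolynomial (Fin r) K :=
  ∏ i : Fin r, ∏ j ∈ Finset.Ioi i, qForm q i j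

theorem eval_qForm {σ : Type*} (q : K) (i j : σ) (w : σ → K) :
    eval w (qForm q i j) = q * w i - q⁻¹ * w j := by
  simp [qForm]

theorem qForm_ne_zero {σ : Type*} {q : K} (hq : q ≠ 0) {i j : σ} (hij : i ≠ j) :
    qForm q i j ≠ 0 := by
  classical
  intro h
  have := eval_qForm q i j (Pi.single i 1)
  rw [h] at this
  simp [hij.symm] at this
  exact hq this.symm

theorem isHomogeneous_qForm {σ : Type*} (q : K) (i j : σ) : (qForm q i j).IsHomogeneous 1 := by
  have h := fun (c : K) (i : σ) => (isHomogeneous_C σ c).mul (isHomogeneous_X K i)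
  exact (h q i).sub (h q⁻¹ j)

theorem degreeOf_qForm {σ : Type*} [DecidableEq σ] {q : K} (hq : q ≠ 0) {i j : σ} (hij : i ≠ j)
    (k : σ) : degreeOf k (qForm q i j) = if k = i ∨ k = j then 1 else 0 := by
  have hC := fun (c : K) (m : σ) => (degreeOf_C_mul_le (X m : MvPolynomial σ K) k c).trans_eq
    (degreeOf_X k m)
  have hle := (degreeOf_sub_le k (C q * X i) (C q⁻¹ * X j : MvPolynomial σ K)).trans
    (max_le_max (hC q i) (hC q⁻¹ j))
  change degreeOf k (qForm q i j) ≤ _ at hle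
  have hge : ∀ m : σ, coeff (Finsupp.single m 1) (qForm q i j) ≠ 0 →
      1 ≤ degreeOf m (qForm q i j) := by
    intro m hm
    simpa using monomial_le_degreeOf m (mem_support_iff.2 hm)
  have hco : ∀ m : σ, coeff (Finsupp.single m 1) (qForm q i j) =
      (if i = m then q else 0) - (if j = m then q⁻¹ else 0) := by
    intro m
    simp [qForm, coeff_C_mul, coeff_X, Finsupp.single_left_inj]
  split_ifs with h
  · apply le_antisymm
    · refine hle.trans ?_
      split_ifs <;> simp
    · rcases h with rfl | rfl
      · exact hge _ (by rw [hco]; simp [hij.symm, hq])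
      · exact hge _ (by rw [hco]; simp [hij, hq])
  · push Not at h
    simpa [h.1, h.2] using hle

theorem qVandermonde_ne_zero {r : ℕ} {q : K} (hq : q ≠ 0) : qVandermonde r q ≠ 0 :=
  Finset.prod_ne_zero_iff.2 fun _ _ => Finset.prod_ne_zero_iff.2 fun _ hj =>
    qForm_ne_zero hq (Finset.mem_Ioi.1 hj).ne

theorem totalDegree_qVandermonde {r : ℕ} {q : K} (hq : q ≠ 0) :
    (qVandermonde r q).totalDegree = r * (r - 1) / 2 := by
  have h : (qVandermonde r q).IsHomogeneous (∑ i : Fin r, ∑ j ∈ Finset.Ioi i, 1) :=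
    IsHomogeneous.prod _ _ _ fun i _ => IsHomogeneous.prod _ _ _ fun j _ => isHomogeneous_qForm q i j
  rw [h.totalDegree (qVandermonde_ne_zero hq)]
  simp only [Finset.sum_const, smul_eq_mul, mul_one, Fin.card_Ioi]
  rw [Fin.sum_univ_eq_sum_range (fun i => r - 1 - i), Finset.sum_range_reflect (fun i => i),
    Finset.sum_range_id]

theorem degreeOf_qVandermonde {r : ℕ} {q : K} (hq : q ≠ 0) (k : Fin r) :
    degreeOf k (qVandermonde r q) = r - 1 := by
  have hne : ∀ i : Fin r, ∀ j ∈ Finset.Ioi i, qForm q i j ≠ 0 := fun i j hj =>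
    qForm_ne_zero hq (Finset.mem_Ioi.1 hj).ne
  rw [qVandermonde, degreeOf_prod_eq _ _ fun i _ => Finset.prod_ne_zero_iff.2 (hne i)]
  have h1 : ∀ i : Fin r, degreeOf k (∏ j ∈ Finset.Ioi i, qForm q i j) =
      (if k = i then r - 1 - i else 0) + if i < k then 1 else 0 := by
    intro i
    rw [degreeOf_prod_eq _ _ (hne i)]
    have h2 : ∀ j ∈ Finset.Ioi i, degreeOf k (qForm q i j) =
        (if k = i then 1 else 0) + if k = j then 1 else 0 := by
      intro j hj
      rw [degreeOf_qForm hq (Finset.mem_Ioi.1 hj).ne]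
      have := (Finset.mem_Ioi.1 hj).ne
      by_cases hki : k = i
      · have hkj : k ≠ j := fun h => this (hki.symm.trans h)
        simp [hki, this]
      · simp [hki]
    rw [Finset.sum_congr rfl h2, Finset.sum_add_distrib, Finset.sum_ite_eq, Finset.sum_const,
      Fin.card_Ioi]
    simp
  rw [Finset.sum_congr rfl fun i _ => h1 i, Finset.sum_add_distrib, Finset.sum_ite_eq]
  have h3 : (Finset.univ.filter fun i : Fin r => i < k) = Finset.Iio k := by ext; simp
  rw [← Finset.sum_filter, h3]
  simp only [Finset.mem_univ, if_true, Finset.sum_const, Fin.card_Iio, smul_eq_mul, mul_one]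
  omega

/-- `q wᵢ - q⁻¹ wⱼ` divides every polynomial that vanishes on the hyperplane `wⱼ = q² wᵢ`. -/
theorem qForm_dvd_sub_aeval {σ : Type*} [DecidableEq σ] {q : K} (hq : q ≠ 0) (i j : σ)
    (p : MvPolynomial σ K) :
    qForm q i j ∣ p - aeval (Function.update X j (C (q ^ 2) * X i : MvPolynomial σ K)) p := by
  induction p using MvPolynomial.induction_on with
  | C a => simp
  | add p p' hp hp' =>
    rw [map_add, add_sub_add_comm]; exact dvd_add hp hp'
  | mul_X p m hp =>
    rw [map_mul, aeval_X]
    set φ := aeval (Function.update X j (C (q ^ 2) * X i : MvPolynomial σ K)) p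
    have : p * X m - φ * Function.update X j (C (q ^ 2) * X i : MvPolynomial σ K) m =
      (p - φ) * X m + φ * (X m - Function.update X j (C (q ^ 2) * X i : MvPolynomial σ K) m) := by ring
    rw [this]
    refine dvd_add (hp.mul_right _) (Dvd.dvd.mul_left ?_ _)
    by_cases hm : m = j
    · subst hm
      rw [Function.update_self]
      refine ⟨-C q, ?_⟩
      have h1 : (C q * C q⁻¹ : MvPolynomial σ K) = 1 := by rw [← C_mul, mul_inv_cancel₀ hq, C_1]
      rw [qForm, C_pow]
      linear_combination -(X m) * h1
    · simp [hm]

theorem prime_qForm {σ : Type*} {q : K} (hq : q ≠ 0) {i j : σ} (hij : i ≠ j) :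
    Prime (qForm q i j) := by
  classical
  set φ : MvPolynomial σ K →ₐ[K] MvPolynomial σ K :=
    aeval (Function.update X j (C (q ^ 2) * X i : MvPolynomial σ K)) with hφ
  have hf : φ (qForm q i j) = 0 := by
    have h1 : (C q * C q⁻¹ : MvPolynomial σ K) = 1 := by rw [← C_mul, mul_inv_cancel₀ hq, C_1]
    simp only [qForm, hφ, map_sub, map_mul, aeval_X, Function.update_self,
      Function.update_of_ne hij, algHom_C, algebraMap_eq, C_pow]
    linear_combination -(X i * C q) * h1
  have hdvd : ∀ p, qForm q i j ∣ p ↔ φ p = 0 := by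
    intro p
    constructor
    · rintro ⟨g, rfl⟩; rw [map_mul, hf, zero_mul]
    · intro h
      have := qForm_dvd_sub_aeval hq i j p
      rwa [← hφ, h, sub_zero] at this
  refine ⟨qForm_ne_zero hq hij, fun hu => ?_, fun a b hab => ?_⟩
  · have := (hdvd 1).1 (hu.dvd)
    rw [map_one] at this; exact one_ne_zero this
  · rw [hdvd, map_mul, mul_eq_zero] at hab
    rwa [hdvd, hdvd]

/-- The linear factors of the product and of its reversal are not proportional if `q ^ 4 ≠ 1`. -/
theorem isRelPrime_qVandermonde_rev {r : ℕ} {q : K} (hq : q ≠ 0) (hq4 : q ^ 4 ≠ 1) :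
    IsRelPrime (qVandermonde r q) (rename (Fin.revPerm : Equiv.Perm (Fin r)) (qVandermonde r q)) := by
  simp only [qVandermonde, map_prod]
  refine IsRelPrime.prod_left fun i _ => IsRelPrime.prod_left fun j hj =>
    IsRelPrime.prod_right fun k _ => IsRelPrime.prod_right fun l hl => ?_
  rw [Finset.mem_Ioi] at hj hl
  rw [(prime_qForm hq hj.ne).irreducible.isRelPrime_iff_not_dvd]
  rintro ⟨g, hg⟩
  have hkl : Fin.revPerm l < Fin.revPerm k := by simpa using hl
  simp only [qForm, map_sub, map_mul, rename_X, algHom_C, algebraMap_eq] at hg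
  generalize Fin.revPerm k = k' at hg hkl
  generalize Fin.revPerm l = l' at hg hkl
  have key : ∀ v : Fin r → K, q * v i - q⁻¹ * v j = 0 → q * v k' - q⁻¹ * v l' = 0 := by
    intro v hv
    have := congrArg (eval v) hg
    simp only [map_sub, map_mul, eval_C, eval_X] at this
    rw [this, hv, zero_mul]
  by_cases hk : k' = i ∨ k' = j
  · by_cases hl' : l' = i ∨ l' = j
    · have h1 : k' = j ∧ l' = i := by
        rcases hk with rfl | rfl <;> rcases hl' with rfl | rfl
        · exact absurd hkl (lt_irrefl _)
        · exact absurd hkl (not_lt.2 hj.le)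
        · exact ⟨rfl, rfl⟩
        · exact absurd hkl (lt_irrefl _)
      obtain ⟨rfl, rfl⟩ := h1
      have := key (fun m => if m = l' then 1 else q ^ 2) (by
        simp [hj.ne']; field_simp; ring)
      simp [hj.ne'] at this
      apply hq4
      field_simp at this
      linear_combination this
    · push Not at hl'
      have := key (Pi.single l' 1) (by simp [hl'.1.symm, hl'.2.symm])
      simp [hkl.ne', hq] at this
  · push Not at hk
    have := key (Pi.single k' 1) (by simp [hk.1.symm, hk.2.symm])
    simp [hkl.ne, hq] at this

/-- Two polynomials that agree where a nonzero polynomial does not vanish are equal. -/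
theorem eq_of_eval_eq_off {σ : Type*} [Infinite K] {G p p' : MvPolynomial σ K} (hG : G ≠ 0)
    (h : ∀ w, eval w G ≠ 0 → eval w p = eval w p') : p = p' := by
  have : G * (p - p') = 0 := by
    apply MvPolynomial.funext
    intro w
    rw [map_mul, map_zero, map_sub]
    by_cases hw : eval w G = 0
    · rw [hw, zero_mul]
    · rw [h w hw, sub_self, mul_zero]
  rcases mul_eq_zero.1 this with h1 | h1
  · exact absurd h1 hG
  · exact sub_eq_zero.1 h1

/-- If `p` transforms under adjacent transpositions like the `q`-Vandermonde product, then it is a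
multiple of it. -/
theorem qVandermonde_dvd {m : ℕ} {q : K} (hq : q ≠ 0) (hq4 : q ^ 4 ≠ 1)
    (p : MvPolynomial (Fin (m + 1)) K)
    (h : ∀ i : Fin m, rename (Equiv.swap i.castSucc i.succ) p * qVandermonde (m + 1) q =
      p * rename (Equiv.swap i.castSucc i.succ) (qVandermonde (m + 1) q)) :
    qVandermonde (m + 1) q ∣ p := by
  have hV := qVandermonde_ne_zero (r := m + 1) hq
  have key : ∀ σ : Equiv.Perm (Fin (m + 1)), rename σ p * qVandermonde (m + 1) q =
      p * rename σ (qVandermonde (m + 1) q) := by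
    intro σ
    have hσ : σ ∈ Submonoid.closure (Set.range fun i : Fin m => Equiv.swap i.castSucc i.succ) := by
      rw [Equiv.Perm.mclosure_swap_castSucc_succ]; exact Submonoid.mem_top _
    induction hσ using Submonoid.closure_induction with
    | mem x hx => obtain ⟨i, rfl⟩ := hx; exact h i
    | one => simp
    | mul x y _ _ hx hy =>
      have hc : ∀ f : MvPolynomial (Fin (m + 1)) K,
          rename (⇑(x * y)) f = rename x (rename y f) := fun f => by
        rw [rename_rename]; rfl
      have h1 := congrArg (rename x) hy
      rw [map_mul, map_mul] at h1
      have hVx : rename x (qVandermonde (m + 1) q) ≠ 0 := fun h0 =>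
        hV (rename_injective _ x.injective (by rw [h0, map_zero]))
      rw [hc, hc]
      apply mul_right_cancel₀ hVx
      linear_combination qVandermonde (m + 1) q * h1 + rename x (rename y (qVandermonde (m + 1) q)) * hx
  -- the reversal of the variables turns the relation into a divisibility between coprime factors
  refine (isRelPrime_qVandermonde_rev hq hq4).dvd_of_dvd_mul_right ⟨rename Fin.revPerm p, ?_⟩
  rw [← key]; ring

end

/-! ### The system in rows, and minimality -/

section

variable {K : Type*} [Field K]

/-- The equations of the system, cleared of denominators and written out for each row, with the
degrees `m₁`, `mᵣ` in the normalizing factors as parameters. -/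
def SatisfiesRows {n : ℕ} (q : K) (m₁ mᵣ : ℕ) (Φ : PolyVector K n) : Prop :=
  ∀ (g : Node n) (w : Fin (2 * n + 1) → K), (∀ j, w j ≠ 0) → q - q⁻¹ * spectral q w g ≠ 0 →
    ∀ ρ, (q - q⁻¹ * spectral q w g) * weight q m₁ mᵣ w g * value Φ (reflect q w g) ρ =
      (q * spectral q w g - q⁻¹) * value Φ w ρ +
        (spectral q w g - 1) * ∑ ρ', generator q g ρ ρ' * value Φ w ρ'

theorem weight_ne_zero {n : ℕ} {q : K} (hq : q ≠ 0) (m₁ mᵣ : ℕ) {w : Fin (2 * n + 1) → K}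
    (hw : ∀ j, w j ≠ 0) (g : Node n) : weight q m₁ mᵣ w g ≠ 0 := by
  cases g
  · exact pow_ne_zero _ (mul_ne_zero (pow_ne_zero _ hq) (hw _))
  · exact one_ne_zero
  · exact pow_ne_zero _ (mul_ne_zero (hw _) (hw _))

theorem rMatrix_mulVec {ι : Type*} [Fintype ι] [DecidableEq ι] (q : K) (e : Matrix ι ι K) (u : K)
    (v : ι → K) (ρ : ι) : (rMatrix q e u).mulVec v ρ =
      (q - q⁻¹ * u)⁻¹ * ((q * u - q⁻¹) * v ρ + (u - 1) * ∑ ρ', e ρ ρ' * v ρ') := by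
  rw [rMatrix, Matrix.smul_mulVec, Matrix.add_mulVec, Matrix.smul_mulVec, Matrix.smul_mulVec,
    Matrix.one_mulVec]
  simp [Matrix.mulVec, dotProduct]

theorem isSolution_iff {n : ℕ} {q : K} (hq : q ≠ 0) {Φ : PolyVector K n} :
    IsSolution q Φ ↔ SatisfiesRows q (partialDegree Φ 0) (partialDegree Φ (Fin.last _)) Φ := by
  unfold IsSolution SatisfiesRows
  refine forall_congr' fun g => forall_congr' fun w => forall_congr' fun hw =>
    forall_congr' fun hu => ?_
  have h1 := weight_ne_zero hq (partialDegree Φ 0) (partialDegree Φ (Fin.last _)) hw g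
  rw [funext_iff]
  refine forall_congr' fun ρ => ?_
  rw [Pi.smul_apply, rMatrix_mulVec, smul_eq_mul, selfWeight]
  rw [inv_mul_eq_iff_eq_mul₀ h1, inv_mul_eq_iff_eq_mul₀ hu, eq_comm, ← mul_assoc]

theorem mul_generator_row_eq {n : ℕ} {q : K} (rank : OpenLinkPattern (2 * n + 1) → ℕ)
    (hrank : Function.Injective rank) {g : Node n} {ρ π : OpenLinkPattern (2 * n + 1)}
    (h : ∀ ρ', generator q g ρ ρ' ≠ 0 → rank ρ' ≤ rank π) (v : OpenLinkPattern (2 * n + 1) → K) :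
    ∑ ρ', generator q g ρ ρ' * v ρ' = generator q g ρ π * v π +
      ∑ ρ' ∈ Finset.univ.filter (fun ρ' => rank ρ' < rank π), generator q g ρ ρ' * v ρ' := by
  rw [← Finset.sum_insert (f := fun ρ' => generator q g ρ ρ' * v ρ') (a := π) (by simp)]
  symm
  apply Finset.sum_subset (Finset.subset_univ _)
  intro ρ' _ hρ'
  simp only [Finset.mem_insert, Finset.mem_filter, Finset.mem_univ, true_and, not_or] at hρ'
  by_cases h0 : generator q g ρ ρ' = 0
  · rw [h0, zero_mul]
  · exact absurd (lt_of_le_of_ne (h ρ' h0) fun h1 => hρ'.1 (hrank h1)) hρ'.2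

/-- A solution is triangular with respect to the order by the number of closed arches and their
right end points. -/
theorem isTriangular_of_isSolution {n : ℕ} {q : K} (hq : q ≠ 0) {Ψ : PolyVector K n}
    (hΨ : IsSolution q Ψ) : IsTriangular q Ψ := by
  refine ⟨patternRank, patternRank_injective _, patternRank_allOpen_le, fun π hπ => ?_⟩
  obtain ⟨g, ρ, h1, h2, h3⟩ := exists_triangular_row q hπ
  refine ⟨g, ρ, h1, h2, h3, fun w hw hu1 hu => ?_⟩
  have key := (isSolution_iff hq).1 hΨ g w hw hu ρ
  rw [mul_generator_row_eq patternRank (patternRank_injective _) h3] at key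
  have hu1' := sub_ne_zero.2 hu1
  change _ * selfWeight q Ψ w g * _ = _ at key
  rw [key, eq_comm, inv_mul_eq_iff_eq_mul₀ h2]
  field_simp
  ring

/-- The arguments at which the equation of a node can be divided by all factors in it are dense. -/
theorem exists_generic {n : ℕ} {q : K} (hq : q ≠ 0) (g : Node n) :
    ∃ G : MvPolynomial (Fin (2 * n + 1)) K, G ≠ 0 ∧ ∀ w, eval w G ≠ 0 →
      (∀ j, w j ≠ 0) ∧ spectral q w g ≠ 1 ∧ q - q⁻¹ * spectral q w g ≠ 0 := by
  have hX : ∏ j : Fin (2 * n + 1), (X j : MvPolynomial (Fin (2 * n + 1)) K) ≠ 0 :=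
    Finset.prod_ne_zero_iff.2 fun j _ => X_ne_zero j
  have hne : ∀ {p : MvPolynomial (Fin (2 * n + 1)) K} (w : Fin (2 * n + 1) → K), eval w p ≠ 0 →
      p ≠ 0 := by rintro p w h rfl; simp at h
  cases g with
  | affine =>
    refine ⟨(∏ j, X j) * ((C (q ^ 6) * X 0 ^ 2 - 1) * (C q - C (q⁻¹ * q ^ 6) * X 0 ^ 2)),
      mul_ne_zero hX (mul_ne_zero (hne 0 (by simp)) (hne 0 (by simp [hq]))), fun w hw => ?_⟩
    simp only [map_mul, map_prod, map_sub, map_pow, eval_X, eval_C, map_one, mul_ne_zero_iff,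
      Finset.prod_ne_zero_iff, Finset.mem_univ, forall_const] at hw
    refine ⟨hw.1, sub_ne_zero.1 hw.2.1, ?_⟩
    rw [spectral, ← mul_assoc]; exact hw.2.2
  | bulk i =>
    have hi : i.castSucc ≠ i.succ := (Fin.castSucc_lt_succ).ne
    refine ⟨(∏ j, X j) * ((X i.succ - X i.castSucc) * qForm q i.castSucc i.succ),
      mul_ne_zero hX (mul_ne_zero (hne (Pi.single i.succ 1) ?_) (qForm_ne_zero hq hi)), fun w hw => ?_⟩
    · simp [hi]
    simp only [map_mul, map_prod, map_sub, eval_X, eval_qForm, mul_ne_zero_iff,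
      Finset.prod_ne_zero_iff, Finset.mem_univ, forall_const] at hw
    have h0 := hw.1 i.castSucc
    refine ⟨hw.1, ?_, ?_⟩
    · rw [spectral, Ne, div_eq_one_iff_eq h0]; exact sub_ne_zero.1 hw.2.1
    · intro h
      apply hw.2.2
      simp only [spectral] at h
      field_simp at h
      field_simp
      linear_combination h
  | last =>
    refine ⟨(∏ j, X j) * ((X (Fin.last _) * X (penult n) - 1) *
      (C q * (X (Fin.last _) * X (penult n)) - C q⁻¹)),
      mul_ne_zero hX (mul_ne_zero (hne 0 (by simp)) (hne 0 (by simp [hq]))), fun w hw => ?_⟩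
    simp only [map_mul, map_prod, map_sub, eval_X, eval_C, map_one, mul_ne_zero_iff,
      Finset.prod_ne_zero_iff, Finset.mem_univ, forall_const] at hw
    have h0 := mul_ne_zero (hw.1 (Fin.last _)) (hw.1 (penult n))
    refine ⟨hw.1, ?_, ?_⟩
    · rw [spectral, Ne, div_eq_one_iff_eq h0, eq_comm]; exact sub_ne_zero.1 hw.2.1
    · intro h
      apply hw.2.2
      simp only [spectral] at h
      generalize w (Fin.last _) * w (penult n) = P at h h0 ⊢
      field_simp at h
      field_simp
      linear_combination h

/-- A solution is determined by its base entry. -/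
theorem SatisfiesRows.eq_zero [CharZero K] {n : ℕ} {q : K} (hq : q ≠ 0) {m₁ mᵣ : ℕ}
    {Φ : PolyVector K n} (hΦ : SatisfiesRows q m₁ mᵣ Φ) (h0 : Φ (allOpen _) = 0) : Φ = 0 := by
  funext π
  induction hm : patternRank π using Nat.strong_induction_on generalizing π with
  | _ m ih =>
    subst hm
    by_cases hπ : π = allOpen _
    · rw [hπ, h0]; rfl
    obtain ⟨g, ρ, h1, h2, h3⟩ := exists_triangular_row q hπ
    obtain ⟨G, hG, hG'⟩ := exists_generic hq g
    refine eq_of_eval_eq_off hG fun w hw => ?_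
    obtain ⟨hw0, hu1, hu⟩ := hG' w hw
    have key := hΦ g w hw0 hu ρ
    rw [mul_generator_row_eq patternRank (patternRank_injective _) h3] at key
    have hz : ∀ ρ', patternRank ρ' < patternRank π → ∀ w, value Φ w ρ' = 0 := fun ρ' h w => by
      rw [value, ih _ h ρ' rfl]; simp
    rw [hz ρ h1, hz ρ h1, Finset.sum_eq_zero (fun ρ' hρ' => by
      rw [hz ρ' (Finset.mem_filter.1 hρ').2, mul_zero])] at key
    simp only [mul_zero, add_zero, zero_add] at key
    have := mul_eq_zero.1 key.symm
    rcases this with h | h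
    · exact absurd (sub_eq_zero.1 h) hu1
    · simpa [value] using (mul_eq_zero.1 h).resolve_left h2

theorem SatisfiesRows.sub_smul {n : ℕ} {q : K} {m₁ mᵣ : ℕ} {Φ Ψ : PolyVector K n}
    (hΦ : SatisfiesRows q m₁ mᵣ Φ) (hΨ : SatisfiesRows q m₁ mᵣ Ψ) (c : K) :
    SatisfiesRows q m₁ mᵣ (fun π => Φ π - C c * Ψ π) := by
  intro g w hw hu ρ
  have h1 := hΦ g w hw hu ρ
  have h2 := hΨ g w hw hu ρ
  simp only [value, map_sub, map_mul, eval_C] at h1 h2 ⊢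
  have h3 : ∀ ρ', generator q g ρ ρ' * (eval w (Φ ρ') - c * eval w (Ψ ρ')) =
      generator q g ρ ρ' * eval w (Φ ρ') - c * (generator q g ρ ρ' * eval w (Ψ ρ')) := fun _ => by ring
  simp only [h3, Finset.sum_sub_distrib, ← Finset.mul_sum]
  linear_combination h1 - c * h2

/-- The exchange equation of a bulk node as an identity of polynomials. -/
theorem SatisfiesRows.exchange [CharZero K] {n : ℕ} {q : K} (hq : q ≠ 0) {m₁ mᵣ : ℕ}
    {Φ : PolyVector K n} (hΦ : SatisfiesRows q m₁ mᵣ Φ) (i : Fin (2 * n))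
    (ρ : OpenLinkPattern (2 * n + 1)) :
    qForm q i.castSucc i.succ * rename (Equiv.swap i.castSucc i.succ) (Φ ρ) =
      qForm q i.succ i.castSucc * Φ ρ + (X i.succ - X i.castSucc) *
        ∑ ρ', C (generator q (.bulk i) ρ ρ') * Φ ρ' := by
  obtain ⟨G, hG, hG'⟩ := exists_generic hq (Node.bulk i)
  refine eq_of_eval_eq_off hG fun w hw => ?_
  obtain ⟨hw0, -, hu⟩ := hG' w hw
  have key := hΦ (.bulk i) w hw0 hu ρ
  simp only [map_mul, map_add, map_sub, map_sum, eval_C, eval_X, eval_qForm, eval_rename]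
  simp only [value, weight, spectral, reflect, mul_one] at key
  have h0 := hw0 i.castSucc
  have hr : eval (w ∘ Equiv.swap i.castSucc i.succ) (Φ ρ) =
    eval (fun j => w (Equiv.swap i.castSucc i.succ j)) (Φ ρ) := rfl
  rw [hr]
  generalize eval (fun j => w (Equiv.swap i.castSucc i.succ j)) (Φ ρ) = A at *
  generalize ∑ ρ', generator q (.bulk i) ρ ρ' * eval w (Φ ρ') = S at *
  field_simp at key
  field_simp
  linear_combination key

theorem degreeOf_le_partialDegree {n : ℕ} (Φ : PolyVector K n) (j : Fin (2 * n + 1))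
    (π : OpenLinkPattern (2 * n + 1)) : degreeOf j (Φ π) ≤ partialDegree Φ j :=
  Finset.le_sup (f := fun π => degreeOf j (Φ π)) (Finset.mem_univ π)

/-- By the exchange equations, a solution has the same degree in all variables. -/
theorem SatisfiesRows.partialDegree_eq [CharZero K] {n : ℕ} {q : K} (hq : q ≠ 0) {m₁ mᵣ : ℕ}
    {Φ : PolyVector K n} (hΦ : SatisfiesRows q m₁ mᵣ Φ) (j k : Fin (2 * n + 1)) :
    partialDegree Φ j = partialDegree Φ k := by
  have step : ∀ i : Fin (2 * n), partialDegree Φ i.castSucc = partialDegree Φ i.succ := by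
    intro i
    have hi : i.castSucc ≠ i.succ := (Fin.castSucc_lt_succ).ne
    have gen : ∀ a b : Fin (2 * n + 1), (a = i.castSucc ∧ b = i.succ ∨ a = i.succ ∧ b = i.castSucc) →
        partialDegree Φ b ≤ partialDegree Φ a := by
      intro a b hab
      refine Finset.sup_le fun ρ _ => ?_
      by_cases hρ : Φ ρ = 0
      · simp [hρ]
      have hex := congrArg (degreeOf a) (hΦ.exchange hq i ρ)
      have hren : rename (Equiv.swap i.castSucc i.succ) (Φ ρ) ≠ 0 := fun h =>
        hρ (rename_injective _ (Equiv.injective _) (by rw [h, map_zero]))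
      have hda : degreeOf a (rename (Equiv.swap i.castSucc i.succ) (Φ ρ)) = degreeOf b (Φ ρ) := by
        have : a = Equiv.swap i.castSucc i.succ b := by
          rcases hab with ⟨rfl, rfl⟩ | ⟨rfl, rfl⟩ <;> simp
        rw [this, degreeOf_rename_of_injective (Equiv.injective _)]
      have ha : a = i.castSucc ∨ a = i.succ := hab.imp And.left And.left
      rw [degreeOf_mul_eq (qForm_ne_zero hq hi) hren, degreeOf_qForm hq hi, if_pos ha, hda] at hex
      have h1 : degreeOf a (qForm q i.succ i.castSucc * Φ ρ) ≤ 1 + partialDegree Φ a := by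
        refine (degreeOf_mul_le _ _ _).trans (add_le_add ?_ (degreeOf_le_partialDegree Φ a ρ))
        rw [degreeOf_qForm hq hi.symm]; split_ifs <;> simp
      have h2 : degreeOf a ((X i.succ - X i.castSucc) *
          ∑ ρ', C (generator q (.bulk i) ρ ρ') * Φ ρ') ≤ 1 + partialDegree Φ a := by
        refine (degreeOf_mul_le _ _ _).trans (add_le_add ?_ ?_)
        · refine (degreeOf_sub_le _ _ _).trans (max_le ?_ ?_) <;> rw [degreeOf_X] <;>
            split_ifs <;> simp
        · refine (degreeOf_sum_le _ _ _).trans (Finset.sup_le fun ρ' _ => ?_)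
          exact (degreeOf_C_mul_le _ _ _).trans (degreeOf_le_partialDegree Φ a ρ')
      have := (degreeOf_add_le a _ _).trans (max_le h1 h2)
      rw [← hex] at this
      omega
    exact le_antisymm (gen _ _ (Or.inr ⟨rfl, rfl⟩)) (gen _ _ (Or.inl ⟨rfl, rfl⟩))
  have h0 : ∀ j : Fin (2 * n + 1), partialDegree Φ j = partialDegree Φ 0 := by
    intro j
    induction j using Fin.induction with
    | zero => rfl
    | succ i ih => rw [← step, ih]
  rw [h0 j, h0 k]

/-- The base pattern does not occur in the image of a Temperley–Lieb generator. -/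
theorem generator_bulk_allOpen {n : ℕ} (q : K) (i : Fin (2 * n)) (π : OpenLinkPattern (2 * n + 1)) :
    generator q (.bulk i) (allOpen _) π = 0 := by
  by_contra h
  have hi : i.castSucc ≠ i.succ := (Fin.castSucc_lt_succ).ne
  have key : ∀ ρ : OpenLinkPattern (2 * n + 1), (colored ρ).1 i.castSucc = i.succ →
      (colored ρ).2 i.castSucc = false → ρ ≠ allOpen _ := by
    intro ρ h1 h2 h3
    have := eq_allOpen_iff.1 h3 i.castSucc
    rw [pattern_eq_of_colored, h2, h1] at this
    exact hi this.symm
  rcases eMatrix_ne_zero h with ⟨h1, h2, h3⟩ | ⟨h1, h2⟩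
  · exact key π h1 h2 h3.symm
  · exact key (allOpen _) (by rw [h2]; simp [join]) (by rw [h2]; simp [join]) rfl

/-- The `q`-Vandermonde product changes by a ratio of two linear forms under an adjacent
transposition. -/
theorem qForm_mul_rename_qVandermonde {m : ℕ} (q : K) (i : Fin m) :
    qForm q i.castSucc i.succ * rename (Equiv.swap i.castSucc i.succ) (qVandermonde (m + 1) q) =
      qForm q i.succ i.castSucc * qVandermonde (m + 1) q := by
  have hV : qVandermonde (m + 1) q =
      ∏ p ∈ Finset.univ.filter (fun p : Fin (m + 1) × Fin (m + 1) => p.1 < p.2), qForm q p.1 p.2 := by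
    rw [qVandermonde, Finset.prod_filter, Fintype.prod_prod_type]
    refine Finset.prod_congr rfl fun k _ => ?_
    rw [← Finset.prod_filter]
    exact Finset.prod_congr (by ext; simp) fun _ _ => rfl
  have hi : i.castSucc < i.succ := Fin.castSucc_lt_succ
  have hmem : (i.castSucc, i.succ) ∈
      Finset.univ.filter (fun p : Fin (m + 1) × Fin (m + 1) => p.1 < p.2) := by simp [hi]
  have hlt : ∀ p : Fin (m + 1) × Fin (m + 1), p.1 < p.2 → p ≠ (i.castSucc, i.succ) →
      Equiv.swap i.castSucc i.succ p.1 < Equiv.swap i.castSucc i.succ p.2 ∧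
      (Equiv.swap i.castSucc i.succ p.1, Equiv.swap i.castSucc i.succ p.2) ≠
        (i.castSucc, i.succ) := by
    rintro ⟨k, l⟩ hkl hne
    simp only [Ne, Prod.mk.injEq, not_and] at hkl hne ⊢
    simp only [Equiv.swap_apply_def]
    refine ⟨?_, fun h => ?_⟩
    · split_ifs <;> simp only [Fin.lt_def, Fin.ext_iff, Fin.val_succ, Fin.val_castSucc] at * <;> omega
    · split_ifs at * <;> simp only [Fin.lt_def, Fin.ext_iff, Fin.val_succ, Fin.val_castSucc] at * <;> omega
  have hren : ∀ a b : Fin (m + 1), rename (Equiv.swap i.castSucc i.succ) (qForm q a b) =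
      qForm q (Equiv.swap i.castSucc i.succ a) (Equiv.swap i.castSucc i.succ b) := by
    intro a b
    simp [qForm]
  rw [hV, map_prod, ← Finset.mul_prod_erase _ _ hmem, ← Finset.mul_prod_erase _ _ hmem, hren]
  have hprod : ∏ p ∈ (Finset.univ.filter
        (fun p : Fin (m + 1) × Fin (m + 1) => p.1 < p.2)).erase (i.castSucc, i.succ),
        rename (Equiv.swap i.castSucc i.succ) (qForm q p.1 p.2) =
      ∏ p ∈ (Finset.univ.filter
        (fun p : Fin (m + 1) × Fin (m + 1) => p.1 < p.2)).erase (i.castSucc, i.succ),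
        qForm q p.1 p.2 := by
    refine Finset.prod_nbij' (fun p => (Equiv.swap i.castSucc i.succ p.1,
      Equiv.swap i.castSucc i.succ p.2)) (fun p => (Equiv.swap i.castSucc i.succ p.1,
      Equiv.swap i.castSucc i.succ p.2)) ?_ ?_ ?_ ?_ ?_
    · intro p hp
      simp only [Finset.mem_erase, Finset.mem_filter, Finset.mem_univ, true_and] at hp ⊢
      exact (hlt p hp.2 hp.1).symm
    · intro p hp
      simp only [Finset.mem_erase, Finset.mem_filter, Finset.mem_univ, true_and] at hp ⊢
      exact (hlt p hp.2 hp.1).symm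
    · intro p _; simp
    · intro p _; simp
    · intro p _; exact hren p.1 p.2
  rw [hprod, Equiv.swap_apply_left, Equiv.swap_apply_right]
  ring

/-- The base entry of a solution transforms like the `q`-Vandermonde product and is therefore a
multiple of it; in the minimal degree the cofactor is a constant, and a solution is determined by its
base entry. -/
theorem minimality [CharZero K] {n : ℕ} {q : K} (hq : q ≠ 0) (hq4 : q ^ 4 ≠ 1)
    {Ψ : PolyVector K n} (hΨ : IsSolution q Ψ) (h0 : Ψ (allOpen _) = qVandermonde _ q)
    (hdeg : ∀ j, partialDegree Ψ j = 2 * n) {Φ : PolyVector K n} (hΦ : IsSolution q Φ)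
    (hne : Φ ≠ 0) : Φ (allOpen _) ≠ 0 ∧
      (2 * n + 1) * (2 * n) / 2 ≤ (Φ (allOpen _)).totalDegree ∧
      (∀ j, 2 * n ≤ partialDegree Φ j) ∧
      ((∃ j, partialDegree Φ j = 2 * n) → ∃ c : K, Φ = fun π => C c * Ψ π) := by
  have hR := (isSolution_iff hq).1 hΦ
  have hRΨ := (isSolution_iff hq).1 hΨ
  have hΦ0 : Φ (allOpen _) ≠ 0 := fun h => hne (hR.eq_zero hq h)
  have hdvd : qVandermonde (2 * n + 1) q ∣ Φ (allOpen _) := by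
    refine qVandermonde_dvd hq hq4 _ fun i => ?_
    have h1 := hR.exchange hq i (allOpen _)
    have h2 := qForm_mul_rename_qVandermonde q i
    simp only [generator_bulk_allOpen, C_0, zero_mul, Finset.sum_const_zero, mul_zero, add_zero] at h1
    apply mul_left_cancel₀ (qForm_ne_zero hq (Fin.castSucc_lt_succ (i := i)).ne)
    linear_combination qVandermonde (2 * n + 1) q * h1 - Φ (allOpen _) * h2
  refine ⟨hΦ0, ?_, fun j => ?_, ?_⟩
  · have := totalDegree_le_of_dvd_of_isDomain hdvd hΦ0
    rwa [totalDegree_qVandermonde hq] at this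
  · obtain ⟨S, hS⟩ := hdvd
    have hS0 : S ≠ 0 := by rintro rfl; exact hΦ0 (by rw [hS, mul_zero])
    have := degreeOf_le_partialDegree Φ j (allOpen _)
    rw [hS, degreeOf_mul_eq (qVandermonde_ne_zero hq) hS0, degreeOf_qVandermonde hq] at this
    omega
  · rintro ⟨j, hj⟩
    have hall : ∀ k, partialDegree Φ k = 2 * n := fun k => (hR.partialDegree_eq hq k j).trans hj
    obtain ⟨S, hS⟩ := hdvd
    have hS0 : S ≠ 0 := by rintro rfl; exact hΦ0 (by rw [hS, mul_zero])
    have hSdeg : ∀ k, degreeOf k S = 0 := by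
      intro k
      have := degreeOf_le_partialDegree Φ k (allOpen _)
      rw [hS, degreeOf_mul_eq (qVandermonde_ne_zero hq) hS0, degreeOf_qVandermonde hq, hall] at this
      omega
    obtain ⟨c, rfl⟩ : ∃ c, S = C c := by
      refine ⟨coeff 0 S, ?_⟩
      rw [← totalDegree_eq_zero_iff_eq_C, totalDegree_eq_zero_iff]
      intro m hm k
      have := monomial_le_degreeOf k hm
      rw [hSdeg] at this
      omega
    refine ⟨c, ?_⟩
    rw [hall, hall] at hR
    rw [hdeg, hdeg] at hRΨ
    have := (hR.sub_smul hRΨ c).eq_zero hq (by rw [hS, h0]; ring)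
    funext π
    exact sub_eq_zero.1 (congrFun this π)

end

/-! ### Diagrams in the spin chain -/

section

variable {K : Type*} [Field K]

/-- The coefficient of an arch of colour `c` in the spin basis, where `x` and `y` are the spins at its
left and right end. A solid arch pairs opposite spins, a dashed one equal spins. -/
def arcWeight (q : K) (c x y : Bool) : K := if y = xor x (!c) then (if x then 1 else -q⁻¹) else 0

/-- The factor of the point `i` in the spin tensor of a diagram: the weight of the arch whose left
end is `i`. -/
def arcFactor {r : ℕ} (q : K) (D : ColoredDiagram r) (ε : Fin r → Bool) (i : Fin r) : K :=
  if i < D.1 i then arcWeight q (D.2 i) (ε i) (ε (D.1 i)) else 1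

/-- The vector in the spin chain that represents a coloured diagram: the product of its arches, with
the sum of both spins at an open point. -/
def spinTensor {r : ℕ} (q : K) (D : ColoredDiagram r) (ε : Fin r → Bool) : K :=
  ∏ i, arcFactor q D ε i

/-- The two spins at the points `a` and `b` are set to given values. -/
def setTwo {r : ℕ} (ε : Fin r → Bool) (a b : Fin r) (x y : Bool) : Fin r → Bool :=
  Function.update (Function.update ε a x) b y

/-- The Temperley–Lieb generator on the spin chain, at the points `a` and `b`. -/
def spinE {r : ℕ} (q : K) (a b : Fin r) (v : (Fin r → Bool) → K) (ε : Fin r → Bool) : K :=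
  arcWeight q false (ε a) (ε b) *
    (-q * v (setTwo ε a b true false) + v (setTwo ε a b false true))

/-- The spin at the point `a` is reversed. -/
def flip {r : ℕ} (a : Fin r) (ε : Fin r → Bool) : Fin r → Bool := Function.update ε a (!ε a)

/-- The boundary generator on the spin chain. -/
def spinEZero {n : ℕ} (q : K) (v : (Fin (2 * n + 1) → Bool) → K) (ε : Fin (2 * n + 1) → Bool) : K :=
  -q⁻¹ * v (Function.update ε 0 true) - q * v (Function.update ε 0 false)

theorem spinTensor_eq_mul {r : ℕ} (q : K) (D : ColoredDiagram r) (ε : Fin r → Bool)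
    (S : Finset (Fin r)) :
    spinTensor q D ε = (∏ i ∈ S, arcFactor q D ε i) * ∏ i ∈ Sᶜ, arcFactor q D ε i :=
  (Finset.prod_mul_prod_compl S _).symm

/-- The possible positions of the partners of two neighbouring points. -/
theorem IsColoredPicture.neighbour_cases {r : ℕ} {D : ColoredDiagram r} (hD : IsColoredPicture D)
    {a b : Fin r} (hab : a < b) (hcov : ∀ c, a < c → b ≤ c) (hne : D.1 a ≠ b) :
    (D.1 a = a ∧ b < D.1 b) ∨ (D.1 b = b ∧ D.1 a < a ∧ D.2 a = false) ∨
    (D.1 a < a ∧ b < D.1 b) ∨ (D.1 b < D.1 a ∧ D.1 a < a ∧ D.2 a = false) ∨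
    (b < D.1 b ∧ D.1 b < D.1 a ∧ D.2 b = false) := by
  obtain ⟨σ, k⟩ := D
  obtain ⟨h1, h2, h3, ⟨o, h4⟩, h5, h6, h7⟩ := hD
  simp only at *
  have ea := h1 a
  have eb := h1 b
  have hne' : σ b ≠ a := fun h => hne (by rw [← h, h1])
  have hxy : σ a ≠ σ b := fun h => hab.ne (by rw [← h1 a, h, h1])
  have ca := hcov (σ a)
  have cb := hcov (σ b)
  have x1 := h3 a b hab
  have x2 := h3 (σ b) a
  have x3 := h3 a (σ b)
  have x4 := h3 (σ b) (σ a)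
  have x5 := h3 (σ a) b
  have x6 := h3 (σ a) (σ b)
  have x7 := h5 a b
  have x8 := h7 b a
  have x9 := h2 a
  have x10 := h2 b
  clear h3 h7 h5 h6 h2 hcov h1
  rw [ea] at x5 x6
  rw [eb] at x2 x4
  rw [ea] at x4
  rw [eb] at x3 x6
  rcases lt_trichotomy (σ a) a with h | h | h <;> rcases lt_trichotomy (σ b) b with h' | h' | h' <;> grind

theorem arcFactor_eq_of_join {r : ℕ} (q : K) {D : ColoredDiagram r} (hD : IsColoredPicture D)
    {a b : Fin r} (ε : Fin r → Bool) (x y : Bool) {i : Fin r} (h1 : i ≠ a) (h2 : i ≠ b)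
    (h3 : i ≠ D.1 a) (h4 : i ≠ D.1 b) :
    arcFactor q D (setTwo ε a b x y) i = arcFactor q (join D a b) ε i := by
  have h5 : D.1 i ≠ a := fun h => h3 (by rw [← h, hD.invol])
  have h6 : D.1 i ≠ b := fun h => h4 (by rw [← h, hD.invol])
  simp [arcFactor, join, h1, h2, h3, h4, h5, h6, setTwo]

/-- On spin tensors the Temperley–Lieb generator acts by gluing of diagrams. -/
theorem spinE_spinTensor_join {r : ℕ} {q : K} (hq : q ≠ 0) {D : ColoredDiagram r}
    (hD : IsColoredPicture D) {a b : Fin r} (hab : a < b) (hcov : ∀ c, a < c → b ≤ c)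
    (hne : D.1 a ≠ b) (ε : Fin r → Bool) :
    spinE q a b (spinTensor q D) ε = spinTensor q (join D a b) ε := by
  have hb := hD.invol b
  have ha := hD.invol a
  have hne' : D.1 b ≠ a := fun h => hne (by rw [← h, hb])
  have hxy : D.1 a ≠ D.1 b := fun h => hab.ne (by rw [← ha, h, hb])
  have hca := hD.color a
  have hcb := hD.color b
  have hrest : ∀ x y : Bool, ∏ i ∈ ({a, b, D.1 a, D.1 b} : Finset (Fin r))ᶜ,
      arcFactor q D (setTwo ε a b x y) i =
      ∏ i ∈ ({a, b, D.1 a, D.1 b} : Finset (Fin r))ᶜ, arcFactor q (join D a b) ε i := by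
    intro x y
    refine Finset.prod_congr rfl fun i hi => ?_
    simp only [Finset.mem_compl, Finset.mem_insert, Finset.mem_singleton, not_or] at hi
    exact arcFactor_eq_of_join q hD ε x y hi.1 hi.2.1 hi.2.2.1 hi.2.2.2
  unfold spinE
  rw [spinTensor_eq_mul q D (setTwo ε a b true false) {a, b, D.1 a, D.1 b},
    spinTensor_eq_mul q D (setTwo ε a b false true) {a, b, D.1 a, D.1 b},
    spinTensor_eq_mul q (join D a b) ε {a, b, D.1 a, D.1 b}, hrest, hrest]
  generalize ∏ i ∈ ({a, b, D.1 a, D.1 b} : Finset (Fin r))ᶜ, arcFactor q (join D a b) ε i = R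
  suffices h : arcWeight q false (ε a) (ε b) *
      (-q * ∏ i ∈ ({a, b, D.1 a, D.1 b} : Finset (Fin r)), arcFactor q D (setTwo ε a b true false) i +
        ∏ i ∈ ({a, b, D.1 a, D.1 b} : Finset (Fin r)), arcFactor q D (setTwo ε a b false true) i) =
      ∏ i ∈ ({a, b, D.1 a, D.1 b} : Finset (Fin r)), arcFactor q (join D a b) ε i by
    rw [← h]; ring
  have hba := hab.ne'
  have hab' := hab.ne
  obtain ⟨σ, k⟩ := D
  have hcov' := hD.neighbour_cases hab hcov hne
  simp only at *
  generalize hX : σ a = x at *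
  generalize hY : σ b = y at *
  -- only the factors of the at most four points involved change; compare them for all spins
  rcases hcov' with ⟨h1, h2⟩ | ⟨h1, h2, h3⟩ | ⟨h1, h2⟩ | ⟨h1, h2, h3⟩ | ⟨h1, h2, h3⟩
  · subst h1
    have hk : k x = false := hD.open_solid x hX
    have e1 : x < y := hab.trans h2
    have hp : ∀ f : Fin r → K, ∏ i ∈ ({x, b, x, y} : Finset (Fin r)), f i = f x * (f b * f y) := by
      intro f
      have hs : ({x, b, x, y} : Finset (Fin r)) = {x, b, y} := by ext; simp; tauto
      rw [hs, Finset.prod_insert (by simp [hab', e1.ne]), Finset.prod_insert (by simp [h2.ne]),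
        Finset.prod_singleton]
    simp only [hp, arcFactor, join, setTwo, hX, hY, hb, hab, hab', hba, h2, h2.ne, h2.ne', e1.ne,
      e1.ne', not_lt.2 h2.le, lt_irrefl, if_true, if_false, Function.update_self, ne_eq,
      not_false_eq_true, Function.update_of_ne, not_lt.2 hab.le]
    rcases hεa : ε x <;> rcases hεb : ε b <;> rcases hεy : ε y <;> rcases hkb : k b <;>
      simp [arcWeight, hq, hk, hkb]
  · subst h1
    have hk : k y = false := hD.open_solid y hY
    have e1 : x < y := h2.trans hab
    have hp : ∀ f : Fin r → K, ∏ i ∈ ({a, y, x, y} : Finset (Fin r)), f i = f a * (f y * f x) := by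
      intro f
      have hs : ({a, y, x, y} : Finset (Fin r)) = {a, y, x} := by ext; simp; tauto
      rw [hs, Finset.prod_insert (by simp [hab', h2.ne']), Finset.prod_insert (by simp [e1.ne']),
        Finset.prod_singleton]
    have hkx : k x = false := hca.trans h3
    simp only [hp, arcFactor, join, setTwo, hX, hY, ha, hab, hab', hba, h2, h2.ne, h2.ne', e1.ne,
      e1.ne', e1, not_lt.2 h2.le, not_lt.2 e1.le, lt_irrefl, if_true, if_false,
      Function.update_self, ne_eq,
      not_false_eq_true, Function.update_of_ne, not_lt.2 hab.le]
    rcases hεa : ε a <;> rcases hεb : ε y <;> rcases hεy : ε x <;>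
      simp [arcWeight, hq, hk, h3, hkx]
  · have e1 : x < b := h1.trans hab
    have e2 : a < y := hab.trans h2
    have e3 : x < y := e1.trans h2
    have hp : ∀ f : Fin r → K, ∏ i ∈ ({a, b, x, y} : Finset (Fin r)), f i =
        f a * (f b * (f x * f y)) := by
      intro f
      rw [Finset.prod_insert (by simp [hab', h1.ne', e2.ne]),
        Finset.prod_insert (by simp [e1.ne', h2.ne]), Finset.prod_insert (by simp [e3.ne]),
        Finset.prod_singleton]
    have hkx : k x = k a := hca
    have hky : k y = k b := hcb
    simp only [hp, arcFactor, join, setTwo, hX, hY, ha, hb, hab, hab', hba, h1, h1.ne, h1.ne', h2,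
      h2.ne, h2.ne', e1.ne, e1.ne', e2.ne, e2.ne', e3.ne, e3.ne', e1, e2, e3, not_lt.2 h1.le,
      not_lt.2 h2.le, not_lt.2 e1.le, not_lt.2 e2.le, not_lt.2 e3.le, lt_irrefl, if_true, if_false,
      Function.update_self, ne_eq, not_false_eq_true, Function.update_of_ne, not_lt.2 hab.le]
    rcases hεa : ε a <;> rcases hεb : ε b <;> rcases hεx : ε x <;> rcases hεy : ε y <;>
      rcases hka : k a <;> rcases hkb : k b <;>
      simp [arcWeight, hq, hka, hkb, hkx, hky]
  · have e1 : x < b := h2.trans hab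
    have e2 : y < a := h1.trans h2
    have e3 : y < b := h1.trans e1
    have hp : ∀ f : Fin r → K, ∏ i ∈ ({a, b, x, y} : Finset (Fin r)), f i =
        f a * (f b * (f x * f y)) := by
      intro f
      rw [Finset.prod_insert (by simp [hab', h2.ne', e2.ne']),
        Finset.prod_insert (by simp [e1.ne', e3.ne']), Finset.prod_insert (by simp [h1.ne']),
        Finset.prod_singleton]
    have hkx : k x = k a := hca
    have hky : k y = k b := hcb
    simp only [hp, arcFactor, join, setTwo, hX, hY, ha, hb, hab, hab', hba, h1, h1.ne, h1.ne', h2,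
      h2.ne, h2.ne', e1.ne, e1.ne', e2.ne, e2.ne', e3.ne, e3.ne', e1, e2, e3, not_lt.2 h1.le,
      not_lt.2 h2.le, not_lt.2 e1.le, not_lt.2 e2.le, not_lt.2 e3.le, lt_irrefl, if_true, if_false,
      Function.update_self, ne_eq, not_false_eq_true, Function.update_of_ne, not_lt.2 hab.le]
    rcases hεa : ε a <;> rcases hεb : ε b <;> rcases hεx : ε x <;> rcases hεy : ε y <;>
      rcases hkb : k b <;>
      simp [arcWeight, hq, h3, hkb, hkx, hky]
  · have e1 : b < x := h1.trans h2
    have e2 : a < y := hab.trans h1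
    have e3 : a < x := e2.trans h2
    have hp : ∀ f : Fin r → K, ∏ i ∈ ({a, b, x, y} : Finset (Fin r)), f i =
        f a * (f b * (f x * f y)) := by
      intro f
      rw [Finset.prod_insert (by simp [hab', e3.ne, e2.ne]),
        Finset.prod_insert (by simp [e1.ne, h1.ne]), Finset.prod_insert (by simp [h2.ne']),
        Finset.prod_singleton]
    have hkx : k x = k a := hca
    have hky : k y = k b := hcb
    simp only [hp, arcFactor, join, setTwo, hX, hY, ha, hb, hab, hab', hba, h1, h1.ne, h1.ne', h2,
      h2.ne, h2.ne', e1.ne, e1.ne', e2.ne, e2.ne', e3.ne, e3.ne', e1, e2, e3, not_lt.2 h1.le,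
      not_lt.2 h2.le, not_lt.2 e1.le, not_lt.2 e2.le, not_lt.2 e3.le, lt_irrefl, if_true, if_false,
      Function.update_self, ne_eq, not_false_eq_true, Function.update_of_ne, not_lt.2 hab.le]
    rcases hεa : ε a <;> rcases hεb : ε b <;> rcases hεx : ε x <;> rcases hεy : ε y <;>
      rcases hka : k a <;>
      simp [arcWeight, hq, h3, hka, hkx, hky]

/-- A solid loop has weight `β`, a loop which is half dashed has weight `0`. -/
theorem spinE_spinTensor_loop {r : ℕ} {q : K} (hq : q ≠ 0) {D : ColoredDiagram r}
    (hD : IsColoredPicture D) {a b : Fin r} (hab : a < b) (hab1 : D.1 a = b) (ε : Fin r → Bool) :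
    spinE q a b (spinTensor q D) ε =
      (if D.2 a = true then 0 else loopWeight q) * spinTensor q D ε := by
  have hb : D.1 b = a := by rw [← hab1, hD.invol]
  have hrest : ∀ x y : Bool, ∏ i ∈ ({a, b} : Finset (Fin r))ᶜ,
      arcFactor q D (setTwo ε a b x y) i =
      ∏ i ∈ ({a, b} : Finset (Fin r))ᶜ, arcFactor q D ε i := by
    intro x y
    refine Finset.prod_congr rfl fun i hi => ?_
    simp only [Finset.mem_compl, Finset.mem_insert, Finset.mem_singleton, not_or] at hi
    have h5 : D.1 i ≠ a := fun h => hi.2 (by rw [← hab1, ← h, hD.invol])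
    have h6 : D.1 i ≠ b := fun h => hi.1 (by rw [← hb, ← h, hD.invol])
    simp [arcFactor, setTwo, hi.1, hi.2, h5, h6]
  unfold spinE
  rw [spinTensor_eq_mul q D (setTwo ε a b true false) {a, b},
    spinTensor_eq_mul q D (setTwo ε a b false true) {a, b},
    spinTensor_eq_mul q D ε {a, b}, hrest, hrest]
  generalize ∏ i ∈ ({a, b} : Finset (Fin r))ᶜ, arcFactor q D ε i = R
  rw [Finset.prod_pair hab.ne, Finset.prod_pair hab.ne, Finset.prod_pair hab.ne]
  simp only [arcFactor, setTwo, hab1, hb, hab, not_lt.2 hab.le, if_true, if_false,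
    Function.update_self, ne_eq, hab.ne, hab.ne', not_false_eq_true, Function.update_of_ne]
  rcases hεa : ε a <;> rcases hεb : ε b <;> rcases hka : D.2 a <;>
    simp [arcWeight, hq, loopWeight] <;> ring

theorem spinTensor_switchLast {n : ℕ} (q : K) {D : ColoredDiagram (2 * n + 1)}
    (hD : IsColoredPicture D) (ε : Fin (2 * n + 1) → Bool) :
    spinTensor q (switchLast D) ε = spinTensor q D (flip (Fin.last _) ε) := by
  refine Finset.prod_congr rfl fun i _ => ?_
  have hl := hD.invol (Fin.last _)
  have hle := Fin.le_last i
  unfold switchLast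
  by_cases h : D.1 (Fin.last _) = Fin.last _
  · rw [if_pos h]
    have h1 : D.1 i ≠ Fin.last _ ∨ i = Fin.last _ := by
      by_contra hc
      push Not at hc
      exact hc.2 (by rw [← hD.invol i, hc.1, h])
    rcases h1 with h1 | h1
    · by_cases h2 : i = Fin.last _
      · exact absurd (h2 ▸ h) h1
      · simp [arcFactor, flip, h1, h2]
    · subst h1; simp [arcFactor, h]
  · rw [if_neg h]
    by_cases h2 : i = Fin.last _
    · subst h2
      have := Fin.le_last (D.1 (Fin.last (2 * n)))
      simp [arcFactor, not_lt.2 this]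
    · by_cases h1 : D.1 i = Fin.last _
      · have h3 : i = D.1 (Fin.last _) := by rw [← h1, hD.invol]
        have h4 : i < Fin.last _ := lt_of_le_of_ne hle h2
        simp only [arcFactor, h1, h4, if_true, h2, h3.symm, false_or, flip, Function.update_self,
          ne_eq, not_false_eq_true, Function.update_of_ne, arcWeight]
        rcases ε i <;> rcases ε (Fin.last _) <;> rcases D.2 i <;> simp
      · have h3 : i ≠ D.1 (Fin.last _) := fun h => h1 (by rw [h, hD.invol])
        simp [arcFactor, flip, h1, h2, h3]

theorem spinEZero_spinTensor_open {n : ℕ} (q : K) {D : ColoredDiagram (2 * n + 1)}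
    (hD : IsColoredPicture D) (h0 : D.1 0 = 0) (ε : Fin (2 * n + 1) → Bool) :
    spinEZero q (spinTensor q D) ε = loopWeight q * spinTensor q D ε := by
  have : ∀ x, spinTensor q D (Function.update ε 0 x) = spinTensor q D ε := by
    intro x
    refine Finset.prod_congr rfl fun i _ => ?_
    by_cases hi : i = 0
    · subst hi; simp [arcFactor, h0]
    · have : D.1 i ≠ 0 := fun h => hi (by rw [← hD.invol i, h, h0])
      simp [arcFactor, hi, this]
  rw [spinEZero, this, this, loopWeight]; ring

theorem spinEZero_spinTensor_cut {n : ℕ} {q : K} (hq : q ≠ 0) {D : ColoredDiagram (2 * n + 1)}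
    (hD : IsColoredPicture D) (h0 : D.1 0 ≠ 0) {o : Fin (2 * n + 1)} (ho : D.1 o = o)
    (ε : Fin (2 * n + 1) → Bool) :
    spinEZero q (spinTensor q D) ε =
      spinTensor q (cutFirst D o false) ε + spinTensor q (cutFirst D o true) ε := by
  have hk : D.2 0 = false := by
    by_contra h
    exact Fin.not_lt_zero _ (hD.open_lt_dashed o 0 ho (by simpa using h))
  have h1 := hD.invol 0
  have h2 : 0 < D.1 0 := Fin.pos_of_ne_zero h0
  have h3 : D.1 0 < o := by
    have ho0 : o ≠ 0 := fun h => h0 (h ▸ ho)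
    rcases lt_trichotomy (D.1 0) o with h | h | h
    · exact h
    · exact absurd (by rw [← h, h1] at ho; exact ho.symm) h0
    · exact absurd ho (hD.nest 0 o (Fin.pos_of_ne_zero ho0) h).2.2.1
  have h4 := h2.trans h3
  have hrest : ∀ x c, ∏ i ∈ ({0, D.1 0, o} : Finset _)ᶜ, arcFactor q D (Function.update ε 0 x) i =
      ∏ i ∈ ({0, D.1 0, o} : Finset _)ᶜ, arcFactor q (cutFirst D o c) ε i := by
    intro x c
    refine Finset.prod_congr rfl fun i hi => ?_
    simp only [Finset.mem_compl, Finset.mem_insert, Finset.mem_singleton, not_or] at hi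
    have h5 : D.1 i ≠ 0 := fun h => hi.2.1 (by rw [← h, hD.invol])
    simp [arcFactor, cutFirst, hi.1, hi.2, h5]
  have hp : ∀ f : Fin (2 * n + 1) → K, ∏ i ∈ ({0, D.1 0, o} : Finset _), f i =
      f 0 * (f (D.1 0) * f o) := by
    intro f
    rw [Finset.prod_insert (by simp [h2.ne, h4.ne]), Finset.prod_insert (by simp [h3.ne]),
      Finset.prod_singleton]
  rw [spinEZero, spinTensor_eq_mul q D (Function.update ε 0 true) {0, D.1 0, o},
    spinTensor_eq_mul q D (Function.update ε 0 false) {0, D.1 0, o},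
    spinTensor_eq_mul q _ ε {0, D.1 0, o}, spinTensor_eq_mul q (cutFirst D o true) ε {0, D.1 0, o},
    hrest true false, hrest false false, ← hrest true true, ← hrest true false]
  generalize ∏ i ∈ ({0, D.1 0, o} : Finset _)ᶜ, arcFactor q D (Function.update ε 0 true) i = R
  simp only [hp]
  simp only [arcFactor, cutFirst, h1, h2, h2.ne', ho, h3, h3.ne', h4.ne', not_lt.2 h2.le,
    not_lt.2 h3.le, lt_irrefl, if_true, if_false, true_or, Function.update_self, ne_eq,
    not_false_eq_true, Function.update_of_ne, hk]
  rcases ε (D.1 0) <;> rcases ε o <;> simp [arcWeight, hq]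

end

section

variable {K : Type*} [Field K]

/-- The vector in the spin chain that represents a combination of link patterns. -/
def spinVector {r : ℕ} (q : K) (v : OpenLinkPattern r → K) (ε : Fin r → Bool) : K :=
  ∑ π, v π * spinTensor q (colored π) ε

theorem sum_ite_colored {r : ℕ} (ρ₀ : OpenLinkPattern r) (f : OpenLinkPattern r → K) :
    ∑ ρ, (if colored ρ = colored ρ₀ then (1 : K) else 0) * f ρ = f ρ₀ := by
  simp [colored_injective.eq_iff]

theorem spinVector_mulVec {r : ℕ} (q : K) (M : Matrix (OpenLinkPattern r) (OpenLinkPattern r) K)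
    (v : OpenLinkPattern r → K) (ε : Fin r → Bool) :
    spinVector q (M.mulVec v) ε = ∑ π, v π * ∑ ρ, M ρ π * spinTensor q (colored ρ) ε := by
  simp only [spinVector, Matrix.mulVec, dotProduct, Finset.sum_mul, Finset.mul_sum]
  rw [Finset.sum_comm]
  exact Finset.sum_congr rfl fun _ _ => Finset.sum_congr rfl fun _ _ => by ring

theorem spinVector_eMatrix {n : ℕ} {q : K} (hq : q ≠ 0) (i : Fin (2 * n))
    (v : OpenLinkPattern (2 * n + 1) → K) (ε : Fin (2 * n + 1) → Bool) :
    spinVector q ((eMatrix q i.castSucc i.succ).mulVec v) ε =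
      spinE q i.castSucc i.succ (spinVector q v) ε := by
  have h : ∀ π : OpenLinkPattern (2 * n + 1), ∑ ρ, eMatrix q i.castSucc i.succ ρ π *
      spinTensor q (colored ρ) ε = spinE q i.castSucc i.succ (spinTensor q (colored π)) ε := by
    intro π
    by_cases h1 : (colored π).1 i.castSucc = i.succ
    · rw [spinE_spinTensor_loop hq (isColoredPicture_colored π) Fin.castSucc_lt_succ h1]
      simp only [eMatrix, h1, if_true]
      split_ifs <;> simp
    · rw [spinE_spinTensor_join hq (isColoredPicture_colored π) Fin.castSucc_lt_succ
        (succ_le_of_castSucc_lt i) h1]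
      obtain ⟨ρ₀, h⟩ := exists_colored_eq_join π i h1
      simp only [eMatrix, h1, if_false, ← h]
      exact sum_ite_colored ρ₀ fun ρ => spinTensor q (colored ρ) ε
  rw [spinVector_mulVec]
  simp only [h, spinE, spinVector, Finset.mul_sum, ← Finset.sum_add_distrib]
  exact Finset.sum_congr rfl fun _ _ => by ring

theorem spinVector_sMatrix {n : ℕ} (q : K)
    (v : OpenLinkPattern (2 * n + 1) → K) (ε : Fin (2 * n + 1) → Bool) :
    spinVector q ((sMatrix K n).mulVec v) ε = spinVector q v (flip (Fin.last _) ε) := by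
  rw [spinVector_mulVec]
  refine Finset.sum_congr rfl fun π _ => ?_
  rw [← spinTensor_switchLast q (isColoredPicture_colored π)]
  obtain ⟨ρ₀, h⟩ := exists_colored_eq_switchLast π
  simp only [sMatrix, ← h]
  rw [sum_ite_colored ρ₀ fun ρ => spinTensor q (colored ρ) ε]

theorem spinVector_eZeroMatrix {n : ℕ} {q : K} (hq : q ≠ 0)
    (v : OpenLinkPattern (2 * n + 1) → K) (ε : Fin (2 * n + 1) → Bool) :
    spinVector q ((eZeroMatrix q).mulVec v) ε = spinEZero q (spinVector q v) ε := by
  have h : ∀ π : OpenLinkPattern (2 * n + 1), ∑ ρ, eZeroMatrix q ρ π *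
      spinTensor q (colored ρ) ε = spinEZero q (spinTensor q (colored π)) ε := by
    intro π
    have hπ := isColoredPicture_colored π
    by_cases h0 : (colored π).1 0 = 0
    · rw [spinEZero_spinTensor_open q hπ h0]
      simp [eZeroMatrix, h0]
    · obtain ⟨o, ho⟩ := hπ.exists_open
      rw [spinEZero_spinTensor_cut hq hπ h0 ho]
      obtain ⟨ρ₀, h1⟩ := exists_colored_eq_cutFirst π h0 ho false
      obtain ⟨ρ₁, h2⟩ := exists_colored_eq_cutFirst π h0 ho true
      have hne : ρ₀ ≠ ρ₁ := by
        intro h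
        have h3 : (cutFirst (colored π) o false).2 o = (cutFirst (colored π) o true).2 o := by
          rw [← h1, ← h2, h]
        have ho0 : o ≠ 0 := fun h => h0 (h ▸ ho)
        simp [cutFirst, ho0] at h3
      rw [← h1, ← h2]
      have h4 : ∀ ρ, eZeroMatrix q ρ π * spinTensor q (colored ρ) ε =
          (if ρ = ρ₀ then spinTensor q (colored ρ) ε else 0) +
          (if ρ = ρ₁ then spinTensor q (colored ρ) ε else 0) := by
        intro ρ
        have h5 : (∃ o c, (colored π).1 o = o ∧ colored ρ = cutFirst (colored π) o c) ↔
            ρ = ρ₀ ∨ ρ = ρ₁ := by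
          constructor
          · rintro ⟨o', c, ho', h⟩
            rw [hπ.open_unique o' o ho' ho] at h
            cases c
            · exact Or.inl (colored_injective (h.trans h1.symm))
            · exact Or.inr (colored_injective (h.trans h2.symm))
          · rintro (rfl | rfl)
            · exact ⟨o, false, ho, h1⟩
            · exact ⟨o, true, ho, h2⟩
        simp only [eZeroMatrix, h0, if_false, h5]
        by_cases hρ : ρ = ρ₀
        · simp [hρ, hne]
        · simp [hρ]
      rw [Finset.sum_congr rfl fun ρ _ => h4 ρ, Finset.sum_add_distrib]
      simp
  rw [spinVector_mulVec]
  simp only [h, spinEZero, spinVector, Finset.mul_sum, ← Finset.sum_sub_distrib]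
  exact Finset.sum_congr rfl fun _ _ => by ring

end

/-! ### The Hecke algebra of type `B` -/

section

variable {K : Type*} [Field K] {M : Type*} [AddCommGroup M] [Module K M]

/-- A representation of the Hecke algebra of type `B` of rank `N + 1`, with parameter `q` for the
generators `τ 0, …, τ (N - 1)` and parameter `1` for the generator `s`, which is connected to
`τ 0`. -/
structure IsHeckeAction (N : ℕ) (q : K) (τ : ℕ → M →ₗ[K] M) (s : M →ₗ[K] M) : Prop where
  quadratic : ∀ k < N, ∀ x, τ k (τ k x) = (q - q⁻¹) • τ k x + x
  braid : ∀ k, k + 1 < N → ∀ x, τ k (τ (k + 1) (τ k x)) = τ (k + 1) (τ k (τ (k + 1) x))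
  comm : ∀ j k, j + 1 < k → k < N → ∀ x, τ j (τ k x) = τ k (τ j x)
  s_sq : ∀ x, s (s x) = x
  s_comm : ∀ k, 1 ≤ k → k < N → ∀ x, τ k (s x) = s (τ k x)
  s_braid : 0 < N → ∀ x, τ 0 (s (τ 0 (s x))) = s (τ 0 (s (τ 0 x)))

/-- The elements `τ (k - 1) ⋯ τ 0 s` of the Hecke algebra: they create a spin `-` at the point number
`k` from the right. -/
def creation (τ : ℕ → M →ₗ[K] M) (s : M →ₗ[K] M) : ℕ → M →ₗ[K] M
  | 0 => s
  | k + 1 => τ k ∘ₗ creation τ s k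

/-- The component `ε` of the family generated from the component `f` with all spins `+`. -/
def spinFamily (τ : ℕ → M →ₗ[K] M) (s : M →ₗ[K] M) : (m : ℕ) → (Fin m → Bool) → M → M
  | 0, _, f => f
  | m + 1, ε, f => spinFamily τ s m (fun i => ε i.succ) (if ε 0 then f else creation τ s m f)

variable {N : ℕ} {q : K} {τ : ℕ → M →ₗ[K] M} {s : M →ₗ[K] M}

namespace IsHeckeAction

theorem comm_creation (h : IsHeckeAction N q τ s) {j : ℕ} (hj : j < N) :
    ∀ k, k < j → ∀ x, τ j (creation τ s k x) = creation τ s k (τ j x)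
  | 0, hk, x => h.s_comm j hk hj x
  | k + 1, hk, x => by
    simp only [creation, LinearMap.comp_apply]
    rw [← h.comm k j hk hj, h.comm_creation hj k (by omega)]

/-- A vector on which the generators act by `q` keeps this property, for all generators but the
topmost ones, when a spin is created. -/
theorem apply_creation_of_lt (h : IsHeckeAction N q τ s) {f : M} {j : ℕ} :
    ∀ m, m ≤ N → j + 1 < m → (∀ i, i < m → τ i f = q • f) →
      τ j (creation τ s m f) = q • creation τ s m f
  | 0, _, hj, _ => absurd hj (by omega)
  | m + 1, hm, hj, hf => by
    simp only [creation, LinearMap.comp_apply]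
    rcases Nat.lt_or_ge (j + 1) m with hj' | hj'
    · rw [h.comm j m hj' (by omega),
        h.apply_creation_of_lt m (by omega) hj' fun i hi => hf i (by omega), map_smul]
    · obtain rfl : m = j + 1 := by omega
      simp only [creation, LinearMap.comp_apply]
      rw [h.braid j (by omega), h.comm_creation (by omega) j (by omega), hf (j + 1) (by omega)]
      simp only [map_smul]

/-- Two spins `-` created at neighbouring points form a `q`-eigenvector. -/
theorem apply_creation_creation (h : IsHeckeAction N q τ s) {f : M} :
    ∀ k, k < N → (∀ i, i ≤ k → τ i f = q • f) →
      τ k (creation τ s k (creation τ s (k + 1) f)) =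
        q • creation τ s k (creation τ s (k + 1) f)
  | 0, hk, hf => by
    simp only [creation, LinearMap.comp_apply]
    rw [h.s_braid hk, hf 0 le_rfl]
    simp only [map_smul]
  | k + 1, hk, hf => by
    have ih := h.apply_creation_creation k (by omega) fun i hi => hf i (by omega)
    simp only [creation, LinearMap.comp_apply] at ih ⊢
    rw [← h.comm_creation (j := k + 1) hk k (by omega), ← h.braid k hk, ih]
    simp only [map_smul]

theorem comm_spinFamily (h : IsHeckeAction N q τ s) {j : ℕ} (hj : j < N) :
    ∀ m, m ≤ j → ∀ (ε : Fin m → Bool) (x : M),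
      τ j (spinFamily τ s m ε x) = spinFamily τ s m ε (τ j x)
  | 0, _, _, _ => rfl
  | m + 1, hm, ε, x => by
    simp only [spinFamily]
    rw [h.comm_spinFamily hj m (by omega)]
    split_ifs
    · rfl
    · rw [h.comm_creation hj m (by omega)]

theorem spinFamily_smul : ∀ (m : ℕ) (ε : Fin m → Bool) (c : K) (x : M),
    spinFamily τ s m ε (c • x) = c • spinFamily τ s m ε x
  | 0, _, _, _ => rfl
  | m + 1, ε, c, x => by
    simp only [spinFamily]
    split_ifs <;> simp [spinFamily_smul m]

/-- The family generated from a common `q`-eigenvector satisfies the relations of the spin chain: equal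
neighbouring spins give a `q`-eigenvector, and the Hecke generator moves a spin `-` to the left. -/
theorem spinFamily_setTwo (h : IsHeckeAction N q τ s) :
    ∀ m : ℕ, m ≤ N → ∀ f : M, (∀ i < m, τ i f = q • f) → ∀ (ε : Fin (m + 1) → Bool)
      (i : Fin m),
      (∀ x, τ (m - 1 - i) (spinFamily τ s (m + 1) (setTwo ε i.castSucc i.succ x x) f) =
        q • spinFamily τ s (m + 1) (setTwo ε i.castSucc i.succ x x) f) ∧
      τ (m - 1 - i) (spinFamily τ s (m + 1) (setTwo ε i.castSucc i.succ true false) f) =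
        spinFamily τ s (m + 1) (setTwo ε i.castSucc i.succ false true) f
  | 0, _, _, _, _, i => i.elim0
  | m + 1, hm, f, hf, ε, i => by
    refine Fin.cases ?_ (fun i => ?_) i
    · have h0 : ∀ x y, spinFamily τ s (m + 1 + 1)
          (setTwo ε (Fin.castSucc 0) (Fin.succ 0) x y) f =
          spinFamily τ s m (fun i => ε i.succ.succ)
            (if y then (if x then f else creation τ s (m + 1) f)
              else creation τ s m (if x then f else creation τ s (m + 1) f)) := by
        intro x y
        have h1 : setTwo ε (Fin.castSucc 0) (Fin.succ 0) x y 0 = x := by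
          simp [setTwo]
        have h2 : setTwo ε (Fin.castSucc 0) (Fin.succ 0) x y (Fin.succ 0) = y := by
          simp [setTwo]
        have h3 : (fun i : Fin m => setTwo ε (Fin.castSucc 0) (Fin.succ 0) x y i.succ.succ) =
            fun i => ε i.succ.succ := by
          funext i
          simp only [setTwo, Function.update_apply]
          rw [if_neg (by simp [Fin.ext_iff]), if_neg (by simp [Fin.ext_iff])]
        simp only [spinFamily, h3, h1, h2]
      simp only [h0]
      have hi : m + 1 - 1 - ((0 : Fin (m + 1)) : ℕ) = m := by simp
      rw [hi]
      refine ⟨fun x => ?_, ?_⟩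
      · rw [h.comm_spinFamily hm m le_rfl, ← spinFamily_smul]
        congr 1
        cases x
        · simpa using h.apply_creation_creation m hm fun i hi => hf i (by omega)
        · simpa using hf m (by omega)
      · rw [h.comm_spinFamily hm m le_rfl]
        simp [creation]
    · have h0 : ∀ x y, spinFamily τ s (m + 1 + 1)
          (setTwo ε i.succ.castSucc i.succ.succ x y) f =
          spinFamily τ s (m + 1) (setTwo (fun i => ε i.succ) i.castSucc i.succ x y)
            (if ε 0 then f else creation τ s (m + 1) f) := by
        intro x y
        have h1 : setTwo ε i.succ.castSucc i.succ.succ x y 0 = ε 0 := by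
          simp only [setTwo, Function.update_apply]
          rw [if_neg (by simp [Fin.ext_iff]), if_neg (by simp [Fin.ext_iff])]
        have h3 : (fun j : Fin (m + 1) => setTwo ε i.succ.castSucc i.succ.succ x y j.succ) =
            setTwo (fun i => ε i.succ) i.castSucc i.succ x y := by
          funext j
          simp only [setTwo, Function.update_apply]
          congr 1
          · simp [Fin.ext_iff]
          · congr 1
            simp [Fin.ext_iff]
        rw [spinFamily, h3, h1]
      simp only [h0]
      have hi : m + 1 - 1 - (i.succ : ℕ) = m - 1 - i := by simp; omega
      rw [hi]
      refine h.spinFamily_setTwo m (by omega) _ (fun j hj => ?_) _ i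
      split_ifs
      · exact hf j (by omega)
      · exact h.apply_creation_of_lt (m + 1) hm (by omega) hf

/-- The generator `s` reverses the spin at the last point. -/
theorem s_spinFamily (h : IsHeckeAction N q τ s) : ∀ (m : ℕ) (f : M) (ε : Fin (m + 1) → Bool),
    s (spinFamily τ s (m + 1) ε f) = spinFamily τ s (m + 1) (flip (Fin.last m) ε) f
  | 0, f, ε => by
    have h1 : flip (Fin.last 0) ε 0 = !ε 0 := by simp [flip]
    simp only [spinFamily, h1]
    cases ε 0 <;> simp [creation, h.s_sq]
  | m + 1, f, ε => by
    rw [spinFamily, h.s_spinFamily m, spinFamily.eq_def τ s (m + 1 + 1) (flip (Fin.last (m + 1)) ε)]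
    have h1 : flip (Fin.last (m + 1)) ε 0 = ε 0 := by
      simp only [flip, Function.update_apply]
      rw [if_neg (by simp [Fin.ext_iff])]
    have h2 : flip (Fin.last m) (fun i => ε i.succ) =
        fun i : Fin (m + 1) => flip (Fin.last (m + 1)) ε i.succ := by
      funext j
      simp only [flip, Function.update_apply, Fin.succ_last]
      congr 1
      simp [Fin.ext_iff]
    simp only [h1, h2]

end IsHeckeAction

end

/-! ### Divided differences on functions of the spectral parameters -/

section

variable {K : Type*} [Field K] {r : ℕ}

/-- The points with nonzero coordinates such that `wᵢ ≠ wⱼ` and `wᵢ wⱼ ≠ 1` for `i ≠ j`. -/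
abbrev GenericPoint (K : Type*) [Field K] (r : ℕ) : Type _ :=
  {w : Fin r → K // (∀ i, w i ≠ 0) ∧ ∀ i j, i ≠ j → w i ≠ w j ∧ w i * w j ≠ 1}

namespace GenericPoint

/-- Exchange of two coordinates. -/
def swap (a b : Fin r) (w : GenericPoint K r) : GenericPoint K r :=
  ⟨fun j => w.1 (Equiv.swap a b j), fun _ => w.2.1 _,
    fun _ _ h => w.2.2 _ _ ((Equiv.swap a b).injective.ne h)⟩

/-- Inversion of a coordinate. -/
def invert (b : Fin r) (w : GenericPoint K r) : GenericPoint K r :=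
  ⟨Function.update w.1 b (w.1 b)⁻¹, by
    intro i
    by_cases h : i = b
    · subst h; simpa using w.2.1 i
    · simpa [h] using w.2.1 i, by
    intro i j hij
    have hb := w.2.1 b
    by_cases h : i = b
    · subst h
      have hj : j ≠ i := hij.symm
      obtain ⟨h1, h2⟩ := w.2.2 i j hij
      simp only [Function.update_self, ne_eq, hj, not_false_eq_true, Function.update_of_ne]
      constructor
      · intro h; exact h2 (by rw [← h]; field_simp)
      · intro h; exact h1 (by field_simp at h; exact h.symm)
    · by_cases h' : j = b
      · subst h'
        obtain ⟨h1, h2⟩ := w.2.2 i j hij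
        simp only [Function.update_self, ne_eq, h, not_false_eq_true, Function.update_of_ne]
        constructor
        · intro h; exact h2 (by rw [h]; field_simp)
        · intro h; exact h1 (by field_simp at h; exact h)
      · simpa [h, h'] using w.2.2 i j hij⟩

@[simp] theorem swap_left (a b : Fin r) (w : GenericPoint K r) : (swap a b w).1 a = w.1 b := by
  simp [swap]

@[simp] theorem swap_right (a b : Fin r) (w : GenericPoint K r) : (swap a b w).1 b = w.1 a := by
  simp [swap]

theorem swap_of_ne {a b c : Fin r} (w : GenericPoint K r) (h : c ≠ a) (h' : c ≠ b) :
    (swap a b w).1 c = w.1 c := by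
  simp [swap, Equiv.swap_apply_of_ne_of_ne h h']

@[simp] theorem invert_self (b : Fin r) (w : GenericPoint K r) :
    (invert b w).1 b = (w.1 b)⁻¹ := by simp [invert]

theorem invert_of_ne {b c : Fin r} (w : GenericPoint K r) (h : c ≠ b) :
    (invert b w).1 c = w.1 c := by simp [invert, h]

@[simp] theorem swap_swap (a b : Fin r) (w : GenericPoint K r) : swap a b (swap a b w) = w := by
  ext j; simp [swap]

@[simp] theorem invert_invert (b : Fin r) (w : GenericPoint K r) : invert b (invert b w) = w := by
  ext j
  by_cases h : j = b
  · subst h; simp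
  · simp [invert_of_ne _ h]

theorem swap_braid {a b c : Fin r} (hab : a ≠ b) (hbc : b ≠ c) (hac : a ≠ c)
    (w : GenericPoint K r) : swap a b (swap b c (swap a b w)) = swap b c (swap a b (swap b c w)) := by
  ext j
  simp only [swap, Equiv.swap_apply_def]
  grind

theorem swap_comm {a b c d : Fin r} (hac : a ≠ c) (had : a ≠ d) (hbc : b ≠ c) (hbd : b ≠ d)
    (w : GenericPoint K r) : swap a b (swap c d w) = swap c d (swap a b w) := by
  ext j
  simp only [swap, Equiv.swap_apply_def]
  grind

theorem swap_invert {a b c : Fin r} (hac : a ≠ c) (hbc : b ≠ c)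
    (w : GenericPoint K r) : swap a b (invert c w) = invert c (swap a b w) := by
  ext j
  simp only [swap, invert, Equiv.swap_apply_def, Function.update_apply]
  grind

theorem swap_invert_braid {a b : Fin r} (hab : a ≠ b) (w : GenericPoint K r) :
    swap a b (invert b (swap a b (invert b w))) = invert b (swap a b (invert b (swap a b w))) := by
  ext j
  simp only [swap, invert, Equiv.swap_apply_def, Function.update_apply]
  grind

end GenericPoint

open GenericPoint

/-- The Hecke generator that acts on functions of the spectral parameters by a divided difference in
the variables number `a` and `b`. -/
def exchangeOp (q : K) (a b : Fin r) : (GenericPoint K r → K) →ₗ[K] (GenericPoint K r → K) where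
  toFun A w := ((q * w.1 a - q⁻¹ * w.1 b) * A (swap a b w) - (q - q⁻¹) * w.1 a * A w) /
    (w.1 b - w.1 a)
  map_add' A B := by funext w; simp; ring
  map_smul' c A := by funext w; simp; ring

/-- The inversion of a variable, as an operator on functions. -/
def invertOp (b : Fin r) : (GenericPoint K r → K) →ₗ[K] (GenericPoint K r → K) where
  toFun A w := A (invert b w)
  map_add' _ _ := rfl
  map_smul' _ _ := rfl

theorem exchangeOp_apply (q : K) (a b : Fin r) (A : GenericPoint K r → K) (w : GenericPoint K r) :
    exchangeOp q a b A w = ((q * w.1 a - q⁻¹ * w.1 b) * A (swap a b w) - (q - q⁻¹) * w.1 a * A w) /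
      (w.1 b - w.1 a) := rfl

theorem invertOp_apply (b : Fin r) (A : GenericPoint K r → K) (w : GenericPoint K r) :
    invertOp b A w = A (invert b w) := rfl

variable {q : K}

theorem exchangeOp_quadratic (hq : q ≠ 0) {a b : Fin r} (hab : a ≠ b) (A : GenericPoint K r → K) :
    exchangeOp q a b (exchangeOp q a b A) = (q - q⁻¹) • exchangeOp q a b A + A := by
  funext w
  have h1 : w.1 b - w.1 a ≠ 0 := sub_ne_zero.2 (w.2.2 b a hab.symm).1
  have h2 : w.1 a - w.1 b ≠ 0 := sub_ne_zero.2 (w.2.2 a b hab).1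
  simp only [Pi.add_apply, Pi.smul_apply, smul_eq_mul, exchangeOp_apply, swap_left, swap_right,
    swap_swap]
  generalize A w = A1, A (swap a b w) = A2, w.1 a = x, w.1 b = y at *
  field_simp
  ring

theorem exchangeOp_comm {a b c d : Fin r} (hac : a ≠ c) (had : a ≠ d) (hbc : b ≠ c) (hbd : b ≠ d)
    (hab : a ≠ b) (hcd : c ≠ d) (A : GenericPoint K r → K) :
    exchangeOp q a b (exchangeOp q c d A) = exchangeOp q c d (exchangeOp q a b A) := by
  funext w
  have h1 : w.1 b - w.1 a ≠ 0 := sub_ne_zero.2 (w.2.2 b a hab.symm).1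
  have h2 : w.1 d - w.1 c ≠ 0 := sub_ne_zero.2 (w.2.2 d c hcd.symm).1
  simp only [exchangeOp_apply, swap_of_ne _ hac.symm hbc.symm, swap_of_ne _ had.symm hbd.symm,
    swap_of_ne _ hac had, swap_of_ne _ hbc hbd, swap_comm hac had hbc hbd]
  field_simp
  ring

theorem exchangeOp_invertOp_comm {a b c : Fin r} (hac : a ≠ c) (hbc : b ≠ c)
    (A : GenericPoint K r → K) :
    exchangeOp q a b (invertOp c A) = invertOp c (exchangeOp q a b A) := by
  funext w
  simp only [exchangeOp_apply, invertOp_apply, invert_of_ne _ hac, invert_of_ne _ hbc,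
    swap_invert hac hbc]

theorem exchangeOp_braid (hq : q ≠ 0) {a b c : Fin r} (hab : a ≠ b) (hbc : b ≠ c) (hac : a ≠ c)
    (A : GenericPoint K r → K) :
    exchangeOp q a b (exchangeOp q b c (exchangeOp q a b A)) =
      exchangeOp q b c (exchangeOp q a b (exchangeOp q b c A)) := by
  funext w
  have h1 : w.1 b - w.1 a ≠ 0 := sub_ne_zero.2 (w.2.2 b a hab.symm).1
  have h2 : w.1 c - w.1 b ≠ 0 := sub_ne_zero.2 (w.2.2 c b hbc.symm).1
  have h3 : w.1 c - w.1 a ≠ 0 := sub_ne_zero.2 (w.2.2 c a hac.symm).1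
  have h4 : w.1 a - w.1 b ≠ 0 := sub_ne_zero.2 (w.2.2 a b hab).1
  have h5 : w.1 b - w.1 c ≠ 0 := sub_ne_zero.2 (w.2.2 b c hbc).1
  simp only [exchangeOp_apply, swap_left, swap_right, swap_swap, swap_of_ne _ hac hab,
    swap_of_ne _ hab hac, swap_of_ne _ hac.symm hbc.symm, ← swap_braid hab hbc hac]
  generalize A w = A1, A (swap a b w) = A2, A (swap b c w) = A3, A (swap a b (swap b c w)) = A4,
    A (swap b c (swap a b w)) = A5, A (swap a b (swap b c (swap a b w))) = A6, w.1 a = x,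
    w.1 b = y, w.1 c = z at *
  field_simp
  ring

theorem exchangeOp_invertOp_braid (hq : q ≠ 0) {a b : Fin r} (hab : a ≠ b)
    (A : GenericPoint K r → K) :
    exchangeOp q a b (invertOp b (exchangeOp q a b (invertOp b A))) =
      invertOp b (exchangeOp q a b (invertOp b (exchangeOp q a b A))) := by
  funext w
  have h1 : w.1 b - w.1 a ≠ 0 := sub_ne_zero.2 (w.2.2 b a hab.symm).1
  have h2 : w.1 a - w.1 b ≠ 0 := sub_ne_zero.2 (w.2.2 a b hab).1
  have h3 : w.1 b * w.1 a - 1 ≠ 0 := sub_ne_zero.2 (w.2.2 b a hab.symm).2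
  have h4 : w.1 a * w.1 b - 1 ≠ 0 := sub_ne_zero.2 (w.2.2 a b hab).2
  have h5 : 1 - w.1 b * w.1 a ≠ 0 := sub_ne_zero.2 (w.2.2 b a hab.symm).2.symm
  have h6 : 1 - w.1 a * w.1 b ≠ 0 := sub_ne_zero.2 (w.2.2 a b hab).2.symm
  have h7 := w.2.1 a
  have h8 := w.2.1 b
  simp only [exchangeOp_apply, invertOp_apply, swap_left, swap_right, swap_swap, invert_self,
    invert_of_ne _ hab, swap_invert_braid hab, invert_invert]
  generalize w.1 a = x, w.1 b = y at *
  field_simp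
  ring

end

/-! ### The solution in the spin chain -/

section

variable {K : Type*} [Field K] {n : ℕ} {q : K}

open GenericPoint

/-- The action of the Hecke algebra of type `B` on functions of the spectral parameters. The generator
number `k` exchanges the variables at the positions `k` and `k + 1`, counted from the right. -/
noncomputable def heckeOp (n : ℕ) (q : K) (k : ℕ) :
    (GenericPoint K (2 * n + 1) → K) →ₗ[K] (GenericPoint K (2 * n + 1) → K) :=
  exchangeOp q ⟨2 * n - 1 - k, by omega⟩ ⟨2 * n - k, by omega⟩

theorem heckeOp_eq (q : K) (i : Fin (2 * n)) :
    heckeOp n q (2 * n - 1 - i) = exchangeOp q i.castSucc i.succ := by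
  rw [heckeOp]
  congr 1
  · ext; simp; omega
  · ext; simp; omega

theorem isHeckeAction_heckeOp (hq : q ≠ 0) :
    IsHeckeAction (2 * n) q (heckeOp n q) (invertOp (Fin.last (2 * n))) where
  quadratic k hk A := exchangeOp_quadratic hq (by simp; omega) A
  braid k hk A := by
    have := exchangeOp_braid hq (a := (⟨2 * n - 1 - (k + 1), by omega⟩ : Fin (2 * n + 1)))
      (b := ⟨2 * n - 1 - k, by omega⟩) (c := ⟨2 * n - k, by omega⟩) (by simp; omega)
      (by simp; omega) (by simp; omega) A
    have h : (⟨2 * n - (k + 1), by omega⟩ : Fin (2 * n + 1)) = ⟨2 * n - 1 - k, by omega⟩ := by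
      ext; simp; omega
    simp only [heckeOp, h]
    exact this.symm
  comm j k hj hk A := by
    exact exchangeOp_comm (by simp; omega) (by simp; omega) (by simp; omega) (by simp; omega)
      (by simp; omega) (by simp; omega) A
  s_sq A := by funext w; simp [invertOp_apply]
  s_comm k hk hk' A := exchangeOp_invertOp_comm (by simp [Fin.ext_iff]; omega)
    (by simp [Fin.ext_iff]; omega) A
  s_braid h A := by
    have h1 : (⟨2 * n - 0, by omega⟩ : Fin (2 * n + 1)) = Fin.last (2 * n) := rfl
    simp only [heckeOp, h1]
    exact exchangeOp_invertOp_braid hq (by simp [Fin.ext_iff]; omega) A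

/-- The base function, a Laurent polynomial with degrees between `-n` and `n` in each variable. -/
noncomputable def baseFunction (n : ℕ) (q : K) (w : GenericPoint K (2 * n + 1)) : K :=
  (∏ j, w.1 j ^ n)⁻¹ * eval w.1 (qVandermonde (2 * n + 1) q)

/-- The base function is a common `q`-eigenfunction of the divided differences. -/
theorem exchangeOp_baseFunction (i : Fin (2 * n)) :
    exchangeOp q i.castSucc i.succ (baseFunction n q) = q • baseFunction n q := by
  funext w
  have h := congrArg (eval w.1) (qForm_mul_rename_qVandermonde q i)
  simp only [map_mul, eval_qForm, eval_rename] at h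
  have h1 : w.1 i.succ - w.1 i.castSucc ≠ 0 :=
    sub_ne_zero.2 (w.2.2 _ _ (Fin.castSucc_lt_succ).ne').1
  have h2 : ∏ j, (swap i.castSucc i.succ w).1 j ^ n = ∏ j, w.1 j ^ n :=
    Equiv.prod_comp (Equiv.swap i.castSucc i.succ) fun j => w.1 j ^ n
  have h3 : eval (swap i.castSucc i.succ w).1 (qVandermonde (2 * n + 1) q) =
      eval (w.1 ∘ (Equiv.swap i.castSucc i.succ)) (qVandermonde (2 * n + 1) q) := rfl
  rw [exchangeOp_apply, div_eq_iff h1]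
  simp only [baseFunction, h2, h3, Pi.smul_apply, smul_eq_mul]
  linear_combination (∏ j, w.1 j ^ n)⁻¹ * h

/-- A family of functions, indexed by the spin configurations, solves the exchange relations at the
positions from `k` on, and the inversion relation at the last position. -/
structure IsSpinSolution (q : K) (k : ℕ)
    (A : (Fin (2 * n + 1) → Bool) → GenericPoint K (2 * n + 1) → K) : Prop where
  exchange : ∀ (i : Fin (2 * n)), k ≤ i → ∀ ε w,
    (q * w.1 i.castSucc - q⁻¹ * w.1 i.succ) * A ε (swap i.castSucc i.succ w) =
      (q * w.1 i.succ - q⁻¹ * w.1 i.castSucc) * A ε w +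
        (w.1 i.succ - w.1 i.castSucc) * spinE q i.castSucc i.succ (fun ε' => A ε' w) ε
  inversion : ∀ ε w, A ε (invert (Fin.last _) w) = A (flip (Fin.last _) ε) w

/-- The solution of the exchange and inversion relations in the spin chain. -/
noncomputable def spinSolution (n : ℕ) (q : K) (ε : Fin (2 * n + 1) → Bool) :
    GenericPoint K (2 * n + 1) → K :=
  spinFamily (heckeOp n q) (invertOp (Fin.last (2 * n))) (2 * n + 1) ε (baseFunction n q)

theorem setTwo_eq_self {r : ℕ} (ε : Fin r → Bool) (a b : Fin r) : setTwo ε a b (ε a) (ε b) = ε := by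
  simp [setTwo]

theorem spinSolution_true : spinSolution n q (fun _ => true) = baseFunction n q := by
  have : ∀ m f, spinFamily (heckeOp n q) (invertOp (Fin.last (2 * n))) m (fun _ => true) f = f := by
    intro m
    induction m with
    | zero => exact fun _ => rfl
    | succ m ih => intro f; simpa [spinFamily] using ih f
  exact this _ _

theorem isSpinSolution_spinSolution (hq : q ≠ 0) : IsSpinSolution q 0 (spinSolution n q) where
  exchange i _ ε w := by
    have hH := isHeckeAction_heckeOp (n := n) hq
    have hb : ∀ k < 2 * n, heckeOp n q k (baseFunction n q) = q • baseFunction n q := by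
      intro k hk
      have := heckeOp_eq q (⟨2 * n - 1 - k, by omega⟩ : Fin (2 * n))
      rw [show 2 * n - 1 - (2 * n - 1 - k) = k by omega] at this
      rw [this, exchangeOp_baseFunction]
    obtain ⟨h1, h2⟩ := hH.spinFamily_setTwo (2 * n) le_rfl (baseFunction n q) hb ε i
    have h3 := hH.quadratic (2 * n - 1 - i) (by omega)
      (spinSolution n q (setTwo ε i.castSucc i.succ true false))
    rw [spinSolution, h2, heckeOp_eq] at h3
    rw [heckeOp_eq] at h1 h2
    have hne := Fin.castSucc_lt_succ (i := i) |>.ne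
    have hw : w.1 i.succ - w.1 i.castSucc ≠ 0 := sub_ne_zero.2 (w.2.2 _ _ hne.symm).1
    have key : ∀ ε, (q * w.1 i.castSucc - q⁻¹ * w.1 i.succ) *
        spinSolution n q ε (swap i.castSucc i.succ w) =
        (w.1 i.succ - w.1 i.castSucc) * exchangeOp q i.castSucc i.succ (spinSolution n q ε) w +
          (q - q⁻¹) * w.1 i.castSucc * spinSolution n q ε w := by
      intro ε
      rw [exchangeOp_apply, mul_div_cancel₀ _ hw]; ring
    rw [key ε]
    have hε := setTwo_eq_self ε i.castSucc i.succ
    unfold spinE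
    rcases ha : ε i.castSucc <;> rcases hb : ε i.succ <;> rw [ha, hb] at hε
    · have := congrFun (h1 false) w
      rw [hε] at this
      rw [spinSolution, this]
      simp [arcWeight]
      ring
    · have := congrFun h3 w
      rw [hε] at this ⊢
      rw [spinSolution, this]
      simp [arcWeight, spinSolution]
      field_simp
      ring
    · have := congrFun h2 w
      rw [hε] at this ⊢
      rw [spinSolution, this]
      simp [arcWeight, spinSolution]
      ring
    · have := congrFun (h1 true) w
      rw [hε] at this
      rw [spinSolution, this]
      simp [arcWeight]
      ring
  inversion ε w := congrFun ((isHeckeAction_heckeOp (n := n) hq).s_spinFamily _ _ ε) w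

variable {k : ℕ} {A B : (Fin (2 * n + 1) → Bool) → GenericPoint K (2 * n + 1) → K}

theorem IsSpinSolution.sub (hA : IsSpinSolution q k A) (hB : IsSpinSolution q k B) :
    IsSpinSolution q k (A - B) where
  exchange i hi ε w := by
    have h1 := hA.exchange i hi ε w
    have h2 := hB.exchange i hi ε w
    simp only [spinE, Pi.sub_apply] at h1 h2 ⊢
    linear_combination h1 - h2
  inversion ε w := by simp [hA.inversion, hB.inversion]

theorem IsSpinSolution.mono {k' : ℕ} (hA : IsSpinSolution q k A) (h : k ≤ k') :
    IsSpinSolution q k' A := ⟨fun i hi => hA.exchange i (h.trans hi), hA.inversion⟩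

/-- If a component vanishes, so does the component with two neighbouring spins exchanged. -/
theorem IsSpinSolution.swap_eq_zero (hA : IsSpinSolution q k A) (hq : q ≠ 0) {i : Fin (2 * n)}
    (hi : k ≤ i) {ε : Fin (2 * n + 1) → Bool} (h : A ε = 0) :
    A (fun j => ε (Equiv.swap i.castSucc i.succ j)) = 0 := by
  have hne := Fin.castSucc_lt_succ (i := i) |>.ne
  have hs : (fun j => ε (Equiv.swap i.castSucc i.succ j)) =
      setTwo ε i.castSucc i.succ (ε i.succ) (ε i.castSucc) := by
    funext j
    simp only [setTwo, Function.update_apply, Equiv.swap_apply_def]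
    grind
  rw [hs]
  have hε := setTwo_eq_self ε i.castSucc i.succ
  funext w
  have hw : w.1 i.succ - w.1 i.castSucc ≠ 0 := sub_ne_zero.2 (w.2.2 _ _ hne.symm).1
  have h1 := hA.exchange i hi ε w
  simp only [h, Pi.zero_apply, mul_zero, zero_add, spinE] at h1
  rcases ha : ε i.castSucc <;> rcases hb : ε i.succ <;> rw [ha, hb] at hε
  · rw [hε, h]
  · rw [hε, h, ha, hb] at h1
    simpa [arcWeight, hw, hq] using h1
  · rw [hε, h, ha, hb] at h1
    simpa [arcWeight, hw, hq] using h1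
  · rw [hε, h]

/-- If a component vanishes, so does the component with one spin reversed: move this spin to the last
point, reverse it there and move it back. -/
theorem IsSpinSolution.flip_eq_zero (hA : IsSpinSolution q k A) (hq : q ≠ 0)
    {i : Fin (2 * n + 1)} (hi : k ≤ i) : ∀ {ε : Fin (2 * n + 1) → Bool}, A ε = 0 →
      A (flip i ε) = 0 := by
  induction i using Fin.reverseInduction with
  | last =>
    intro ε h
    funext w
    rw [← hA.inversion, h]; rfl
  | cast i ih =>
    intro ε h
    have hi' : k ≤ i := by simpa using hi
    have h1 := hA.swap_eq_zero hq hi' (ih (by simp; omega) (hA.swap_eq_zero hq hi' h))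
    convert h1 using 2
    funext j
    have hne := Fin.castSucc_lt_succ (i := i) |>.ne
    simp only [flip, Function.update_apply, Equiv.swap_apply_def]
    grind

/-- Exchange relations and inversion relation determine all components from a single one. -/
theorem IsSpinSolution.eq_zero (hA : IsSpinSolution q k A) (hq : q ≠ 0)
    {ε₀ : Fin (2 * n + 1) → Bool} (h : A ε₀ = 0) {ε : Fin (2 * n + 1) → Bool}
    (hε : ∀ i : Fin (2 * n + 1), (i : ℕ) < k → ε i = ε₀ i) : A ε = 0 := by
  have key : ∀ S : Finset (Fin (2 * n + 1)), (∀ i ∈ S, k ≤ (i : ℕ)) →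
      A (fun i => if i ∈ S then !ε₀ i else ε₀ i) = 0 := by
    intro S
    induction S using Finset.induction_on with
    | empty => simpa using h
    | insert a S ha ih =>
      intro hS
      have h1 := hA.flip_eq_zero hq (hS a (by simp)) (ih fun i hi => hS i (by simp [hi]))
      convert h1 using 2
      funext j
      by_cases hj : j = a
      · subst hj; simp [flip, ha]
      · simp [flip, hj]
  have h1 := key (Finset.univ.filter fun i => ε i ≠ ε₀ i) fun i hi => by
    by_contra hlt
    exact (Finset.mem_filter.1 hi).2 (hε i (not_le.1 hlt))
  convert h1 using 2
  funext j
  by_cases hj : ε j = ε₀ j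
  · simp [hj]
  · simp only [Finset.mem_filter, Finset.mem_univ, true_and, ne_eq, hj, not_false_eq_true, if_true]
    rcases h1 : ε j <;> rcases h2 : ε₀ j <;> simp_all

end

/-! ### Lagrange interpolation -/

section

variable {K : Type*} [Field K]

/-- A polynomial whose degree is less than the number of nodes minus one has a vanishing divided
difference. -/
theorem sum_eval_div_prod_eq_zero {ι : Type*} [Fintype ι] [DecidableEq ι] {v : ι → K}
    (hv : Function.Injective v) {P : Polynomial K} (hP : P.natDegree + 1 < Fintype.card ι) :
    ∑ i, P.eval (v i) / ∏ j, (if j = i then 1 else v i - v j) = 0 := by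
  have h := Lagrange.coeff_eq_sum (s := Finset.univ) (v := v) hv.injOn (P := P)
    ((Polynomial.degree_le_natDegree).trans_lt (by rw [Finset.card_univ]; exact_mod_cast (by omega)))
  rw [Finset.card_univ, Polynomial.coeff_eq_zero_of_natDegree_lt (by omega)] at h
  rw [h]
  refine Finset.sum_congr rfl fun i _ => ?_
  rw [← Finset.mul_prod_erase _ _ (Finset.mem_univ i), if_pos rfl, one_mul]
  congr 1
  exact Finset.prod_congr rfl fun j hj => if_neg (Finset.ne_of_mem_erase hj)

/-- The polynomial `∏ (q wₖ z - q⁻¹)` in `z`. -/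
noncomputable def reflectionPoly {r : ℕ} (q : K) (w : Fin r → K) : Polynomial K :=
  ∏ k, (Polynomial.C (q * w k) * Polynomial.X - Polynomial.C q⁻¹)

theorem eval_reflectionPoly {r : ℕ} (q : K) (w : Fin r → K) (z : K) :
    (reflectionPoly q w).eval z = ∏ k, (q * w k * z - q⁻¹) := by
  simp [reflectionPoly, Polynomial.eval_prod]

theorem natDegree_reflectionPoly_le {r : ℕ} (q : K) (w : Fin r → K) :
    (reflectionPoly q w).natDegree ≤ r := by
  refine (Polynomial.natDegree_prod_le _ _).trans ?_
  refine (Finset.sum_le_card_nsmul _ _ 1 fun k _ => ?_).trans (by simp)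
  exact Polynomial.natDegree_sub_C.trans_le (Polynomial.natDegree_C_mul_le _ _ |>.trans Polynomial.natDegree_X_le)

theorem prod_eq_mul_prod_ne {r : ℕ} (f : Fin r → K) (j : Fin r) :
    ∏ k, f k = f j * ∏ k, (if k = j then 1 else f k) := by
  rw [← Finset.mul_prod_erase _ f (Finset.mem_univ j),
    ← Finset.mul_prod_erase _ (fun k => if k = j then 1 else f k) (Finset.mem_univ j), if_pos rfl,
    one_mul]
  congr 1
  exact Finset.prod_congr rfl fun k hk => (if_neg (Finset.ne_of_mem_erase hk)).symm

/-- A product of an even number of differences does not change when all signs are reversed. -/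
theorem prod_ne_neg {n : ℕ} (w : Fin (2 * n + 1) → K) (j : Fin (2 * n + 1)) (z : K) :
    ∏ k, (if k = j then 1 else w k - z) = ∏ k, (if k = j then 1 else z - w k) := by
  have h : ∀ k, (if k = j then 1 else w k - z) =
      (if k = j then 1 else -1) * (if k = j then 1 else z - w k) := by
    intro k; split_ifs <;> ring
  rw [Finset.prod_congr rfl fun k _ => h k, Finset.prod_mul_distrib]
  have h1 : ∏ k : Fin (2 * n + 1), (if k = j then (1 : K) else -1) = 1 := by
    have h2 := prod_eq_mul_prod_ne (fun _ : Fin (2 * n + 1) => (-1 : K)) j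
    simp [pow_succ, pow_mul] at h2
    exact h2.symm
  rw [h1, one_mul]

/-- The weight `∏ (q wₖ wⱼ - q⁻¹) / (wₖ - wⱼ)`, over `k ≠ j`. -/
noncomputable def residueWeight {r : ℕ} (q : K) (w : Fin r → K) (j : Fin r) : K :=
  (∏ k, (if k = j then 1 else q * w k * w j - q⁻¹)) / ∏ k, (if k = j then 1 else w k - w j)

section

variable {n : ℕ} {q : K} {w : Fin (2 * n + 1) → K}

theorem inv_ne_neg_inv [CharZero K] (hq : q ≠ 0) : q⁻¹ ≠ -q⁻¹ := by
  intro h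
  have : (2 : K) * q⁻¹ = 0 := by linear_combination h
  simp [hq] at this

theorem prod_at_inv (hq : q ≠ 0) (w : Fin (2 * n + 1) → K) :
    ∏ k, (q * w k * q⁻¹ - q⁻¹) = -∏ k, (q⁻¹ - w k) := by
  have h : ∀ k, q * w k * q⁻¹ - q⁻¹ = -1 * (q⁻¹ - w k) := by
    intro k; field_simp; ring
  rw [Finset.prod_congr rfl fun k _ => h k, Finset.prod_mul_distrib]
  simp [pow_succ, pow_mul]

theorem prod_at_neg_inv (hq : q ≠ 0) (w : Fin (2 * n + 1) → K) :
    ∏ k, (q * w k * -q⁻¹ - q⁻¹) = ∏ k, (-q⁻¹ - w k) := by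
  refine Finset.prod_congr rfl fun k _ => ?_
  field_simp
  ring

theorem prod_ne_ne_zero (hw : Function.Injective w) (x : Fin (2 * n + 1)) :
    ∏ k, (if k = x then 1 else w x - w k) ≠ 0 := by
  refine Finset.prod_ne_zero_iff.2 fun k _ => ?_
  split_ifs with h
  · exact one_ne_zero
  · exact sub_ne_zero.2 (hw.ne (Ne.symm h))

theorem prod_eq_residueWeight (hq : q ≠ 0) (hw : Function.Injective w) (x : Fin (2 * n + 1)) :
    ∏ k, (q * w k * w x - q⁻¹) = q * ((w x - q⁻¹) * (w x + q⁻¹)) *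
      ((∏ k, if k = x then 1 else w x - w k) * residueWeight q w x) := by
  have h := prod_ne_ne_zero hw x
  rw [residueWeight, prod_ne_neg w x (w x), mul_div_cancel₀ _ h,
    prod_eq_mul_prod_ne (fun k => q * w k * w x - q⁻¹) x]
  congr 1
  field_simp
  ring

/-- Lagrange interpolation of `∏ (q wₖ z - q⁻¹)` at the nodes `wⱼ` and `±q⁻¹`: at the two additional
nodes the factors cancel against the differences of the nodes. -/
theorem sum_residueWeight [CharZero K] (hq : q ≠ 0) (hw : Function.Injective w)
    (h1 : ∀ j, w j ≠ q⁻¹) (h2 : ∀ j, w j ≠ -q⁻¹) :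
    ∑ j, residueWeight q w j = 1 := by
  let v : Fin (2 * n + 1) ⊕ Fin 2 → K := Sum.elim w ![q⁻¹, -q⁻¹]
  have hqq := inv_ne_neg_inv hq
  have hv : Function.Injective v := by
    rintro (i | i) (j | j) h
    · exact congrArg _ (hw h)
    · fin_cases j <;> simp [v] at h
      · exact absurd h (h1 _)
      · exact absurd h (h2 _)
    · fin_cases i <;> simp [v] at h
      · exact absurd h.symm (h1 _)
      · exact absurd h.symm (h2 _)
    · congr 1
      fin_cases i <;> fin_cases j <;> simp [v] at h ⊢
      · exact hqq h
      · exact hqq h.symm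
  have h := sum_eval_div_prod_eq_zero hv (P := reflectionPoly q w)
    (by have := natDegree_reflectionPoly_le q w; simp; omega)
  simp only [Fintype.sum_sum_type, Fintype.prod_sum_type, v, Sum.elim_inl, Sum.elim_inr,
    Fin.sum_univ_two, Fin.prod_univ_two, Sum.inl.injEq, Sum.inr.injEq, reduceCtorEq, if_false,
    eval_reflectionPoly] at h
  simp only [Matrix.cons_val_zero, sub_neg_eq_add, Matrix.cons_val_one, Matrix.cons_val_fin_one,
    if_true, one_ne_zero, zero_ne_one, if_false, one_mul, mul_one] at h
  rw [prod_at_inv hq, prod_at_neg_inv hq] at h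
  have ht : ∀ x, (∏ k, (q * w k * w x - q⁻¹)) /
      ((∏ k, if k = x then 1 else w x - w k) * ((w x - q⁻¹) * (w x + q⁻¹))) =
      q * residueWeight q w x := by
    intro x
    rw [prod_eq_residueWeight hq hw x]
    have e1 : w x - q⁻¹ ≠ 0 := sub_ne_zero.2 (h1 x)
    have e2 : w x + q⁻¹ ≠ 0 := fun h => h2 x (eq_neg_of_add_eq_zero_left h)
    have e3 := prod_ne_ne_zero hw x
    generalize w x - q⁻¹ = y1, w x + q⁻¹ = y2 at *
    field_simp
  simp only [ht, ← Finset.mul_sum] at h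
  have e4 : ∏ k, (q⁻¹ - w k) ≠ 0 := Finset.prod_ne_zero_iff.2 fun k _ => sub_ne_zero.2 (h1 k).symm
  have e5 : ∏ k, (-q⁻¹ - w k) ≠ 0 := Finset.prod_ne_zero_iff.2 fun k _ => sub_ne_zero.2 (h2 k).symm
  generalize ∏ k, (q⁻¹ - w k) = R1, ∏ k, (-q⁻¹ - w k) = R2, ∑ j, residueWeight q w j = S at *
  have h' : q * (S - 1) = 0 := by
    rw [← h]
    field_simp
    ring
  exact sub_eq_zero.1 ((mul_eq_zero.1 h').resolve_left hq)

/-- Lagrange interpolation of `∏ (q wₖ z - q⁻¹)` with an additional node `a`. -/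
theorem sum_residueWeight_div [CharZero K] (hq : q ≠ 0) (hw : Function.Injective w)
    (h1 : ∀ j, w j ≠ q⁻¹) (h2 : ∀ j, w j ≠ -q⁻¹) {a : K} (ha : ∀ j, w j ≠ a) (h3 : a ≠ q⁻¹)
    (h4 : a ≠ -q⁻¹) :
    (q ^ 2 * a ^ 2 - 1) * ∑ j, residueWeight q w j / (a - w j) =
      q ^ 2 * a + q * ∏ k, (q * w k * a - q⁻¹) / (a - w k) := by
  let v : Fin (2 * n + 1) ⊕ Fin 3 → K := Sum.elim w ![q⁻¹, -q⁻¹, a]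
  have hqq := inv_ne_neg_inv hq
  have hv : Function.Injective v := by
    rintro (i | i) (j | j) h
    · exact congrArg _ (hw h)
    · fin_cases j <;> simp [v] at h
      · exact absurd h (h1 _)
      · exact absurd h (h2 _)
      · exact absurd h (ha _)
    · fin_cases i <;> simp [v] at h
      · exact absurd h.symm (h1 _)
      · exact absurd h.symm (h2 _)
      · exact absurd h.symm (ha _)
    · congr 1
      fin_cases i <;> fin_cases j <;> simp [v] at h ⊢
      · exact hqq h
      · exact h3 h.symm
      · exact hqq h.symm
      · exact h4 h.symm
      · exact h3 h
      · exact h4 h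
  have h := sum_eval_div_prod_eq_zero hv (P := reflectionPoly q w)
    (by have := natDegree_reflectionPoly_le q w; simp; omega)
  simp only [Fintype.sum_sum_type, Fintype.prod_sum_type, v, Sum.elim_inl, Sum.elim_inr,
    Fin.sum_univ_three, Fin.prod_univ_three, Sum.inl.injEq, Sum.inr.injEq, reduceCtorEq, if_false,
    eval_reflectionPoly] at h
  simp only [Matrix.cons_val_zero, sub_neg_eq_add, Matrix.cons_val_one, Matrix.cons_val,
    if_true, one_ne_zero, zero_ne_one, if_false, one_mul, mul_one, Fin.reduceEq] at h
  rw [prod_at_inv hq, prod_at_neg_inv hq] at h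
  have ht : ∀ x, (∏ k, (q * w k * w x - q⁻¹)) /
      ((∏ k, if k = x then 1 else w x - w k) * ((w x - q⁻¹) * (w x + q⁻¹) * (w x - a))) =
      -q * (residueWeight q w x / (a - w x)) := by
    intro x
    rw [prod_eq_residueWeight hq hw x]
    have e1 : w x - q⁻¹ ≠ 0 := sub_ne_zero.2 (h1 x)
    have e2 : w x + q⁻¹ ≠ 0 := fun h => h2 x (eq_neg_of_add_eq_zero_left h)
    have e3 := prod_ne_ne_zero hw x
    have e5 : a - w x ≠ 0 := sub_ne_zero.2 (ha x).symm
    rw [← neg_sub a (w x)]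
    generalize w x - q⁻¹ = y1, w x + q⁻¹ = y2, a - w x = y3 at *
    field_simp
  simp only [ht, ← Finset.mul_sum] at h
  rw [Finset.prod_div_distrib]
  have e1 : q * a - 1 ≠ 0 := fun h => h3 (by field_simp; linear_combination h)
  have e2 : q * a + 1 ≠ 0 := fun h => h4 (by field_simp; linear_combination h)
  have e4 : ∏ k, (q⁻¹ - w k) ≠ 0 := Finset.prod_ne_zero_iff.2 fun k _ => sub_ne_zero.2 (h1 k).symm
  have e5 : ∏ k, (-q⁻¹ - w k) ≠ 0 := Finset.prod_ne_zero_iff.2 fun k _ => sub_ne_zero.2 (h2 k).symm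
  have e6 : ∏ k, (a - w k) ≠ 0 := Finset.prod_ne_zero_iff.2 fun k _ => sub_ne_zero.2 (ha k).symm
  generalize ∏ k, (q⁻¹ - w k) = R1, ∏ k, (-q⁻¹ - w k) = R2, ∏ k, (a - w k) = R3,
    ∏ k, (q * w k * a - q⁻¹) = R4, ∑ j, residueWeight q w j / (a - w j) = S at *
  have f1 : a - q⁻¹ = (q * a - 1) / q := by field_simp
  have f2 : a + q⁻¹ = (q * a + 1) / q := by field_simp
  have f3 : q⁻¹ - a = -(q * a - 1) / q := by field_simp; ring
  have f4 : -q⁻¹ - a = -(q * a + 1) / q := by field_simp; ring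
  rw [f1, f2, f3, f4] at h
  have f5 : q ^ 2 * a ^ 2 - 1 = (q * a - 1) * (q * a + 1) := by ring
  have h' : -q * (q ^ 2 * a ^ 2 - 1) * S + q * (q ^ 2 * a + q * (R4 / R3)) = 0 := by
    rw [f5]
    generalize hA : q * a - 1 = A1 at *
    generalize hB : q * a + 1 = B1 at *
    have hAB : B1 = A1 + 2 := by rw [← hA, ← hB]; ring
    have ha' : a = (A1 + 1) / q := by rw [← hA]; field_simp; ring
    have h2 : A1 * B1 * 0 = (0 : K) := mul_zero _
    rw [← h2, ← h, ha']
    field_simp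
    rw [hAB]
    ring
  have h'' : -q * ((q ^ 2 * a ^ 2 - 1) * S - (q ^ 2 * a + q * (R4 / R3))) = 0 := by
    linear_combination h'
  exact sub_eq_zero.1 ((mul_eq_zero.1 h'').resolve_left (neg_ne_zero.2 hq))

end

end

/-! ### The components with a single spin `-` -/

section

variable {K : Type*} [Field K]

open GenericPoint

/-- A product over the points before `i`, a factor at `i`, and a product over the points after `i`: the
numerator of the component with a single spin `-`, at the point `i`. -/
noncomputable def singlePoly {r : ℕ} (q : K) (w : Fin r → K) (i : Fin r) (z : K) : K :=
  ∏ k, (if k < i then w k - z else if k = i then (q - q⁻¹) * w i else q * w k - q⁻¹ * z)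

/-- The sum of `f (wⱼ)` against the residues at `wⱼ`. -/
noncomputable def residueSum {r : ℕ} (q : K) (w : Fin r → K) (f : K → K) : K :=
  ∑ j, f (w j) * (residueWeight q w j / ∏ k, (q * w k - q⁻¹ * w j))

theorem residueWeight_comp {r : ℕ} (q : K) (w : Fin r → K) (σ : Equiv.Perm (Fin r)) (j : Fin r) :
    residueWeight q (fun k => w (σ k)) j = residueWeight q w (σ j) := by
  unfold residueWeight
  congr 1
  · rw [← Equiv.prod_comp σ fun k => if k = σ j then 1 else q * w k * w (σ j) - q⁻¹]
    simp
  · rw [← Equiv.prod_comp σ fun k => if k = σ j then 1 else w k - w (σ j)]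
    simp

theorem residueSum_comp {r : ℕ} (q : K) (w : Fin r → K) (σ : Equiv.Perm (Fin r)) (f : K → K) :
    residueSum q (fun k => w (σ k)) f = residueSum q w f := by
  unfold residueSum
  rw [← Equiv.sum_comp σ fun j => f (w j) * (residueWeight q w j / ∏ k, (q * w k - q⁻¹ * w j))]
  refine Finset.sum_congr rfl fun j _ => ?_
  rw [residueWeight_comp, ← Equiv.prod_comp σ fun k => q * w k - q⁻¹ * w (σ j)]

/-- Telescoping sum of the numerators. -/
theorem sum_singlePoly {q : K} (hq : q ≠ 0) (z : K) : ∀ {r : ℕ} (w : Fin r → K),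
    ∑ i : Fin r, (q ^ (i : ℕ))⁻¹ * singlePoly q w i z =
      ∏ k, (q * w k - q⁻¹ * z) - (q ^ r)⁻¹ * ∏ k, (w k - z)
  | 0, w => by simp
  | r + 1, w => by
    have ih := sum_singlePoly hq z fun k : Fin r => w k.castSucc
    have h1 : ∀ i : Fin r, singlePoly q w i.castSucc z =
        singlePoly q (fun k : Fin r => w k.castSucc) i z * (q * w (Fin.last r) - q⁻¹ * z) := by
      intro i
      rw [singlePoly, Fin.prod_univ_castSucc]
      congr 1
      · simp [singlePoly]
      · rw [if_neg (by simp [Fin.lt_def]), if_neg (Fin.castSucc_lt_last i).ne']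
    have h2 : singlePoly q w (Fin.last r) z =
        (∏ k : Fin r, (w k.castSucc - z)) * ((q - q⁻¹) * w (Fin.last r)) := by
      rw [singlePoly, Fin.prod_univ_castSucc]
      simp [Fin.castSucc_lt_last]
    rw [Fin.sum_univ_castSucc, h2, Fin.prod_univ_castSucc, Fin.prod_univ_castSucc]
    simp only [h1, Fin.val_castSucc, Fin.val_last, ← mul_assoc, ← Finset.sum_mul]
    rw [ih]
    field_simp
    ring

/-- The exchange relation between the numerators at neighbouring points. -/
theorem singlePoly_exchange {m : ℕ} {q : K} (hq : q ≠ 0) (w : Fin (m + 1) → K) (i : Fin m) (z : K) :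
    (w i.succ - w i.castSucc) * singlePoly q w i.castSucc z =
      (q * w i.succ - q⁻¹ * w i.castSucc) *
        singlePoly q (fun k => w (Equiv.swap i.castSucc i.succ k)) i.succ z -
      (q - q⁻¹) * w i.castSucc * singlePoly q w i.succ z := by
  have hlt := Fin.castSucc_lt_succ (i := i)
  have hsplit : ∀ f : Fin (m + 1) → K, ∏ k, f k = f i.castSucc * f i.succ *
      ∏ k ∈ ({i.castSucc, i.succ} : Finset (Fin (m + 1)))ᶜ, f k := by
    intro f
    rw [← Finset.prod_mul_prod_compl {i.castSucc, i.succ} f, Finset.prod_pair hlt.ne]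
  unfold singlePoly
  rw [hsplit, hsplit, hsplit]
  have hrest : ∀ k ∈ ({i.castSucc, i.succ} : Finset (Fin (m + 1)))ᶜ,
      k ≠ i.castSucc ∧ k ≠ i.succ ∧ (k < i.succ ↔ k < i.castSucc) := by
    intro k hk
    simp only [Finset.mem_compl, Finset.mem_insert, Finset.mem_singleton, not_or] at hk
    refine ⟨hk.1, hk.2, fun h => ?_, fun h => h.trans hlt⟩
    exact lt_of_le_of_ne (by rw [Fin.le_def]; rw [Fin.lt_def] at h; simp at h ⊢; omega) hk.1
  rw [Finset.prod_congr rfl fun k hk => show (if k < i.succ then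
      w (Equiv.swap i.castSucc i.succ k) - z else if k = i.succ then
      (q - q⁻¹) * w (Equiv.swap i.castSucc i.succ i.succ) else
      q * w (Equiv.swap i.castSucc i.succ k) - q⁻¹ * z) =
      (if k < i.castSucc then w k - z else q * w k - q⁻¹ * z) by
        obtain ⟨h1, h2, h3⟩ := hrest k hk
        simp only [h3, h2, if_false, Equiv.swap_apply_of_ne_of_ne h1 h2],
    Finset.prod_congr rfl fun k hk => show (if k < i.succ then
      w k - z else if k = i.succ then (q - q⁻¹) * w i.succ else q * w k - q⁻¹ * z) =
      (if k < i.castSucc then w k - z else q * w k - q⁻¹ * z) by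
        obtain ⟨h1, h2, h3⟩ := hrest k hk
        simp only [h3, h2, if_false],
    Finset.prod_congr rfl fun k hk => show (if k < i.castSucc then
      w k - z else if k = i.castSucc then (q - q⁻¹) * w i.castSucc else q * w k - q⁻¹ * z) =
      (if k < i.castSucc then w k - z else q * w k - q⁻¹ * z) by
        obtain ⟨h1, h2, h3⟩ := hrest k hk
        simp only [h1, if_false]]
  simp only [lt_irrefl, if_true, if_false, hlt, hlt.not_gt, hlt.ne', Equiv.swap_apply_left,
    Equiv.swap_apply_right]
  field_simp
  ring

/-- The value of the `q`-Vandermonde product as a product over all pairs. -/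
theorem eval_qVandermonde {r : ℕ} (q : K) (w : Fin r → K) :
    eval w (qVandermonde r q) = ∏ i, ∏ j, (if i < j then q * w i - q⁻¹ * w j else 1) := by
  simp only [qVandermonde, map_prod, eval_qForm]
  refine Finset.prod_congr rfl fun i _ => ?_
  rw [← Finset.prod_filter]
  exact Finset.prod_congr (by ext; simp) fun _ _ => rfl

theorem eval_qVandermonde_last {m : ℕ} (q : K) (w : Fin (m + 1) → K) :
    eval w (qVandermonde (m + 1) q) = eval (fun k => w k.castSucc) (qVandermonde m q) *
      ∏ k : Fin m, (q * w k.castSucc - q⁻¹ * w (Fin.last m)) := by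
  simp only [eval_qVandermonde, Fin.prod_univ_castSucc, Finset.prod_mul_distrib]
  simp [Fin.castSucc_lt_last, (Fin.castSucc_lt_last _).not_gt]

theorem eval_qVandermonde_first {m : ℕ} (q : K) (w : Fin (m + 1) → K) :
    eval w (qVandermonde (m + 1) q) = (∏ k : Fin m, (q * w 0 - q⁻¹ * w k.succ)) *
      eval (fun k => w k.succ) (qVandermonde m q) := by
  simp only [eval_qVandermonde, Fin.prod_univ_succ, Finset.prod_mul_distrib]
  simp

/-- The value of the base entry, normalized to a Laurent polynomial. -/
noncomputable def baseValue (n : ℕ) (q : K) (w : Fin (2 * n + 1) → K) : K :=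
  (∏ j, w j ^ n)⁻¹ * eval w (qVandermonde (2 * n + 1) q)

theorem baseFunction_eq {n : ℕ} (q : K) (w : GenericPoint K (2 * n + 1)) :
    baseFunction n q w = baseValue n q w.1 := rfl

variable {n : ℕ} {q : K}

/-- The components with a single spin `-` as sums of residues. -/
theorem spinSolution_flip (hq : q ≠ 0) (i : Fin (2 * n + 1)) :
    ∀ w : GenericPoint K (2 * n + 1), (∀ j k, q * w.1 k - q⁻¹ * w.1 j ≠ 0) →
      spinSolution n q (flip i fun _ => true) w =
        baseFunction n q w * residueSum q w.1 (singlePoly q w.1 i) := by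
  have hsol := isSpinSolution_spinSolution (n := n) hq
  induction i using Fin.reverseInduction with
  | last =>
    -- only the residue at the last parameter contributes
    intro w hG
    rw [← hsol.inversion, spinSolution_true, baseFunction_eq, baseFunction_eq, residueSum,
      Fin.sum_univ_castSucc, Finset.sum_eq_zero, zero_add]
    · have hb := w.2.1 (Fin.last _)
      have hGl := fun k : Fin (2 * n) => hG (Fin.last _) k.castSucc
      have hGll := hG (Fin.last _) (Fin.last _)
      have hdiff := fun k : Fin (2 * n) =>
        sub_ne_zero.2 (w.2.2 k.castSucc (Fin.last _) (Fin.castSucc_lt_last k).ne).1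
      have hnz := fun k : Fin (2 * n) => w.2.1 k.castSucc
      have hinv : ∀ k : Fin (2 * n), (invert (Fin.last _) w).1 k.castSucc = w.1 k.castSucc :=
        fun k => invert_of_ne _ (Fin.castSucc_lt_last k).ne
      simp only [baseValue, eval_qVandermonde_last, Fin.prod_univ_castSucc, invert_self, hinv,
        residueWeight, singlePoly, Fin.castSucc_lt_last, lt_irrefl, if_true, if_false,
        (Fin.castSucc_lt_last _).ne, mul_one]
      generalize w.1 (Fin.last _) = b at *
      have e1 : ∏ k : Fin (2 * n), (q * w.1 k.castSucc * b - q⁻¹) =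
          b ^ (2 * n) * ∏ k : Fin (2 * n), (q * w.1 k.castSucc - q⁻¹ * b⁻¹) := by
        have h : ∀ k : Fin (2 * n), q * w.1 k.castSucc * b - q⁻¹ =
            b * (q * w.1 k.castSucc - q⁻¹ * b⁻¹) := by
          intro k; field_simp
        rw [Finset.prod_congr rfl fun k _ => h k, Finset.prod_mul_distrib]
        simp
      rw [e1]
      have e2 := Finset.prod_ne_zero_iff.2 fun k (_ : k ∈ Finset.univ) => hGl k
      have e3 := Finset.prod_ne_zero_iff.2 fun k (_ : k ∈ Finset.univ) => hdiff k
      have e4 := Finset.prod_ne_zero_iff.2 fun k (_ : k ∈ Finset.univ) => pow_ne_zero n (hnz k)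
      have e5 : q * b - q⁻¹ * b = (q - q⁻¹) * b := by ring
      rw [e5] at hGll ⊢
      generalize ∏ k : Fin (2 * n), (q * w.1 k.castSucc - q⁻¹ * b) = R1,
        ∏ k : Fin (2 * n), (w.1 k.castSucc - b) = R2,
        ∏ k : Fin (2 * n), w.1 k.castSucc ^ n = R3,
        ∏ k : Fin (2 * n), (q * w.1 k.castSucc - q⁻¹ * b⁻¹) = R4,
        eval (fun k : Fin (2 * n) => w.1 k.castSucc) (qVandermonde (2 * n) q) = R5,
        (q - q⁻¹) * b = R6 at *
      rw [two_mul n, pow_add, inv_pow]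
      field_simp
    · intro j _
      rw [singlePoly, Finset.prod_eq_zero (Finset.mem_univ j.castSucc), zero_mul]
      simp [Fin.castSucc_lt_last]
  | cast i ih =>
    intro w hG
    have hne := Fin.castSucc_lt_succ (i := i) |>.ne
    have hw : w.1 i.succ - w.1 i.castSucc ≠ 0 := sub_ne_zero.2 (w.2.2 _ _ hne.symm).1
    have h1 := hsol.exchange i (Nat.zero_le _) (flip i.succ fun _ => true) w
    have h2 := ih (swap i.castSucc i.succ w) (fun j k => hG _ _)
    have h3 := congrFun (exchangeOp_baseFunction (n := n) (q := q) i) w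
    rw [exchangeOp_apply, div_eq_iff hw] at h3
    simp only [Pi.smul_apply, smul_eq_mul] at h3
    have h4 : residueSum q (swap i.castSucc i.succ w).1
        (singlePoly q (swap i.castSucc i.succ w).1 i.succ) =
        residueSum q w.1 (singlePoly q (swap i.castSucc i.succ w).1 i.succ) :=
      residueSum_comp q w.1 (Equiv.swap i.castSucc i.succ) _
    have h5 : (w.1 i.succ - w.1 i.castSucc) * residueSum q w.1 (singlePoly q w.1 i.castSucc) =
        (q * w.1 i.succ - q⁻¹ * w.1 i.castSucc) *
          residueSum q w.1 (singlePoly q (swap i.castSucc i.succ w).1 i.succ) -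
        (q - q⁻¹) * w.1 i.castSucc * residueSum q w.1 (singlePoly q w.1 i.succ) := by
      simp only [residueSum, Finset.mul_sum, ← Finset.sum_sub_distrib]
      refine Finset.sum_congr rfl fun j _ => ?_
      have := singlePoly_exchange hq w.1 i (w.1 j)
      have hs : (swap i.castSucc i.succ w).1 = fun k => w.1 (Equiv.swap i.castSucc i.succ k) := rfl
      rw [hs]
      linear_combination (residueWeight q w.1 j / ∏ k, (q * w.1 k - q⁻¹ * w.1 j)) * this
    have e1 : setTwo (flip i.succ fun _ => true) i.castSucc i.succ true false =
        flip i.succ fun _ => true := by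
      funext k; simp only [setTwo, flip, Function.update_apply]; split_ifs <;> simp_all
    have e2 : setTwo (flip i.succ fun _ => true) i.castSucc i.succ false true =
        flip i.castSucc fun _ => true := by
      funext k; simp only [setTwo, flip, Function.update_apply]; split_ifs <;> simp_all
    rw [h2, h4, ih w hG, spinE, e1, e2, ih w hG] at h1
    have e3 : arcWeight q false (flip i.succ (fun _ => true) i.castSucc)
        (flip i.succ (fun _ => true) i.succ) = 1 := by
      simp [flip, hne, arcWeight]
    rw [e3] at h1
    refine mul_left_cancel₀ hw ?_
    generalize spinSolution n q (flip i.castSucc fun _ => true) w = x,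
      residueSum q w.1 (singlePoly q w.1 i.castSucc) = y1,
      residueSum q w.1 (singlePoly q w.1 i.succ) = y2,
      residueSum q w.1 (singlePoly q (swap i.castSucc i.succ w).1 i.succ) = y3,
      baseFunction n q w = f, baseFunction n q (swap i.castSucc i.succ w) = f' at *
    linear_combination -h1 + y3 * h3 - f * h5

/-- The components with at most one spin `-` satisfy a linear relation. -/
theorem sum_spinSolution_flip_of_generic [CharZero K] (hq : q ≠ 0) (w : GenericPoint K (2 * n + 1))
    (hG : ∀ j k, q * w.1 k - q⁻¹ * w.1 j ≠ 0) (h1 : ∀ j, w.1 j ≠ q⁻¹) (h2 : ∀ j, w.1 j ≠ -q⁻¹) :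
    ∑ i : Fin (2 * n + 1), (q ^ (i : ℕ))⁻¹ * spinSolution n q (flip i fun _ => true) w =
      baseFunction n q w := by
  have hinj : Function.Injective w.1 := fun i j h => by
    by_contra hij
    exact (w.2.2 i j hij).1 h
  simp only [fun i => spinSolution_flip hq i w hG]
  have h3 : ∑ i : Fin (2 * n + 1), (q ^ (i : ℕ))⁻¹ * residueSum q w.1 (singlePoly q w.1 i) = 1 := by
    refine Eq.trans ?_ (sum_residueWeight hq hinj h1 h2)
    simp only [residueSum, Finset.mul_sum]
    rw [Finset.sum_comm]
    refine Finset.sum_congr rfl fun j _ => ?_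
    have h4 := sum_singlePoly hq (w.1 j) w.1
    have h6 : ∏ k, (w.1 k - w.1 j) = 0 :=
      Finset.prod_eq_zero (Finset.mem_univ j) (sub_self (w.1 j))
    rw [h6, mul_zero, sub_zero] at h4
    have h5 : ∏ k, (q * w.1 k - q⁻¹ * w.1 j) ≠ 0 := Finset.prod_ne_zero_iff.2 fun k _ => hG j k
    simp only [← mul_assoc]
    rw [← Finset.sum_mul, h4, mul_div_cancel₀ _ h5]
  calc _ = baseFunction n q w * ∑ i : Fin (2 * n + 1), (q ^ (i : ℕ))⁻¹ *
        residueSum q w.1 (singlePoly q w.1 i) := by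
          rw [Finset.mul_sum]
          exact Finset.sum_congr rfl fun i _ => by ring
    _ = _ := by rw [h3, mul_one]

/-- The component with a single spin `-`, at the first point, and the reflection of the base function
in the first variable. -/
theorem spinSolution_flip_zero_of_generic [CharZero K] (hq : q ≠ 0) (w : GenericPoint K (2 * n + 1))
    (hG : ∀ j k, q * w.1 k - q⁻¹ * w.1 j ≠ 0) (h1 : ∀ j, w.1 j ≠ q⁻¹) (h2 : ∀ j, w.1 j ≠ -q⁻¹)
    (h3 : q ^ 2 * w.1 0 ≠ q⁻¹) (h4 : q ^ 2 * w.1 0 ≠ -q⁻¹) :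
    q * (q ^ 6 * w.1 0 ^ 2 - 1) * spinSolution n q (flip 0 fun _ => true) w =
      (q - q⁻¹) * (q ^ 6 * w.1 0 ^ 2) * baseFunction n q w -
        (q - q⁻¹ * (q ^ 6 * w.1 0 ^ 2)) *
          baseValue n q (Function.update w.1 0 (1 / (q ^ 6 * w.1 0))) := by
  have hinj : Function.Injective w.1 := fun i j h => by
    by_contra hij
    exact (w.2.2 i j hij).1 h
  have h0 := w.2.1 0
  have hq1 : q ^ 2 - 1 ≠ 0 := fun h => hG 0 0 (by field_simp; linear_combination w.1 0 * h)
  have ha : ∀ j, w.1 j ≠ q ^ 2 * w.1 0 := by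
    intro j h
    apply hG j 0
    rw [h]; field_simp; ring
  -- the pole `q² w₁` of the numerator of the first component serves as the additional node
  have hs := sum_residueWeight_div hq hinj h1 h2 ha h3 h4
  rw [spinSolution_flip hq 0 w hG]
  have hr : residueSum q w.1 (singlePoly q w.1 0) =
      (q ^ 2 - 1) * w.1 0 * ∑ j, residueWeight q w.1 j / (q ^ 2 * w.1 0 - w.1 j) := by
    rw [residueSum, Finset.mul_sum]
    refine Finset.sum_congr rfl fun j _ => ?_
    have h5 : singlePoly q w.1 0 (w.1 j) = (q - q⁻¹) * w.1 0 *
        ∏ k : Fin (2 * n), (q * w.1 k.succ - q⁻¹ * w.1 j) := by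
      rw [singlePoly, Fin.prod_univ_succ]
      simp
    rw [h5, Fin.prod_univ_succ]
    have h6 : ∏ k : Fin (2 * n), (q * w.1 k.succ - q⁻¹ * w.1 j) ≠ 0 :=
      Finset.prod_ne_zero_iff.2 fun k _ => hG j k.succ
    have h7 := sub_ne_zero.2 (ha j).symm
    have h8 : q * w.1 0 - q⁻¹ * w.1 j = q⁻¹ * (q ^ 2 * w.1 0 - w.1 j) := by field_simp
    rw [h8]
    generalize q ^ 2 * w.1 0 - w.1 j = y, ∏ k : Fin (2 * n), (q * w.1 k.succ - q⁻¹ * w.1 j) = y' at *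
    field_simp
  rw [hr]
  have h5 : baseValue n q (Function.update w.1 0 (1 / (q ^ 6 * w.1 0))) =
      baseFunction n q w * ∏ k : Fin (2 * n),
        (q * w.1 k.succ * (q ^ 2 * w.1 0) - q⁻¹) / (q ^ 2 * w.1 0 - w.1 k.succ) := by
    rw [baseFunction_eq]
    simp only [baseValue, eval_qVandermonde_first, Fin.prod_univ_succ, Function.update_self,
      Function.update_of_ne (Fin.succ_ne_zero _) , ne_eq]
    have e1 : ∏ k : Fin (2 * n), (q * (1 / (q ^ 6 * w.1 0)) - q⁻¹ * w.1 k.succ) =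
        (q ^ 4 * w.1 0)⁻¹ ^ (2 * n) *
          ∏ k : Fin (2 * n), (q * w.1 k.succ * (q ^ 2 * w.1 0) - q⁻¹) := by
      have h : ∀ k : Fin (2 * n), q * (1 / (q ^ 6 * w.1 0)) - q⁻¹ * w.1 k.succ =
          -(q ^ 4 * w.1 0)⁻¹ * (q * w.1 k.succ * (q ^ 2 * w.1 0) - q⁻¹) := by
        intro k; field_simp; ring
      rw [Finset.prod_congr rfl fun k _ => h k, Finset.prod_mul_distrib]
      simp [pow_mul]
    have e2 : ∏ k : Fin (2 * n), (q * w.1 0 - q⁻¹ * w.1 k.succ) =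
        q⁻¹ ^ (2 * n) * ∏ k : Fin (2 * n), (q ^ 2 * w.1 0 - w.1 k.succ) := by
      have h : ∀ k : Fin (2 * n), q * w.1 0 - q⁻¹ * w.1 k.succ =
          q⁻¹ * (q ^ 2 * w.1 0 - w.1 k.succ) := by
        intro k; field_simp
      rw [Finset.prod_congr rfl fun k _ => h k, Finset.prod_mul_distrib]
      simp
    have e3 : ∏ k : Fin (2 * n), (q ^ 2 * w.1 0 - w.1 k.succ) ≠ 0 :=
      Finset.prod_ne_zero_iff.2 fun k _ => sub_ne_zero.2 (ha k.succ).symm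
    have e4 : ∏ k : Fin (2 * n), w.1 k.succ ^ n ≠ 0 :=
      Finset.prod_ne_zero_iff.2 fun k _ => pow_ne_zero n (w.2.1 _)
    rw [e1, e2, Finset.prod_div_distrib]
    generalize ∏ k : Fin (2 * n), (q ^ 2 * w.1 0 - w.1 k.succ) = R1,
      ∏ k : Fin (2 * n), w.1 k.succ ^ n = R2,
      ∏ k : Fin (2 * n), (q * w.1 k.succ * (q ^ 2 * w.1 0) - q⁻¹) = R3 at *
    simp only [mul_pow, inv_pow, one_div, mul_inv]
    simp only [← pow_mul]
    field_simp
    ring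
  rw [h5]
  rw [Fin.prod_univ_succ] at hs
  clear hr h5 ha h3 h4
  generalize w.1 0 = x at *
  generalize ∏ k : Fin (2 * n),
        (q * w.1 k.succ * (q ^ 2 * x) - q⁻¹) / (q ^ 2 * x - w.1 k.succ) = R at *
  generalize ∑ j, residueWeight q w.1 j / (q ^ 2 * x - w.1 j) = S at *
  generalize baseFunction n q w = f at *
  have e6 : (q * x * (q ^ 2 * x) - q⁻¹) / (q ^ 2 * x - x) * ((q ^ 2 - 1) * x) =
      q * x * (q ^ 2 * x) - q⁻¹ := by
    have : q ^ 2 * x - x = (q ^ 2 - 1) * x := by ring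
    rw [this, div_mul_cancel₀ _ (mul_ne_zero hq1 h0)]
  have e7 : (q - q⁻¹) = (q ^ 2 - 1) * q⁻¹ := by field_simp
  have e8 : q * q⁻¹ = 1 := mul_inv_cancel₀ hq
  generalize hE : (q * x * (q ^ 2 * x) - q⁻¹) / (q ^ 2 * x - x) = E at *
  have e9 : (q ^ 6 * x ^ 2 - 1) * S = q ^ 4 * x + q * (E * R) := by linear_combination hs
  rw [e7]
  have e10 : E * ((q ^ 2 - 1) * x) * q = q ^ 4 * x ^ 2 - 1 := by
    rw [e6]; field_simp
  linear_combination f * q * (q ^ 2 - 1) * x * e9 + f * R * q * e10 -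
    ((q ^ 2 - 1) * (q ^ 5 * x ^ 2) * f + q ^ 5 * x ^ 2 * f * R) * e8

end

/-! ### Laurent polynomials in `q` -/

section

variable {K : Type*} [Field K]

open GenericPoint

/-- A function of `q` is given by a Laurent polynomial for `q ≠ 0`; its value at `0` is irrelevant. -/
def IsLaurent (F : K → K) : Prop :=
  ∃ (N : ℕ) (P : Polynomial K), ∀ q, q ≠ 0 → F q * q ^ N = P.eval q

namespace IsLaurent

variable {F G : K → K}

theorem const (c : K) : IsLaurent fun _ => c := ⟨0, Polynomial.C c, fun q _ => by simp⟩

theorem id : IsLaurent fun q : K => q := ⟨0, Polynomial.X, fun q _ => by simp⟩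

theorem inv : IsLaurent fun q : K => q⁻¹ := ⟨1, 1, fun q hq => by simp [hq]⟩

theorem mul (hF : IsLaurent F) (hG : IsLaurent G) : IsLaurent fun q => F q * G q := by
  obtain ⟨N, P, h⟩ := hF
  obtain ⟨N', P', h'⟩ := hG
  exact ⟨N + N', P * P', fun q hq => by rw [Polynomial.eval_mul, ← h q hq, ← h' q hq]; ring⟩

theorem add (hF : IsLaurent F) (hG : IsLaurent G) : IsLaurent fun q => F q + G q := by
  obtain ⟨N, P, h⟩ := hF
  obtain ⟨N', P', h'⟩ := hG
  refine ⟨N + N', P * Polynomial.X ^ N' + P' * Polynomial.X ^ N, fun q hq => ?_⟩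
  simp only [Polynomial.eval_add, Polynomial.eval_mul, Polynomial.eval_pow, Polynomial.eval_X]
  rw [← h q hq, ← h' q hq]; ring

theorem neg (hF : IsLaurent F) : IsLaurent fun q => -F q := by
  simpa using (const (-1)).mul hF

theorem sub (hF : IsLaurent F) (hG : IsLaurent G) : IsLaurent fun q => F q - G q := by
  simpa [sub_eq_add_neg] using hF.add hG.neg

theorem pow (hF : IsLaurent F) : ∀ m : ℕ, IsLaurent fun q => F q ^ m
  | 0 => by simpa using const 1
  | m + 1 => by simpa [pow_succ] using (hF.pow m).mul hF

theorem prod {ι : Type*} (s : Finset ι) {F : ι → K → K} (h : ∀ i ∈ s, IsLaurent (F i)) :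
    IsLaurent fun q => ∏ i ∈ s, F i q := by
  classical
  induction s using Finset.induction_on with
  | empty => simpa using const 1
  | insert a s ha ih =>
    simp only [Finset.prod_insert ha]
    exact (h a (by simp)).mul (ih fun i hi => h i (by simp [hi]))

theorem sum {ι : Type*} (s : Finset ι) {F : ι → K → K} (h : ∀ i ∈ s, IsLaurent (F i)) :
    IsLaurent fun q => ∑ i ∈ s, F i q := by
  classical
  induction s using Finset.induction_on with
  | empty => simpa using const 0
  | insert a s ha ih =>
    simp only [Finset.sum_insert ha]
    exact (h a (by simp)).add (ih fun i hi => h i (by simp [hi]))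

theorem eq_zero_of_infinite (hF : IsLaurent F) (h : {q | q ≠ 0 ∧ F q = 0}.Infinite) {q : K}
    (hq : q ≠ 0) : F q = 0 := by
  obtain ⟨N, P, hP⟩ := hF
  have h0 : P = 0 := by
    refine Polynomial.eq_zero_of_infinite_isRoot P (h.mono fun x hx => ?_)
    have := hP x hx.1
    rw [hx.2, zero_mul] at this
    exact this.symm
  have := hP q hq
  rw [h0, Polynomial.eval_zero] at this
  exact (mul_eq_zero.1 this).resolve_right (pow_ne_zero _ hq)

/-- A Laurent polynomial that vanishes off the zeros of a nonzero polynomial vanishes identically. -/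
theorem eq_zero_of_ne [Infinite K] (hF : IsLaurent F) {B : Polynomial K} (hB : B ≠ 0)
    (h : ∀ q, q ≠ 0 → B.eval q ≠ 0 → F q = 0) {q : K} (hq : q ≠ 0) : F q = 0 := by
  refine hF.eq_zero_of_infinite ?_ hq
  have hfin : {x | x = 0 ∨ B.eval x = 0}.Finite := by
    refine (Polynomial.finite_setOfPred_isRoot (mul_ne_zero Polynomial.X_ne_zero hB)).subset ?_
    rintro x (hx | hx) <;> simp [hx]
  refine hfin.infinite_compl.mono fun x hx => ?_
  simp only [Set.mem_compl_iff, Set.mem_ofPred_eq, not_or] at hx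
  exact ⟨hx.1, h x hx.1 hx.2⟩

end IsLaurent

theorem isLaurent_baseFunction {n : ℕ} (w : GenericPoint K (2 * n + 1)) :
    IsLaurent fun q => baseFunction n q w := by
  simp only [baseFunction, eval_qVandermonde]
  refine (IsLaurent.const _).mul (IsLaurent.prod _ fun i _ => IsLaurent.prod _ fun j _ => ?_)
  split_ifs
  · exact (IsLaurent.id.mul (.const _)).sub (IsLaurent.inv.mul (.const _))
  · exact .const _

theorem isLaurent_exchangeOp {r : ℕ} (a b : Fin r) {A : K → GenericPoint K r → K}
    (h : ∀ w, IsLaurent fun q => A q w) (w : GenericPoint K r) :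
    IsLaurent fun q => exchangeOp q a b (A q) w := by
  simp only [exchangeOp_apply, div_eq_mul_inv]
  exact ((((IsLaurent.id.mul (.const _)).sub (IsLaurent.inv.mul (.const _))).mul (h _)).sub
    (((IsLaurent.id.sub .inv).mul (.const _)).mul (h w))).mul (.const _)

theorem isLaurent_creation {n : ℕ} {A : K → GenericPoint K (2 * n + 1) → K}
    (h : ∀ w, IsLaurent fun q => A q w) : ∀ (k : ℕ) (w : GenericPoint K (2 * n + 1)),
    IsLaurent fun q => creation (heckeOp n q) (invertOp (Fin.last (2 * n))) k (A q) w
  | 0, _ => h _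
  | k + 1, w => isLaurent_exchangeOp _ _ (isLaurent_creation h k) w

theorem isLaurent_spinFamily {n : ℕ} : ∀ (m : ℕ) (ε : Fin m → Bool)
    {A : K → GenericPoint K (2 * n + 1) → K}, (∀ w, IsLaurent fun q => A q w) →
    ∀ w : GenericPoint K (2 * n + 1),
    IsLaurent fun q => spinFamily (heckeOp n q) (invertOp (Fin.last (2 * n))) m ε (A q) w
  | 0, _, _, h, w => h w
  | m + 1, ε, A, h, w => by
    simp only [spinFamily]
    by_cases hε : ε 0 = true
    · simpa [hε] using isLaurent_spinFamily m (fun i => ε i.succ) h w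
    · simpa [hε] using isLaurent_spinFamily m (fun i => ε i.succ) (isLaurent_creation h m) w

theorem isLaurent_spinSolution {n : ℕ} (ε : Fin (2 * n + 1) → Bool)
    (w : GenericPoint K (2 * n + 1)) : IsLaurent fun q => spinSolution n q ε w :=
  isLaurent_spinFamily _ ε isLaurent_baseFunction w

/-- A polynomial in `q` that vanishes at the values of `q` for which the spectral parameters `w` are not
in general position. -/
noncomputable def degeneracyPoly {r : ℕ} (w : Fin (r + 1) → K) : Polynomial K :=
  ((∏ j, ∏ k, (Polynomial.C (w k) * Polynomial.X ^ 2 - Polynomial.C (w j))) *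
    ∏ j, (Polynomial.C (w j ^ 2) * Polynomial.X ^ 2 - 1)) *
    (Polynomial.C (w 0 ^ 2) * Polynomial.X ^ 6 - 1)

theorem C_mul_X_pow_sub_C_ne_zero {a : K} (ha : a ≠ 0) (b : K) {m : ℕ} (hm : 0 < m) :
    Polynomial.C a * Polynomial.X ^ m - Polynomial.C b ≠ 0 := by
  intro h
  have := congrArg (Polynomial.coeff · m) h
  simp [Polynomial.coeff_C, hm.ne', ha] at this

theorem degeneracyPoly_ne_zero {r : ℕ} {w : Fin (r + 1) → K} (hw : ∀ j, w j ≠ 0) : degeneracyPoly w ≠ 0 := by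
  have h1 := C_mul_X_pow_sub_C_ne_zero (pow_ne_zero 2 (hw 0)) 1 (m := 6) (by norm_num)
  refine mul_ne_zero (mul_ne_zero ?_ ?_) (by simpa using h1)
  · exact Finset.prod_ne_zero_iff.2 fun j _ => Finset.prod_ne_zero_iff.2 fun k _ =>
      C_mul_X_pow_sub_C_ne_zero (hw k) _ (by norm_num)
  · exact Finset.prod_ne_zero_iff.2 fun j _ => by
      simpa using C_mul_X_pow_sub_C_ne_zero (pow_ne_zero 2 (hw j)) 1 (m := 2) (by norm_num)

theorem generic_of_degeneracyPoly {r : ℕ} {w : Fin (r + 1) → K} {q : K} (hq : q ≠ 0)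
    (h : (degeneracyPoly w).eval q ≠ 0) :
    (∀ j k, q * w k - q⁻¹ * w j ≠ 0) ∧ (∀ j, w j ≠ q⁻¹) ∧ (∀ j, w j ≠ -q⁻¹) ∧
      q ^ 2 * w 0 ≠ q⁻¹ ∧ q ^ 2 * w 0 ≠ -q⁻¹ := by
  simp only [degeneracyPoly, Polynomial.eval_mul, Polynomial.eval_prod, Polynomial.eval_sub,
    Polynomial.eval_pow, Polynomial.eval_C, Polynomial.eval_X, Polynomial.eval_one, ne_eq,
    mul_eq_zero, not_or, Finset.prod_eq_zero_iff, Finset.mem_univ, true_and, not_exists] at h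
  obtain ⟨⟨h1, h2⟩, h3⟩ := h
  refine ⟨fun j k h => h1 j k ?_, fun j h => h2 j ?_, fun j h => h2 j ?_, fun h => h3 ?_,
    fun h => h3 ?_⟩
  · field_simp at h; linear_combination h
  · rw [h]; field_simp; ring
  · rw [h]; field_simp; ring
  · have : q ^ 3 * w 0 = 1 := by
      rw [pow_succ', mul_assoc, h, mul_inv_cancel₀ hq]
    linear_combination (q ^ 3 * w 0 + 1) * this
  · have : q ^ 3 * w 0 = -1 := by
      rw [pow_succ', mul_assoc, h, mul_neg, mul_inv_cancel₀ hq]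
    linear_combination (q ^ 3 * w 0 - 1) * this

/-- The linear relation between the components with at most one spin `-`, for all `q ≠ 0`, by
continuation in `q`. -/
theorem sum_spinSolution_flip [CharZero K] {n : ℕ} {q : K} (hq : q ≠ 0)
    (w : GenericPoint K (2 * n + 1)) :
    ∑ i : Fin (2 * n + 1), (q ^ (i : ℕ))⁻¹ * spinSolution n q (flip i fun _ => true) w =
      baseFunction n q w := by
  have h : IsLaurent fun q => ∑ i : Fin (2 * n + 1), (q⁻¹ ^ (i : ℕ)) *
      spinSolution n q (flip i fun _ => true) w - baseFunction n q w :=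
    (IsLaurent.sum _ fun i _ => (IsLaurent.inv.pow _).mul (isLaurent_spinSolution _ w)).sub
      (isLaurent_baseFunction w)
  have := h.eq_zero_of_ne (degeneracyPoly_ne_zero w.2.1) (fun q hq hB => by
    obtain ⟨h1, h2, h3, -⟩ := generic_of_degeneracyPoly hq hB
    rw [← sum_spinSolution_flip_of_generic hq w h1 h2 h3, sub_eq_zero]
    simp) hq
  rw [sub_eq_zero] at this
  simpa using this

/-- The component with a single spin `-` at the first point, for all `q ≠ 0`, by continuation in `q`. -/
theorem spinSolution_flip_zero [CharZero K] {n : ℕ} {q : K} (hq : q ≠ 0)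
    (w : GenericPoint K (2 * n + 1)) :
    q * (q ^ 6 * w.1 0 ^ 2 - 1) * spinSolution n q (flip 0 fun _ => true) w =
      (q - q⁻¹) * (q ^ 6 * w.1 0 ^ 2) * baseFunction n q w -
        (q - q⁻¹ * (q ^ 6 * w.1 0 ^ 2)) *
          baseValue n q (Function.update w.1 0 (1 / (q ^ 6 * w.1 0))) := by
  have hu : IsLaurent fun q => q ^ 6 * w.1 0 ^ 2 := (IsLaurent.id.pow 6).mul (.const _)
  have hc : ∀ j, IsLaurent fun q => Function.update w.1 0 (1 / (q ^ 6 * w.1 0)) j := by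
    intro j
    by_cases hj : j = 0
    · subst hj
      simpa using (IsLaurent.const (w.1 0)⁻¹).mul (IsLaurent.inv.pow 6)
    · simpa [hj] using IsLaurent.const (w.1 j)
  have hbv : IsLaurent fun q => baseValue n q (Function.update w.1 0 (1 / (q ^ 6 * w.1 0))) := by
    simp only [baseValue, eval_qVandermonde]
    refine IsLaurent.mul ?_ (IsLaurent.prod _ fun i _ => IsLaurent.prod _ fun j _ => ?_)
    · simp only [Fin.prod_univ_succ, Function.update_self, Function.update_of_ne (Fin.succ_ne_zero _)]
      have h := (IsLaurent.const (∏ k : Fin (2 * n), w.1 k.succ ^ n)⁻¹).mul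
        ((IsLaurent.id.pow 6).mul (.const (w.1 0)) |>.pow n)
      convert h using 2
      rw [mul_inv, one_div, inv_pow, inv_inv, mul_comm]
    · split_ifs
      · exact (IsLaurent.id.mul (hc i)).sub (IsLaurent.inv.mul (hc j))
      · exact .const _
  have h : IsLaurent fun q => q * (q ^ 6 * w.1 0 ^ 2 - 1) *
      spinSolution n q (flip 0 fun _ => true) w -
      ((q - q⁻¹) * (q ^ 6 * w.1 0 ^ 2) * baseFunction n q w -
        (q - q⁻¹ * (q ^ 6 * w.1 0 ^ 2)) *
          baseValue n q (Function.update w.1 0 (1 / (q ^ 6 * w.1 0)))) :=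
    ((IsLaurent.id.mul (hu.sub (.const 1))).mul (isLaurent_spinSolution _ w)).sub
      ((((IsLaurent.id.sub .inv).mul hu).mul (isLaurent_baseFunction w)).sub
        ((IsLaurent.id.sub (IsLaurent.inv.mul hu)).mul hbv))
  have := h.eq_zero_of_ne (degeneracyPoly_ne_zero w.2.1) (fun q hq hB => by
    obtain ⟨h1, h2, h3, h4, h5⟩ := generic_of_degeneracyPoly hq hB
    rw [spinSolution_flip_zero_of_generic hq w h1 h2 h3 h4 h5, sub_self]) hq
  exact sub_eq_zero.1 this

end

/-! ### An operator that commutes with the Temperley–Lieb generators -/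

section

variable {K : Type*} [Field K] {r : ℕ}

open GenericPoint

/-- The weight with which a spin is passed in `chainOp`. -/
def spinWeight (q : K) (c : Bool) : K := if c then q⁻¹ else q

/-- The product of the weights of the spins at the points before `i`. -/
def headWeight (q : K) (ε : Fin r → Bool) (i : Fin r) : K :=
  ∏ k, (if k < i then spinWeight q (ε k) else 1)

/-- The operator `∑ κ ⊗ ⋯ ⊗ κ ⊗ σ ⊗ 1 ⊗ ⋯ ⊗ 1` on the spin chain, where `σ` reverses a spin and `κ`
multiplies by its weight: the coproduct of an element of a coideal subalgebra of `U_q(sl₂)`. -/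
def chainOp (q : K) : ((Fin r → Bool) → K) →ₗ[K] ((Fin r → Bool) → K) where
  toFun x ε := ∑ i, headWeight q ε i * x (flip i ε)
  map_add' x y := by funext ε; simp [mul_add, Finset.sum_add_distrib]
  map_smul' c x := by
    funext ε
    simp only [Pi.smul_apply, smul_eq_mul, RingHom.id_apply, Finset.mul_sum]
    exact Finset.sum_congr rfl fun _ _ => by ring

theorem chainOp_apply (q : K) (x : (Fin r → Bool) → K) (ε : Fin r → Bool) :
    chainOp q x ε = ∑ i, headWeight q ε i * x (flip i ε) := rfl

theorem headWeight_congr (q : K) {ε ε' : Fin r → Bool} {i : Fin r} (h : ∀ k < i, ε k = ε' k) :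
    headWeight q ε i = headWeight q ε' i := by
  refine Finset.prod_congr rfl fun k _ => ?_
  split_ifs with hk
  · rw [h k hk]
  · rfl

theorem headWeight_succ {m : ℕ} (q : K) (ε : Fin (m + 1) → Bool) (i : Fin m) :
    headWeight q ε i.succ = headWeight q ε i.castSucc * spinWeight q (ε i.castSucc) := by
  have h1 := Finset.mul_prod_erase Finset.univ
    (fun k => if k < i.succ then spinWeight q (ε k) else 1) (Finset.mem_univ i.castSucc)
  have h2 := Finset.mul_prod_erase Finset.univ
    (fun k => if k < i.castSucc then spinWeight q (ε k) else 1) (Finset.mem_univ i.castSucc)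
  rw [headWeight, headWeight, ← h1, ← h2, if_pos Fin.castSucc_lt_succ, if_neg (lt_irrefl _), one_mul,
    mul_comm]
  congr 1
  refine Finset.prod_congr rfl fun k hk => ?_
  have : k < i.succ ↔ k < i.castSucc := by
    have h := Finset.ne_of_mem_erase hk
    rw [Fin.lt_def, Fin.lt_def]
    simp only [Fin.ext_iff, Fin.val_castSucc, ne_eq, Fin.val_succ] at h ⊢
    omega
  simp only [this]

/-- The weight at a point beyond two neighbouring opposite spins does not depend on their order. -/
theorem headWeight_setTwo {m : ℕ} {q : K} (hq : q ≠ 0) (ε : Fin (m + 1) → Bool) (i : Fin m)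
    {j : Fin (m + 1)} (h1 : j ≠ i.castSucc) (h2 : j ≠ i.succ) :
    headWeight q (setTwo ε i.castSucc i.succ true false) j =
      headWeight q (setTwo ε i.castSucc i.succ false true) j := by
  have hne := Fin.castSucc_lt_succ (i := i) |>.ne
  by_cases hj : j < i.castSucc
  · refine headWeight_congr q fun k hk => ?_
    simp [setTwo, (hk.trans hj).ne, (hk.trans (hj.trans Fin.castSucc_lt_succ)).ne]
  · have h3 : i.castSucc < j := lt_of_le_of_ne (not_lt.1 hj) h1.symm
    have h4 : i.succ < j := lt_of_le_of_ne (succ_le_of_castSucc_lt i j h3) h2.symm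
    unfold headWeight
    rw [← Finset.prod_mul_prod_compl {i.castSucc, i.succ},
      ← Finset.prod_mul_prod_compl {i.castSucc, i.succ} (fun k => if k < j then _ else _),
      Finset.prod_pair hne, Finset.prod_pair hne]
    congr 1
    · simp [h3, h4, setTwo, hne, spinWeight, hq]
    · refine Finset.prod_congr rfl fun k hk => ?_
      simp only [Finset.mem_compl, Finset.mem_insert, Finset.mem_singleton, not_or] at hk
      simp [setTwo, hk.1, hk.2]

theorem setTwo_flip (ε : Fin r → Bool) {a b j : Fin r} (h1 : j ≠ a) (h2 : j ≠ b) (x y : Bool) :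
    setTwo (flip j ε) a b x y = flip j (setTwo ε a b x y) := by
  funext k
  simp only [setTwo, flip, Function.update_apply]
  grind

theorem flip_setTwo_left (ε : Fin r → Bool) {a b : Fin r} (hab : a ≠ b) (x y : Bool) :
    flip a (setTwo ε a b x y) = setTwo ε a b (!x) y := by
  funext k
  simp only [setTwo, flip, Function.update_apply]
  grind

theorem flip_setTwo_right (ε : Fin r → Bool) {a b : Fin r} (x y : Bool) :
    flip b (setTwo ε a b x y) = setTwo ε a b x (!y) := by
  funext k
  simp only [setTwo, flip, Function.update_apply]
  grind

theorem setTwo_setTwo (ε : Fin r → Bool) (a b : Fin r) (x y x' y' : Bool) :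
    setTwo (setTwo ε a b x' y') a b x y = setTwo ε a b x y := by
  funext k
  simp only [setTwo, Function.update_apply]
  grind

theorem setTwo_left (ε : Fin r → Bool) {a b : Fin r} (hab : a ≠ b) (x y : Bool) :
    setTwo ε a b x y a = x := by simp [setTwo, hab]

theorem setTwo_right (ε : Fin r → Bool) (a b : Fin r) (x y : Bool) :
    setTwo ε a b x y b = y := by simp [setTwo]

/-- `chainOp` commutes with the Temperley–Lieb generators. -/
theorem chainOp_spinE {m : ℕ} {q : K} (hq : q ≠ 0) (i : Fin m) (x : (Fin (m + 1) → Bool) → K) :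
    chainOp q (spinE q i.castSucc i.succ x) = spinE q i.castSucc i.succ (chainOp q x) := by
  funext ε
  have hne := Fin.castSucc_lt_succ (i := i) |>.ne
  have hh : ∀ x y, headWeight q (setTwo ε i.castSucc i.succ x y) i.castSucc =
      headWeight q ε i.castSucc := fun x y => headWeight_congr q fun k hk => by
    simp [setTwo, hk.ne, (hk.trans Fin.castSucc_lt_succ).ne]
  rw [← setTwo_eq_self ε i.castSucc i.succ]
  generalize ε i.castSucc = y, ε i.succ = z
  rw [spinE, chainOp_apply, chainOp_apply, chainOp_apply]
  simp only [setTwo_setTwo]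
  rw [← Finset.sum_add_sum_compl {i.castSucc, i.succ},
    ← Finset.sum_add_sum_compl {i.castSucc, i.succ}
      (fun j => headWeight q (setTwo ε i.castSucc i.succ true false) j * _),
    ← Finset.sum_add_sum_compl {i.castSucc, i.succ}
      (fun j => headWeight q (setTwo ε i.castSucc i.succ false true) j * _),
    Finset.sum_pair hne, Finset.sum_pair hne, Finset.sum_pair hne]
  simp only [headWeight_succ, hh, flip_setTwo_left _ hne, flip_setTwo_right, spinE, setTwo_setTwo,
    setTwo_left _ hne, setTwo_right]
  have hrest : ∑ j ∈ ({i.castSucc, i.succ} : Finset (Fin (m + 1)))ᶜ,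
      headWeight q (setTwo ε i.castSucc i.succ y z) j *
        (arcWeight q false (flip j (setTwo ε i.castSucc i.succ y z) i.castSucc)
          (flip j (setTwo ε i.castSucc i.succ y z) i.succ) *
          (-q * x (setTwo (flip j (setTwo ε i.castSucc i.succ y z)) i.castSucc i.succ true false) +
            x (setTwo (flip j (setTwo ε i.castSucc i.succ y z)) i.castSucc i.succ false true))) =
      arcWeight q false y z *
        (-q * ∑ j ∈ ({i.castSucc, i.succ} : Finset (Fin (m + 1)))ᶜ,
          headWeight q (setTwo ε i.castSucc i.succ true false) j *
            x (flip j (setTwo ε i.castSucc i.succ true false)) +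
        ∑ j ∈ ({i.castSucc, i.succ} : Finset (Fin (m + 1)))ᶜ,
          headWeight q (setTwo ε i.castSucc i.succ false true) j *
            x (flip j (setTwo ε i.castSucc i.succ false true))) := by
    rw [Finset.mul_sum, ← Finset.sum_add_distrib, Finset.mul_sum]
    refine Finset.sum_congr rfl fun j hj => ?_
    simp only [Finset.mem_compl, Finset.mem_insert, Finset.mem_singleton, not_or] at hj
    have e1 : flip j (setTwo ε i.castSucc i.succ y z) i.castSucc = y := by
      simp [flip, Ne.symm hj.1, setTwo, hne]
    have e2 : flip j (setTwo ε i.castSucc i.succ y z) i.succ = z := by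
      simp [flip, Ne.symm hj.2, setTwo]
    rw [e1, e2, setTwo_flip _ hj.1 hj.2, setTwo_flip _ hj.1 hj.2, setTwo_setTwo, setTwo_setTwo]
    have e3 := headWeight_setTwo hq ε i hj.1 hj.2
    cases y <;> cases z <;> simp [arcWeight, e3] <;> ring
  rw [hrest]
  clear hrest
  generalize ∑ j ∈ ({i.castSucc, i.succ} : Finset (Fin (m + 1)))ᶜ,
          headWeight q (setTwo ε i.castSucc i.succ true false) j *
            x (flip j (setTwo ε i.castSucc i.succ true false)) = S1,
    ∑ j ∈ ({i.castSucc, i.succ} : Finset (Fin (m + 1)))ᶜ,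
          headWeight q (setTwo ε i.castSucc i.succ false true) j *
            x (flip j (setTwo ε i.castSucc i.succ false true)) = S2
  cases y <;> cases z <;> simp [arcWeight, spinWeight] <;> field_simp <;>
    first | ring1 | (ring_nf; simp)

/-- `chainOp` commutes with the reversal of the last spin. -/
theorem chainOp_flip_last {m : ℕ} (q : K) (x : (Fin (m + 1) → Bool) → K) :
    chainOp q (fun ε => x (flip (Fin.last m) ε)) = fun ε => chainOp q x (flip (Fin.last m) ε) := by
  funext ε
  rw [chainOp_apply, chainOp_apply]
  refine Finset.sum_congr rfl fun j _ => ?_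
  congr 1
  · refine headWeight_congr q fun k hk => ?_
    simp [flip, (hk.trans_le (Fin.le_last j)).ne]
  · congr 1
    funext k
    simp only [flip, Function.update_apply]
    grind

/-- The spin tensors of coloured pictures are eigenvectors of `chainOp` for the eigenvalue `1`. -/
theorem chainOp_spinTensor {q : K} (hq : q ≠ 0) {D : ColoredDiagram r} (hD : IsColoredPicture D) :
    chainOp q (spinTensor q D) = spinTensor q D := by
  obtain ⟨o, ho⟩ := hD.exists_open
  -- spins before `j`, taken over a union of solid arches with opposite spins, have total weight `1`
  have hprod : ∀ (ε : Fin r → Bool) (S : Finset (Fin r)), (∀ k ∈ S, D.1 k ∈ S) →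
      (∀ k ∈ S, D.2 k = false ∧ D.1 k ≠ k) → (∀ k ∈ S, arcFactor q D ε k ≠ 0) →
      ∏ k ∈ S, spinWeight q (ε k) = 1 := by
    intro ε S hS hS' h
    have hopp : ∀ k ∈ S, ε (D.1 k) = !ε k := by
      have h1 : ∀ k ∈ S, k < D.1 k → ε (D.1 k) = !ε k := by
        intro k hk hlt
        have := h k hk
        rw [arcFactor, if_pos hlt, (hS' k hk).1] at this
        by_contra hne
        exact this (by rw [arcWeight, if_neg]; simpa using hne)
      intro k hk
      rcases lt_or_gt_of_ne (hS' k hk).2 with hlt | hlt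
      · have := h1 (D.1 k) (hS k hk) (by rwa [hD.invol])
        rw [hD.invol] at this
        rw [this, Bool.not_not]
      · exact h1 k hk hlt
    refine Finset.prod_involution (fun k _ => D.1 k) (fun k hk => ?_) (fun k hk _ => (hS' k hk).2)
      (fun k hk => hS k hk) (fun k _ => hD.invol k)
    rw [hopp k hk]
    cases ε k <;> simp [spinWeight, hq]
  have hpair : ∀ (ε : Fin r → Bool) (i : Fin r), i < D.1 i →
      headWeight q ε i * spinTensor q D (flip i ε) +
        headWeight q ε (D.1 i) * spinTensor q D (flip (D.1 i) ε) = 0 := by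
    intro ε i hi
    have hne := hi.ne
    have hji := hD.invol i
    have hrest : ∀ l, l = i ∨ l = D.1 i → ∏ k ∈ ({i, D.1 i} : Finset (Fin r))ᶜ,
        arcFactor q D (flip l ε) k = ∏ k ∈ ({i, D.1 i} : Finset (Fin r))ᶜ, arcFactor q D ε k := by
      intro l hl
      refine Finset.prod_congr rfl fun k hk => ?_
      simp only [Finset.mem_compl, Finset.mem_insert, Finset.mem_singleton, not_or] at hk
      have h1 : k ≠ l := by rintro rfl; tauto
      have h2 : D.1 k ≠ l := by
        rintro rfl
        rcases hl with hl | hl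
        · exact hk.2 (by rw [← hl, hD.invol])
        · exact hk.1 (by rw [← hD.invol k, hl, hD.invol])
      simp [arcFactor, flip, h1, h2]
    rw [spinTensor_eq_mul q D (flip i ε) {i, D.1 i}, spinTensor_eq_mul q D (flip (D.1 i) ε) {i, D.1 i},
      hrest i (Or.inl rfl), hrest (D.1 i) (Or.inr rfl), Finset.prod_pair hne, Finset.prod_pair hne]
    by_cases hR : ∏ k ∈ ({i, D.1 i} : Finset (Fin r))ᶜ, arcFactor q D ε k = 0
    · rw [hR]; ring
    have hR' := Finset.prod_ne_zero_iff.1 hR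
    have hin : ∏ k ∈ Finset.Ioo i (D.1 i), spinWeight q (ε k) = 1 := by
      refine hprod ε _ (fun k hk => ?_) (fun k hk => ?_) fun k hk => hR' k ?_
      all_goals rw [Finset.mem_Ioo] at hk
      · obtain ⟨h1, h2, -⟩ := hD.nest i k hk.1 hk.2
        exact Finset.mem_Ioo.2 ⟨h1, h2⟩
      · obtain ⟨-, -, h3, h4⟩ := hD.nest i k hk.1 hk.2
        exact ⟨h4, h3⟩
      · simp [hk.1.ne', hk.2.ne]
    have hw : headWeight q ε (D.1 i) = headWeight q ε i * spinWeight q (ε i) := by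
      have h1 : headWeight q ε (D.1 i) = headWeight q ε i *
          ((∏ k, if k = i then spinWeight q (ε k) else 1) *
            ∏ k, if k ∈ Finset.Ioo i (D.1 i) then spinWeight q (ε k) else 1) := by
        simp only [headWeight, ← Finset.prod_mul_distrib, Finset.mem_Ioo]
        refine Finset.prod_congr rfl fun k _ => ?_
        rcases lt_trichotomy k i with h | h | h
        · simp [h, h.trans hi, h.ne, h.not_gt]
        · subst h; simp [hi]
        · simp [h, h.ne', h.not_gt]
      rw [h1, Finset.prod_ite_mem, Finset.univ_inter, hin, mul_one]
      simp
    rw [hw]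
    generalize ∏ k ∈ ({i, D.1 i} : Finset (Fin r))ᶜ, arcFactor q D ε k = R
    simp only [arcFactor, hi, hji, not_lt.2 hi.le, if_true, if_false, flip, Function.update_self,
      Function.update_of_ne hne, Function.update_of_ne hne.symm, mul_one]
    cases ε i <;> cases ε (D.1 i) <;> cases D.2 i <;> simp [arcWeight, spinWeight] <;>
      field_simp <;> ring
  funext ε
  rw [chainOp_apply, ← Finset.add_sum_erase _ _ (Finset.mem_univ o)]
  have h1 : ∑ i ∈ Finset.univ.erase o, headWeight q ε i * spinTensor q D (flip i ε) = 0 := by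
    refine Finset.sum_involution (fun i _ => D.1 i) (fun i hi => ?_) (fun i hi _ h => ?_)
      (fun i hi => ?_) (fun i _ => hD.invol i)
    · have hne : D.1 i ≠ i := fun h => Finset.ne_of_mem_erase hi (hD.open_unique _ _ h ho)
      rcases lt_or_gt_of_ne hne with hlt | hlt
      · have := hpair ε (D.1 i) (by rwa [hD.invol])
        rw [hD.invol] at this
        rw [add_comm, this]
      · exact hpair ε i hlt
    · exact Finset.ne_of_mem_erase hi (hD.open_unique _ _ h ho)
    · refine Finset.mem_erase.2 ⟨fun h => Finset.ne_of_mem_erase hi ?_, Finset.mem_univ _⟩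
      rw [← hD.invol i, h, ho]
  rw [h1, add_zero]
  have h2 : spinTensor q D (flip o ε) = spinTensor q D ε := by
    refine Finset.prod_congr rfl fun k _ => ?_
    by_cases hk : k = o
    · subst hk; simp [arcFactor, ho]
    · have : D.1 k ≠ o := fun h => hk (by rw [← hD.invol k, h, ho])
      simp [arcFactor, flip, hk, this]
  rw [h2]
  by_cases h3 : spinTensor q D ε = 0
  · rw [h3, mul_zero]
  · have h3 := Finset.prod_ne_zero_iff.1 h3
    have h4 : headWeight q ε o = 1 := by
      rw [headWeight, ← Finset.prod_filter]
      refine hprod ε _ (fun k hk => ?_) (fun k hk => ?_) fun k _ => h3 k (Finset.mem_univ k)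
      all_goals simp only [Finset.mem_filter, Finset.mem_univ, true_and] at hk ⊢
      · by_contra hlt
        have hok : D.1 k ≠ o := fun h => hk.ne (by rw [← hD.invol k, h, ho])
        exact (hD.nest k o hk (lt_of_le_of_ne (not_lt.1 hlt) hok.symm)).2.2.1 ho
      · refine ⟨?_, fun h => hk.ne (hD.open_unique _ _ h ho)⟩
        by_contra h
        exact absurd (hD.open_lt_dashed o k ho (by simpa using h)) hk.not_gt
    rw [h4, one_mul]

end

/-! ### The eigenspaces of the operator -/

section

variable {K : Type*} [Field K] {r : ℕ}

/-- The number of walks on the integers with `r` steps `±1` from `m` to `0`. -/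
def walkCount : ℕ → ℤ → ℕ
  | 0, m => if m = 0 then 1 else 0
  | r + 1, m => walkCount r (m - 1) + walkCount r (m + 1)

/-- The `q`-integer `(q ^ m - q ^ (-m)) / (q - q⁻¹)`. -/
noncomputable def qInt (q : K) (m : ℤ) : K := (q ^ m - q ^ (-m)) / (q - q⁻¹)

theorem qInt_sub_one_add {q : K} (hq : q ≠ 0) (m : ℤ) :
    qInt q (m - 1) + qInt q (m + 1) = (q + q⁻¹) * qInt q m := by
  simp only [qInt, neg_add, sub_eq_add_neg, zpow_add₀ hq, zpow_neg, zpow_one, neg_neg]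
  field_simp
  ring

theorem qInt_sub_one_mul {q : K} (hq : q ≠ 0) (hq2 : q - q⁻¹ ≠ 0) (m : ℤ) :
    qInt q (m - 1) * qInt q (m + 1) = qInt q m ^ 2 - 1 := by
  have h := zpow_ne_zero m hq
  have h2 : q ^ 2 - 1 ≠ 0 := fun h => hq2 (by field_simp; linear_combination h)
  have e : q - q⁻¹ = (q ^ 2 - 1) / q := by field_simp
  simp only [qInt, neg_sub, neg_add, zpow_sub₀ hq, zpow_add₀ hq, zpow_neg, zpow_one, e]
  generalize q ^ m = z at *
  field_simp
  ring

theorem chainOp_cons {m : ℕ} (q : K) (x : (Fin (m + 1) → Bool) → K) (c : Bool) (ε : Fin m → Bool) :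
    chainOp q x (Fin.cons c ε : Fin (m + 1) → Bool) =
      x (Fin.cons (!c) ε : Fin (m + 1) → Bool) +
      spinWeight q c * chainOp q (fun ε' => x (Fin.cons c ε' : Fin (m + 1) → Bool)) ε := by
  rw [chainOp_apply, chainOp_apply, Fin.sum_univ_succ, Finset.mul_sum]
  congr 1
  · have h1 : headWeight q (Fin.cons c ε : Fin (m + 1) → Bool) 0 = 1 := by simp [headWeight]
    have h2 : flip 0 (Fin.cons c ε : Fin (m + 1) → Bool) = Fin.cons (!c) ε := by
      simp [flip]
    rw [h1, h2, one_mul]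
  · refine Finset.sum_congr rfl fun i _ => ?_
    have h1 : headWeight q (Fin.cons c ε : Fin (m + 1) → Bool) i.succ =
        spinWeight q c * headWeight q ε i := by
      simp [headWeight, Fin.prod_univ_succ]
    have h2 : flip i.succ (Fin.cons c ε : Fin (m + 1) → Bool) = Fin.cons c (flip i ε) := by
      simp [flip, Fin.cons_update]
    rw [h1, h2, mul_assoc]

theorem finrank_ker_comp_le {V : Type*} [AddCommGroup V] [Module K V] [FiniteDimensional K V]
    (A B : V →ₗ[K] V) : Module.finrank K (LinearMap.ker (A ∘ₗ B)) ≤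
      Module.finrank K (LinearMap.ker A) + Module.finrank K (LinearMap.ker B) := by
  rw [← LinearMap.finrank_range_add_finrank_ker (B.domRestrict (LinearMap.ker (A ∘ₗ B)))]
  refine add_le_add (Submodule.finrank_mono ?_) ?_
  · rintro _ ⟨x, rfl⟩
    exact x.2
  · rw [LinearMap.ker_domRestrict]
    exact (Submodule.finrank_map_subtype_eq _ _).symm.trans_le
      (Submodule.finrank_mono (by rintro _ ⟨x, hx, rfl⟩; exact hx))

/-- The eigenspaces of `chainOp` for `q`-integers are at most as large as the numbers of walks. An
eigenvector for `[m]` is determined by its half with first spin `+`, and this half is annihilated by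
`(chainOp - [m - 1]) (chainOp - [m + 1])`, because `[m - 1] + [m + 1] = (q + q⁻¹) [m]` and
`[m - 1] [m + 1] = [m]² - 1`. -/
theorem finrank_eigenspace_chainOp_le {q : K} (hq : q ≠ 0) (hq2 : q - q⁻¹ ≠ 0)
    (hq3 : ∀ m : ℤ, m ≠ 0 → qInt q m ≠ 0) : ∀ (r : ℕ) (m : ℤ),
    Module.finrank K (LinearMap.ker (chainOp q - qInt q m • LinearMap.id :
      ((Fin r → Bool) → K) →ₗ[K] ((Fin r → Bool) → K))) ≤ walkCount r m
  | 0, m => by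
    rw [walkCount]
    split_ifs with h
    · exact (Submodule.finrank_le _).trans (by simp)
    · rw [Nat.le_zero, Submodule.finrank_eq_zero, LinearMap.ker_eq_bot']
      intro x hx
      funext ε
      have := congrFun hx ε
      simpa [chainOp_apply, hq3 m h] using this
  | r + 1, m => by
    have ih1 := finrank_eigenspace_chainOp_le hq hq2 hq3 r (m - 1)
    have ih2 := finrank_eigenspace_chainOp_le hq hq2 hq3 r (m + 1)
    refine le_trans ?_ (add_le_add ih1 ih2)
    refine le_trans ?_ (finrank_ker_comp_le _ _)
    let up : ((Fin (r + 1) → Bool) → K) →ₗ[K] ((Fin r → Bool) → K) :=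
      LinearMap.funLeft K K (fun ε => (Fin.cons true ε : Fin (r + 1) → Bool))
    let down : ((Fin (r + 1) → Bool) → K) →ₗ[K] ((Fin r → Bool) → K) :=
      LinearMap.funLeft K K (fun ε => (Fin.cons false ε : Fin (r + 1) → Bool))
    have key : ∀ x, x ∈ LinearMap.ker (chainOp q - qInt q m • LinearMap.id :
        ((Fin (r + 1) → Bool) → K) →ₗ[K] ((Fin (r + 1) → Bool) → K)) →
        down x = qInt q m • up x - q⁻¹ • chainOp q (up x) ∧
        up x = qInt q m • down x - q • chainOp q (down x) := by
      intro x hx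
      rw [LinearMap.mem_ker, LinearMap.sub_apply, sub_eq_zero] at hx
      constructor
      · funext ε
        have h := congrFun hx (Fin.cons true ε)
        rw [chainOp_cons] at h
        simp only [spinWeight, Bool.not_true, if_true, LinearMap.smul_apply, LinearMap.id_apply,
          Pi.smul_apply, smul_eq_mul] at h
        exact eq_sub_of_add_eq h
      · funext ε
        have h := congrFun hx (Fin.cons false ε)
        rw [chainOp_cons] at h
        simp only [spinWeight, Bool.not_false, Bool.false_eq_true, if_false, LinearMap.smul_apply,
          LinearMap.id_apply, Pi.smul_apply, smul_eq_mul] at h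
        exact eq_sub_of_add_eq h
    rw [← LinearMap.finrank_range_of_inj (f := up.domRestrict (LinearMap.ker (chainOp q -
      qInt q m • LinearMap.id : ((Fin (r + 1) → Bool) → K) →ₗ[K] ((Fin (r + 1) → Bool) → K))))]
    · refine Submodule.finrank_mono ?_
      rintro _ ⟨⟨x, hx⟩, rfl⟩
      obtain ⟨h1, h2⟩ := key x hx
      rw [LinearMap.domRestrict_apply, LinearMap.mem_ker, LinearMap.comp_apply]
      rw [h1] at h2
      generalize up x = y at *
      have e1 := qInt_sub_one_add hq m
      have e2 := qInt_sub_one_mul hq hq2 m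
      funext ε
      have h := congrFun h2 ε
      simp only [map_sub, map_smul, LinearMap.sub_apply, LinearMap.smul_apply, LinearMap.id_apply,
        Pi.sub_apply, Pi.smul_apply, smul_eq_mul, Pi.zero_apply] at h ⊢
      have e3 : q * q⁻¹ = 1 := mul_inv_cancel₀ hq
      linear_combination (y ε) * e2 - (chainOp q y ε) * e1 - h -
        (chainOp q (chainOp q y) ε) * e3
    · rw [← LinearMap.ker_eq_bot, LinearMap.ker_eq_bot']
      rintro ⟨x, hx⟩ h
      obtain ⟨h1, -⟩ := key x hx
      have h0 : up x = 0 := h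
      rw [h0, map_zero, smul_zero, smul_zero, sub_zero] at h1
      ext ε
      rw [← Fin.cons_self_tail ε]
      cases ε 0
      · exact congrFun h1 (Fin.tail ε)
      · exact congrFun h0 (Fin.tail ε)

end

/-! ### Counting link patterns -/

section

variable {r : ℕ}

/-- The number of open arches. -/
def openCard (π : OpenLinkPattern r) : ℕ := (Finset.univ.filter fun p => π.1 p = p).card

/-- The pattern with an additional open arch on the right. -/
def addOpen (π : OpenLinkPattern r) : OpenLinkPattern (r + 1) :=
  ⟨Fin.lastCases (Fin.last r) fun i => (π.1 i).castSucc, by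
    constructor
    · intro i
      refine Fin.lastCases ?_ (fun i => ?_) i
      · simp
      · simp [π.2.1 i]
    · intro i j
      refine Fin.lastCases ?_ (fun i => ?_) i
      · intro h; exact absurd h (Fin.le_last j).not_gt
      · refine Fin.lastCases ?_ (fun j => ?_) j
        · intro _ h
          simp only [Fin.lastCases_castSucc] at h
          exact absurd h (Fin.le_last _).not_gt
        · simpa using π.2.2 i j⟩

@[simp] theorem addOpen_last (π : OpenLinkPattern r) : (addOpen π).1 (Fin.last r) = Fin.last r := by
  simp [addOpen]

@[simp] theorem addOpen_castSucc (π : OpenLinkPattern r) (i : Fin r) :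
    (addOpen π).1 i.castSucc = (π.1 i).castSucc := by
  simp [addOpen]

/-- The pattern obtained by connecting the rightmost open arch with an additional point on the
right. -/
def closeLast (π : OpenLinkPattern r) (p : Fin r) (hp : π.1 p = p) (hmax : ∀ c, p < c → π.1 c ≠ c) :
    OpenLinkPattern (r + 1) :=
  ⟨Fin.lastCases p.castSucc fun i => if i = p then Fin.last r else (π.1 i).castSucc, by
    have hinv := π.2.1
    have hn := π.2.2
    constructor
    · intro i
      refine Fin.lastCases ?_ (fun i => ?_) i
      · simp
      · by_cases hi : i = p
        · simp [hi]
        · have : π.1 i ≠ p := fun h => hi (by rw [← hinv i, h, hp])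
          simp [hi, this, hinv i]
    · intro i j
      refine Fin.lastCases ?_ (fun i => ?_) i
      · intro h; exact absurd h (Fin.le_last j).not_gt
      · refine Fin.lastCases ?_ (fun j => ?_) j
        · intro _ h
          exact absurd h (Fin.le_last _).not_gt
        · simp only [Fin.lastCases_castSucc]
          by_cases hi : i = p
          · subst hi
            intro hij _
            rw [Fin.castSucc_lt_castSucc_iff] at hij
            have hj : j ≠ i := hij.ne'
            simp only [hj, if_false, Fin.castSucc_lt_castSucc_iff]
            have hne := hmax j hij
            refine ⟨?_, Fin.castSucc_lt_last _, by simpa using hne⟩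
            by_contra hlt
            have h1 : π.1 j ≠ i := fun h => hj (by rw [← hinv j, h, hp])
            have h2 := hn (π.1 j) i (lt_of_le_of_ne (not_lt.1 hlt) h1) (by rwa [hinv])
            exact h2.2.2 hp
          · simp only [hi, if_false, Fin.castSucc_lt_castSucc_iff]
            intro hij hj
            obtain ⟨h1, h2, h3⟩ := hn i j hij hj
            have hjp : j ≠ p := fun h => h3 (h ▸ hp)
            simp [hjp, h1, h2, h3]⟩

@[simp] theorem closeLast_last (π : OpenLinkPattern r) (p : Fin r) (hp hmax) :
    (closeLast π p hp hmax).1 (Fin.last r) = p.castSucc := by simp [closeLast]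

@[simp] theorem closeLast_castSucc (π : OpenLinkPattern r) (p : Fin r) (hp hmax) (i : Fin r) :
    (closeLast π p hp hmax).1 i.castSucc = if i = p then Fin.last r else (π.1 i).castSucc := by
  simp [closeLast]

theorem openCard_eq_sum (π : OpenLinkPattern r) : openCard π = ∑ p, if π.1 p = p then 1 else 0 := by
  simp [openCard]

theorem openCard_addOpen (π : OpenLinkPattern r) : openCard (addOpen π) = openCard π + 1 := by
  rw [openCard_eq_sum, openCard_eq_sum, Fin.sum_univ_castSucc]
  simp

theorem openCard_closeLast (π : OpenLinkPattern r) (p : Fin r) (hp hmax) :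
    openCard (closeLast π p hp hmax) + 1 = openCard π := by
  rw [openCard_eq_sum, openCard_eq_sum, Fin.sum_univ_castSucc, ← Finset.add_sum_erase _ _
    (Finset.mem_univ p), ← Finset.add_sum_erase _ (fun q => if π.1 q = q then 1 else 0)
    (Finset.mem_univ p)]
  simp only [closeLast_last, closeLast_castSucc, if_true, hp, (Fin.castSucc_lt_last p).ne,
    (Fin.castSucc_lt_last p).ne', if_false, zero_add, add_zero]
  rw [add_comm]
  congr 1
  refine Finset.sum_congr rfl fun i hi => ?_
  simp [Finset.ne_of_mem_erase hi]

/-- The patterns with at least `k` open arches. -/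
def patternsWithOpens (r k : ℕ) : Finset (OpenLinkPattern r) :=
  Finset.univ.filter fun π => k ≤ openCard π

theorem exists_rightmost_open {π : OpenLinkPattern r} (h : 0 < openCard π) :
    ∃ p, π.1 p = p ∧ ∀ c, p < c → π.1 c ≠ c := by
  obtain ⟨p, hp⟩ := Finset.card_pos.1 h
  have hne : (Finset.univ.filter fun p => π.1 p = p).Nonempty := ⟨p, hp⟩
  refine ⟨_, (Finset.mem_filter.1 (Finset.max'_mem _ hne)).2, fun c hc h => ?_⟩
  exact hc.not_ge (Finset.le_max' _ c (by simp [h]))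

theorem addOpen_injective : Function.Injective (addOpen (r := r)) := by
  intro π π' h
  apply Subtype.ext
  funext i
  have := congrFun (congrArg Subtype.val h) i.castSucc
  simpa using this

theorem closeLast_injective {π π' : OpenLinkPattern r} {p p' : Fin r} {hp hmax hp' hmax'}
    (h : closeLast π p hp hmax = closeLast π' p' hp' hmax') : π = π' := by
  have h1 := congrFun (congrArg Subtype.val h) (Fin.last r)
  simp only [closeLast_last, Fin.castSucc_inj] at h1
  subst h1
  apply Subtype.ext
  funext i
  have := congrFun (congrArg Subtype.val h) i.castSucc
  by_cases hi : i = p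
  · rw [hi, hp, hp']
  · simpa [hi] using this

/-- The two ways of adding a point on the right: as an open arch, or as the right end of an arch that
starts at the rightmost open point. -/
theorem card_patternsWithOpens_add_le (r k : ℕ) :
    (patternsWithOpens r (k - 1)).card + (patternsWithOpens r (k + 1)).card ≤
      (patternsWithOpens (r + 1) k).card := by
  classical
  have hpos : ∀ π ∈ patternsWithOpens r (k + 1), 0 < openCard π := fun π hπ => by
    have := (Finset.mem_filter.1 hπ).2
    omega
  choose p hp hmax using fun π : {π // π ∈ patternsWithOpens r (k + 1)} =>
    exists_rightmost_open (hpos π.1 π.2)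
  let f : {π // π ∈ patternsWithOpens r (k + 1)} → OpenLinkPattern (r + 1) :=
    fun π => closeLast π.1 (p π) (hp π) (hmax π)
  have hf : Function.Injective f := fun π π' h => Subtype.ext (closeLast_injective h)
  rw [← Finset.card_image_of_injective (patternsWithOpens r (k - 1)) addOpen_injective,
    ← Finset.card_attach (s := patternsWithOpens r (k + 1)), ← Finset.card_image_of_injective _ hf,
    ← Finset.card_union_of_disjoint]
  · refine Finset.card_le_card fun π hπ => ?_
    simp only [patternsWithOpens, Finset.mem_filter, Finset.mem_univ, true_and]
    rcases Finset.mem_union.1 hπ with h | h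
    · obtain ⟨π', h1, rfl⟩ := Finset.mem_image.1 h
      have := (Finset.mem_filter.1 h1).2
      rw [openCard_addOpen]; omega
    · obtain ⟨π', -, rfl⟩ := Finset.mem_image.1 h
      have h1 := (Finset.mem_filter.1 π'.2).2
      have h2 := openCard_closeLast π'.1 (p π') (hp π') (hmax π')
      change k ≤ openCard (closeLast π'.1 (p π') (hp π') (hmax π'))
      omega
  · rw [Finset.disjoint_left]
    intro π h h'
    obtain ⟨π₁, -, rfl⟩ := Finset.mem_image.1 h
    obtain ⟨π₂, -, h2⟩ := Finset.mem_image.1 h'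
    have := congrFun (congrArg Subtype.val h2) (Fin.last r)
    simp only [f, closeLast_last, addOpen_last] at this
    exact (Fin.castSucc_lt_last _).ne this

/-- There are at least as many patterns with `|m|` or more open arches as walks from `m` to `0`. -/
theorem walkCount_le_card : ∀ (r : ℕ) (m : ℤ), walkCount r m ≤ (patternsWithOpens r m.natAbs).card
  | 0, m => by
    rw [walkCount]
    split_ifs with h
    · subst h
      exact Finset.card_pos.2 ⟨allOpen 0, by simp [patternsWithOpens]⟩
    · exact Nat.zero_le _
  | r + 1, m => by
    have hmono : ∀ k l, k ≤ l → (patternsWithOpens r l).card ≤ (patternsWithOpens r k).card :=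
      fun k l h => Finset.card_le_card fun π hπ =>
        Finset.mem_filter.2 ⟨Finset.mem_univ _, h.trans (Finset.mem_filter.1 hπ).2⟩
    have h1 := walkCount_le_card r (m - 1)
    have h2 := walkCount_le_card r (m + 1)
    refine le_trans ?_ (card_patternsWithOpens_add_le r m.natAbs)
    rw [walkCount]
    rcases lt_trichotomy m 0 with h | h | h
    · rw [show (m - 1).natAbs = m.natAbs + 1 by omega] at h1
      rw [show (m + 1).natAbs = m.natAbs - 1 by omega] at h2
      omega
    · subst h
      have := hmono 0 1 (by omega)
      simp at h1 h2 ⊢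
      omega
    · rw [show (m - 1).natAbs = m.natAbs - 1 by omega] at h1
      rw [show (m + 1).natAbs = m.natAbs + 1 by omega] at h2
      omega

/-- A pattern is determined by the right ends of its closed arches. -/
theorem closers_injective : Function.Injective (closers (r := r)) := by
  have hmem : ∀ {π π' : OpenLinkPattern r}, closers π = closers π' → ∀ p, π.1 p < p ↔ π'.1 p < p :=
    fun h p => by rw [← mem_closers, ← mem_closers, h]
  -- the left end of the arch at a right end is the last unmatched point before it
  have hle : ∀ {π π' : OpenLinkPattern r}, closers π = closers π' → ∀ p, π.1 p < p →
      (∀ p' < p, π.1 p' < p' → π.1 p' = π'.1 p') → ¬ π.1 p < π'.1 p := by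
    intro π π' h p hp ih hlt
    have hp' := (hmem h p).1 hp
    obtain ⟨h1, h2, h3⟩ := π.2.2 (π.1 p) (π'.1 p) hlt (by rwa [π.2.1])
    rw [π.2.1] at h2
    have h4 : π'.1 p < π.1 (π'.1 p) := by
      rcases lt_or_gt_of_ne h3 with h5 | h5
      · have := (hmem h _).1 h5
        rw [π'.2.1] at this
        exact absurd this hp'.not_gt
      · exact h5
    have h5 := ih (π.1 (π'.1 p)) h2 (by rwa [π.2.1])
    rw [π.2.1] at h5
    have h6 := congrArg π'.1 h5
    rw [π'.2.1, π'.2.1] at h6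
    exact h2.ne h6.symm
  have hcl : ∀ {π π' : OpenLinkPattern r}, closers π = closers π' → ∀ p, π.1 p < p →
      π.1 p = π'.1 p := by
    intro π π' h p
    induction p using WellFoundedLT.induction with
    | ind p ih =>
      intro hp
      have h1 := hle h p hp ih
      have h2 := hle h.symm p ((hmem h p).1 hp) fun p' hp' hlt =>
        (ih p' hp' ((hmem h p').2 hlt)).symm
      exact le_antisymm (not_lt.1 h2) (not_lt.1 h1)
  intro π π' h
  apply Subtype.ext
  funext p
  rcases lt_trichotomy (π.1 p) p with h1 | h1 | h1
  · exact hcl h p h1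
  · rcases lt_trichotomy (π'.1 p) p with h2 | h2 | h2
    · exact absurd ((hmem h p).2 h2) (by rw [h1]; exact lt_irrefl _)
    · rw [h1, h2]
    · have := hcl h.symm (π'.1 p) (by rwa [π'.2.1])
      rw [π'.2.1] at this
      have h3 := congrArg π.1 this
      rw [π.2.1, h1] at h3
      exact absurd h3 h2.ne
  · have := hcl h (π.1 p) (by rwa [π.2.1])
    rw [π.2.1] at this
    have h3 := congrArg π'.1 this
    rw [π'.2.1] at h3
    exact h3.symm

end

/-! ### Coordinates with respect to the spin tensors -/

section

variable {K : Type*} [Field K] {r : ℕ}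

open GenericPoint

/-- The spin configuration with `-` at the right ends of the closed arches. -/
def closerSpin (π : OpenLinkPattern r) (p : Fin r) : Bool := !decide (π.1 p < p)

theorem closerSpin_eq_false {π : OpenLinkPattern r} {p : Fin r} :
    closerSpin π p = false ↔ p ∈ closers π := by
  simp [closerSpin, mem_closers]

/-- The sum of the distances of the right ends of the closed arches from the end of the line. -/
def closerMass (π : OpenLinkPattern r) : ℕ := ∑ p ∈ closers π, (r - p)

theorem spinTensor_closerSpin_self (q : K) (π : OpenLinkPattern r) :
    spinTensor q (colored π) (closerSpin π) = 1 := by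
  refine Finset.prod_eq_one fun i _ => ?_
  unfold arcFactor
  split_ifs with h
  · rcases colored_cases π i with ⟨j, h1, h2, h3⟩ | ⟨j, h1, h2, h3⟩ | ⟨-, h2, h3⟩
    · rw [h2, h3]
      simp [closerSpin, h1.2.1, h1.2.2.1, arcWeight]
    · rw [h2] at h
      exact absurd h1.1 h.not_gt
    · rw [h2] at h
      rw [h2, h3]
      simp [closerSpin, h, h.not_gt, π.2.1 i, arcWeight]
  · rfl

/-- The spin tensors are triangular with respect to the configurations `closerSpin`. -/
theorem closerMass_lt_or_eq {q : K} {π π' : OpenLinkPattern r}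
    (h : spinTensor q (colored π') (closerSpin π) ≠ 0) : closerMass π' < closerMass π ∨ π' = π := by
  classical
  have hf := Finset.prod_ne_zero_iff.1 h
  -- exactly one of the ends of a closed arch of `π'` carries the spin `-`
  have hone : ∀ p ∈ closers π', p ∉ closers π → π'.1 p ∈ closers π := by
    intro p hp hp'
    rw [mem_closers] at hp
    have hcl : π'.1 (π'.1 p) ≠ π'.1 p := by rw [π'.2.1]; exact hp.ne'
    have h1 := hf (π'.1 p) (Finset.mem_univ _)
    obtain ⟨h2, h3⟩ := colored_of_closed hcl
    rw [arcFactor, h2, h3, π'.2.1, if_pos hp, arcWeight] at h1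
    have h4 : closerSpin π p = xor (closerSpin π (π'.1 p)) (!false) := by
      by_contra hne
      exact h1 (if_neg hne)
    have h5 : closerSpin π p = true := by
      by_contra hh
      exact hp' (closerSpin_eq_false.1 (by simpa using hh))
    rw [h5] at h4
    rw [← closerSpin_eq_false]
    simpa using h4.symm
  -- assign to each arch of `π'` its end with the spin `-`; passing to the left end increases the mass
  let φ : Fin r → Fin r := fun p => if p ∈ closers π then p else π'.1 p
  have hmem : ∀ p ∈ closers π', φ p ∈ closers π := by
    intro p hp
    by_cases hpc : p ∈ closers π
    · simp [φ, hpc]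
    · simpa [φ, hpc] using hone p hp hpc
  have hle : ∀ p ∈ closers π', r - (p : ℕ) ≤ r - (φ p : ℕ) := by
    intro p hp
    by_cases hpc : p ∈ closers π
    · simp [φ, hpc]
    · have := mem_closers.1 hp
      rw [Fin.lt_def] at this
      simp only [φ, hpc, if_false]
      omega
  have hinj : Set.InjOn φ (closers π') := by
    intro p hp p' hp' heq
    have h1 := mem_closers.1 hp
    have h2 := mem_closers.1 hp'
    simp only [φ] at heq
    split_ifs at heq
    · exact heq
    · rw [heq, π'.2.1] at h1
      exact absurd h1 h2.not_gt
    · rw [← heq, π'.2.1] at h2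
      exact absurd h2 h1.not_gt
    · rw [← π'.2.1 p, heq, π'.2.1]
  have h1 : closerMass π' ≤ ∑ p ∈ closers π', (r - (φ p : ℕ)) := Finset.sum_le_sum hle
  have h2 : ∑ p ∈ closers π', (r - (φ p : ℕ)) = ∑ p ∈ (closers π').image φ, (r - (p : ℕ)) :=
    (Finset.sum_image (f := fun p : Fin r => r - (p : ℕ)) hinj).symm
  have hsub : (closers π').image φ ⊆ closers π := Finset.image_subset_iff.2 hmem
  have h3 : ∑ p ∈ (closers π').image φ, (r - (p : ℕ)) ≤ closerMass π :=
    Finset.sum_le_sum_of_subset hsub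
  by_contra hcon
  push Not at hcon
  obtain ⟨hlt, hne⟩ := hcon
  have h4 : ∀ p ∈ closers π', r - (p : ℕ) = r - (φ p : ℕ) :=
    (Finset.sum_eq_sum_iff_of_le hle).1 (by
      change closerMass π' = _
      omega)
  have h5 : closers π' ⊆ closers π := by
    intro p hp
    have := h4 p hp
    have hpφ : φ p = p := by
      ext
      have := (φ p).2
      have := p.2
      omega
    rw [← hpφ]
    exact hmem p hp
  have h6 : closers π' ≠ closers π := fun h => hne (closers_injective h)
  obtain ⟨x, hx, hx'⟩ := Finset.exists_of_ssubset (Finset.ssubset_iff_subset_ne.2 ⟨h5, h6⟩)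
  have h7 : closerMass π' < closerMass π :=
    Finset.sum_lt_sum_of_subset h5 hx hx' (by have := x.2; omega) fun _ _ _ => Nat.zero_le _
  omega

/-- The coefficients of a combination of spin tensors, computed from its components at the
configurations `closerSpin`. -/
noncomputable def coord (q : K) (v : (Fin r → Bool) → K) (π : OpenLinkPattern r) : K :=
  v (closerSpin π) - ∑ π' ∈ (Finset.univ.filter fun π' => closerMass π' < closerMass π).attach,
    coord q v π'.1 * spinTensor q (colored π'.1) (closerSpin π)
termination_by closerMass π
decreasing_by exact (Finset.mem_filter.1 π'.2).2

theorem coord_eq (q : K) (v : (Fin r → Bool) → K) (π : OpenLinkPattern r) :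
    coord q v π = v (closerSpin π) -
      ∑ π' ∈ Finset.univ.filter fun π' => closerMass π' < closerMass π,
        coord q v π' * spinTensor q (colored π') (closerSpin π) := by
  rw [coord, ← Finset.sum_attach (Finset.univ.filter fun π' => closerMass π' < closerMass π)]

theorem spinVector_closerSpin (q : K) (c : OpenLinkPattern r → K) (π : OpenLinkPattern r) :
    spinVector q c (closerSpin π) = c π +
      ∑ π' ∈ Finset.univ.filter fun π' => closerMass π' < closerMass π,
        c π' * spinTensor q (colored π') (closerSpin π) := by
  rw [spinVector, ← Finset.sum_filter_add_sum_filter_not _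
    (fun π' => closerMass π' < closerMass π), add_comm]
  congr 1
  rw [Finset.sum_eq_single π]
  · rw [spinTensor_closerSpin_self, mul_one]
  · intro π' hπ' hne
    by_contra h
    rcases closerMass_lt_or_eq (right_ne_zero_of_mul h) with h1 | h1
    · exact (Finset.mem_filter.1 hπ').2 h1
    · exact hne h1
  · intro h
    exact absurd (by simp) h

/-- The vector with the coordinates `coord q v` agrees with `v` at the configurations `closerSpin`. -/
theorem spinVector_coord_closerSpin (q : K) (v : (Fin r → Bool) → K) (π : OpenLinkPattern r) :
    spinVector q (coord q v) (closerSpin π) = v (closerSpin π) := by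
  rw [spinVector_closerSpin, coord_eq q v π, sub_add_cancel]

theorem eq_of_spinVector_closerSpin {q : K} {c c' : OpenLinkPattern r → K}
    (h : ∀ π, spinVector q c (closerSpin π) = spinVector q c' (closerSpin π)) : c = c' := by
  have key : ∀ (m : ℕ) (π : OpenLinkPattern r), closerMass π = m → c π = c' π := by
    intro m
    induction m using Nat.strong_induction_on with
    | _ m ih =>
      intro π hπ
      have h1 := h π
      rw [spinVector_closerSpin, spinVector_closerSpin] at h1
      rw [Finset.sum_congr rfl fun π' hπ' => by
        rw [ih (closerMass π') (hπ ▸ (Finset.mem_filter.1 hπ').2) π' rfl]] at h1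
      exact add_right_cancel h1
  exact funext fun π => key _ π rfl

theorem spinVector_injective (q : K) : Function.Injective (spinVector (r := r) q) :=
  fun _ _ h => eq_of_spinVector_closerSpin fun π => congrFun h (closerSpin π)

theorem natCast_zpow_sub_zpow_neg_ne_zero [CharZero K] {k : ℕ} (hk : 2 ≤ k) {m : ℤ} (hm : m ≠ 0) :
    (k : K) ^ m - (k : K) ^ (-m) ≠ 0 := by
  have h0 : (k : K) ≠ 0 := by exact_mod_cast (by omega : k ≠ 0)
  have key : ∀ l : ℕ, l ≠ 0 → (k : K) ^ l * (k : K) ^ l ≠ 1 := by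
    intro l hl h
    have h1 : k ^ l * k ^ l = 1 := by exact_mod_cast h
    have h2 : 1 < k ^ l := Nat.one_lt_pow hl (by omega)
    nlinarith
  intro h
  obtain ⟨l, rfl | rfl⟩ := m.eq_nat_or_neg
  · rw [zpow_neg, zpow_natCast, sub_eq_zero, ← mul_eq_one_iff_eq_inv₀ (pow_ne_zero _ h0)] at h
    exact key l (by exact_mod_cast hm) h
  · rw [neg_neg, zpow_neg, zpow_natCast, sub_eq_zero, eq_comm,
      ← mul_eq_one_iff_eq_inv₀ (pow_ne_zero _ h0)] at h
    exact key l (by simpa using hm) h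

/-- For `q = 2, 3, …` the fixed vectors of `chainOp` are the combinations of spin tensors. -/
theorem exists_spinVector_eq [CharZero K] {n k : ℕ} (hk : 2 ≤ k)
    {v : (Fin (2 * n + 1) → Bool) → K} (hv : chainOp (k : K) v = v) :
    ∃ c, spinVector (k : K) c = v := by
  have h0 : (k : K) ≠ 0 := by exact_mod_cast (by omega : k ≠ 0)
  have h1 : (k : K) - (k : K)⁻¹ ≠ 0 := by
    simpa using natCast_zpow_sub_zpow_neg_ne_zero (K := K) hk one_ne_zero
  let L : (OpenLinkPattern (2 * n + 1) → K) →ₗ[K] ((Fin (2 * n + 1) → Bool) → K) :=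
    { toFun := spinVector (k : K)
      map_add' := fun c c' => by funext ε; simp [spinVector, add_mul, Finset.sum_add_distrib]
      map_smul' := fun a c => by funext ε; simp [spinVector, Finset.mul_sum, mul_assoc] }
  have hq1 : qInt (k : K) 1 = 1 := by
    rw [qInt, zpow_neg, zpow_one, div_self h1]
  have hle : LinearMap.range L ≤ LinearMap.ker (chainOp (k : K) - qInt (k : K) 1 • LinearMap.id) := by
    rintro _ ⟨c, rfl⟩
    rw [LinearMap.mem_ker, hq1, one_smul, LinearMap.sub_apply, LinearMap.id_apply, sub_eq_zero]
    have hL : L c = ∑ π, c π • spinTensor (k : K) (colored π) := by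
      funext ε
      simp [L, spinVector]
    rw [hL, map_sum]
    exact Finset.sum_congr rfl fun π _ => by
      rw [map_smul, chainOp_spinTensor h0 (isColoredPicture_colored π)]
  have heq := Submodule.eq_of_le_of_finrank_le hle (by
    refine (finrank_eigenspace_chainOp_le h0 h1 (fun m hm => div_ne_zero
      (natCast_zpow_sub_zpow_neg_ne_zero hk hm) h1) _ 1).trans ?_
    rw [LinearMap.finrank_range_of_inj (f := L) (spinVector_injective _), Module.finrank_pi]
    exact (walkCount_le_card _ 1).trans (Finset.card_le_univ _))
  have : v ∈ LinearMap.range L := by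
    rw [heq, LinearMap.mem_ker, hq1, one_smul, LinearMap.sub_apply, LinearMap.id_apply, hv, sub_self]
  exact this

variable {n : ℕ} {q : K}

theorem headWeight_true (q : K) (i : Fin r) : headWeight q (fun _ => true) i = (q ^ (i : ℕ))⁻¹ := by
  have h : (Finset.univ.filter fun k => k < i) = Finset.Iio i := by ext; simp
  rw [headWeight, ← Finset.prod_filter, h]
  simp [spinWeight]

/-- `chainOp` maps solutions to solutions. -/
theorem IsSpinSolution.chainOp {A : (Fin (2 * n + 1) → Bool) → GenericPoint K (2 * n + 1) → K}
    (hA : IsSpinSolution q 0 A) (hq : q ≠ 0) :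
    IsSpinSolution q 0 fun ε w => DqKZ.chainOp q (fun ε' => A ε' w) ε where
  exchange i hi ε w := by
    have h1 : (q * w.1 i.castSucc - q⁻¹ * w.1 i.succ) • (fun ε => A ε (swap i.castSucc i.succ w)) =
        (q * w.1 i.succ - q⁻¹ * w.1 i.castSucc) • (fun ε => A ε w) +
        (w.1 i.succ - w.1 i.castSucc) • spinE q i.castSucc i.succ (fun ε' => A ε' w) :=
      funext fun ε => hA.exchange i hi ε w
    have h2 := congrFun (congrArg (DqKZ.chainOp q) h1) ε
    rw [map_add, map_smul, map_smul, map_smul, chainOp_spinE hq] at h2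
    exact h2
  inversion ε w := by
    have h1 : (fun ε => A ε (invert (Fin.last _) w)) = fun ε => A (flip (Fin.last _) ε) w :=
      funext fun ε => hA.inversion ε w
    rw [h1, chainOp_flip_last q fun ε => A ε w]

/-- The solution is fixed by `chainOp`: its image under `chainOp` solves the same relations, and both
have the same component with all spins `+`. -/
theorem chainOp_spinSolution [CharZero K] (hq : q ≠ 0) (w : GenericPoint K (2 * n + 1)) :
    chainOp q (fun ε => spinSolution n q ε w) = fun ε => spinSolution n q ε w := by
  have hs := isSpinSolution_spinSolution (n := n) hq
  have h := (hs.chainOp hq).sub hs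
  have h0 := fun ε => h.eq_zero hq (ε₀ := fun _ => true) (ε := ε) (by
    funext w
    simp only [Pi.sub_apply, Pi.zero_apply, sub_eq_zero, chainOp_apply, headWeight_true]
    rw [sum_spinSolution_flip hq, spinSolution_true]) (fun i hi => absurd hi (Nat.not_lt_zero _))
  funext ε
  exact sub_eq_zero.1 (congrFun (h0 ε) w)

theorem isLaurent_spinTensor (D : ColoredDiagram r) (ε : Fin r → Bool) :
    IsLaurent fun q : K => spinTensor q D ε := by
  refine IsLaurent.prod _ fun i _ => ?_
  simp only [arcFactor, arcWeight]
  split_ifs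
  all_goals first | exact .const _ | exact IsLaurent.inv.neg

theorem isLaurent_coord {v : K → (Fin r → Bool) → K} (hv : ∀ ε, IsLaurent fun q => v q ε) :
    ∀ π, IsLaurent fun q => coord q (v q) π := by
  have key : ∀ (m : ℕ) (π : OpenLinkPattern r), closerMass π = m →
      IsLaurent fun q => coord q (v q) π := by
    intro m
    induction m using Nat.strong_induction_on with
    | _ m ih =>
      intro π hπ
      simp only [coord_eq _ _ π]
      exact (hv _).sub (IsLaurent.sum _ fun π' hπ' =>
        (ih (closerMass π') (hπ ▸ (Finset.mem_filter.1 hπ').2) π' rfl).mul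
          (isLaurent_spinTensor _ _))
  exact fun π => key _ π rfl

/-- The solution in the spin chain is a combination of the spin tensors of link patterns. Both sides are
Laurent polynomials in `q`, so that it suffices to consider `q = 2, 3, …`, for which the fixed vectors
of `chainOp` are known. -/
theorem spinVector_coord_spinSolution [CharZero K] (hq : q ≠ 0) (w : GenericPoint K (2 * n + 1)) :
    spinVector q (coord q fun ε => spinSolution n q ε w) = fun ε => spinSolution n q ε w := by
  funext ε
  have h : IsLaurent fun q => spinVector q (coord q fun ε => spinSolution n q ε w) ε -
      spinSolution n q ε w :=
    (IsLaurent.sum _ fun π _ => (isLaurent_coord (fun ε => isLaurent_spinSolution ε w) π).mul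
      (isLaurent_spinTensor _ _)).sub (isLaurent_spinSolution ε w)
  refine sub_eq_zero.1 (h.eq_zero_of_infinite ?_ hq)
  have hinf : (Set.range fun k : ℕ => ((k + 2 : ℕ) : K)).Infinite :=
    Set.infinite_range_of_injective fun a b h => by
      have : a + 2 = b + 2 := Nat.cast_injective h
      omega
  refine hinf.mono ?_
  rintro _ ⟨k, rfl⟩
  have h0 : ((k + 2 : ℕ) : K) ≠ 0 := Nat.cast_ne_zero.2 (by omega)
  refine ⟨h0, ?_⟩
  obtain ⟨c, hc⟩ := exists_spinVector_eq (K := K) (k := k + 2) (by omega) (chainOp_spinSolution h0 w)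
  have h1 : coord ((k + 2 : ℕ) : K) (fun ε => spinSolution n ((k + 2 : ℕ) : K) ε w) = c :=
    eq_of_spinVector_closerSpin fun π => by rw [spinVector_coord_closerSpin, hc]
  rw [h1, hc, sub_self]

end

/-! ### Polynomiality -/

section

variable {K : Type*} [Field K] {n : ℕ}

open GenericPoint

/-- Polynomials that agree at all generic points are equal. -/
theorem eq_of_eval_genericPoint [CharZero K] {r : ℕ} {p p' : MvPolynomial (Fin r) K}
    (h : ∀ w : GenericPoint K r, eval w.1 p = eval w.1 p') : p = p' := by
  let G : MvPolynomial (Fin r) K := (∏ i, X i) *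
    ∏ i, ∏ j, (if i = j then 1 else (X i - X j) * (X i * X j - 1))
  have hG : G ≠ 0 := by
    have h1 : eval (fun i : Fin r => ((i : ℕ) + 2 : K)) G ≠ 0 := by
      simp only [G, map_mul, map_prod, eval_X]
      refine mul_ne_zero (Finset.prod_ne_zero_iff.2 fun i _ => ?_)
        (Finset.prod_ne_zero_iff.2 fun i _ => Finset.prod_ne_zero_iff.2 fun j _ => ?_)
      · exact_mod_cast (by omega : (i : ℕ) + 2 ≠ 0)
      · split_ifs with hij
        · simp
        · simp only [map_mul, map_sub, eval_X, map_one]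
          refine mul_ne_zero (sub_ne_zero.2 ?_) (sub_ne_zero.2 ?_)
          · intro h
            have h2 : (i : ℕ) + 2 = (j : ℕ) + 2 := by exact_mod_cast h
            exact hij (Fin.ext (by omega))
          · intro h
            have h2 : ((i : ℕ) + 2) * ((j : ℕ) + 2) = 1 := by exact_mod_cast h
            have := Nat.eq_one_of_mul_eq_one_right h2
            omega
    intro h2
    rw [h2, map_zero] at h1
    exact h1 rfl
  refine eq_of_eval_eq_off hG fun w hw => ?_
  simp only [G, map_mul, map_prod, eval_X, ne_eq, mul_eq_zero, not_or, Finset.prod_eq_zero_iff,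
    Finset.mem_univ, true_and, not_exists] at hw
  refine h ⟨w, hw.1, fun i j hij => ?_⟩
  have := hw.2 i j
  rw [if_neg hij] at this
  simp only [map_mul, map_sub, eval_X, map_one, mul_eq_zero, not_or, sub_eq_zero] at this
  exact this

theorem prod_pow_ne_zero {r : ℕ} (w : GenericPoint K r) (n : ℕ) : ∏ j, w.1 j ^ n ≠ 0 :=
  Finset.prod_ne_zero_iff.2 fun j _ => pow_ne_zero n (w.2.1 j)

theorem prod_invert_pow {r : ℕ} (w : GenericPoint K r) (b : Fin r) (n : ℕ) :
    ∏ j, (invert b w).1 j ^ n = (w.1 b ^ (2 * n))⁻¹ * ∏ j, w.1 j ^ n := by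
  have hb := pow_ne_zero n (w.2.1 b)
  rw [← Finset.mul_prod_erase _ _ (Finset.mem_univ b),
    ← Finset.mul_prod_erase _ (fun j => w.1 j ^ n) (Finset.mem_univ b),
    Finset.prod_congr rfl fun j hj => by rw [invert_of_ne w (Finset.ne_of_mem_erase hj)],
    invert_self, inv_pow, two_mul n, pow_add]
  field_simp

/-- A polynomial with its substitution `w_b ↦ 1 / (c w_b)`, cleared of denominators. -/
theorem exists_reversal {r : ℕ} {c : K} (hc : c ≠ 0) (b : Fin r) {N : ℕ}
    (p : MvPolynomial (Fin r) K) (hp : ∀ j, degreeOf j p ≤ N) :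
    ∃ p' : MvPolynomial (Fin r) K, (∀ j, degreeOf j p' ≤ N) ∧ ∀ w : Fin r → K, w b ≠ 0 →
      eval w p' = w b ^ N * eval (Function.update w b (1 / (c * w b))) p := by
  refine ⟨∑ s ∈ p.support, monomial (s.update b (N - s b)) (coeff s p * c⁻¹ ^ s b), ?_, ?_⟩
  · intro j
    refine (degreeOf_sum_le j _ _).trans (Finset.sup_le fun s hs => ?_)
    by_cases h0 : coeff s p * c⁻¹ ^ s b = 0
    · rw [h0, map_zero, degreeOf_zero]; exact Nat.zero_le _
    · rw [degreeOf_monomial_eq _ _ h0]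
      by_cases hj : j = b
      · subst hj; simp
      · simp only [Finsupp.coe_update, Function.update_of_ne hj]
        exact (monomial_le_degreeOf j hs).trans (hp j)
  · intro w hw
    rw [map_sum, eval_eq', Finset.mul_sum]
    refine Finset.sum_congr rfl fun s hs => ?_
    have hsb : s b ≤ N := (monomial_le_degreeOf b hs).trans (hp b)
    rw [eval_monomial, Finsupp.prod_fintype _ _ fun _ => pow_zero _,
      ← Finset.mul_prod_erase _ _ (Finset.mem_univ b),
      ← Finset.mul_prod_erase _ (fun i => Function.update w b (1 / (c * w b)) i ^ s i)
        (Finset.mem_univ b)]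
    have h1 : ∏ x ∈ Finset.univ.erase b, w x ^ (s.update b (N - s b)) x =
        ∏ x ∈ Finset.univ.erase b, Function.update w b (1 / (c * w b)) x ^ s x := by
      refine Finset.prod_congr rfl fun x hx => ?_
      have := Finset.ne_of_mem_erase hx
      simp [this]
    rw [h1]
    simp only [Finsupp.coe_update, Function.update_self]
    have h2 : w b ^ N = w b ^ (N - s b) * w b ^ s b := by rw [← pow_add, Nat.sub_add_cancel hsb]
    rw [h2, one_div, mul_inv, mul_pow, inv_pow, inv_pow]
    field_simp

/-- The numerator of a divided difference is divisible by the difference of the two variables, and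
the quotient has no larger partial degrees. -/
theorem exists_dividedDifference {r : ℕ} (q : K) {a b : Fin r} (hab : a ≠ b) {N : ℕ}
    (p : MvPolynomial (Fin r) K) (hp : ∀ j, degreeOf j p ≤ N) :
    ∃ D : MvPolynomial (Fin r) K, (∀ j, degreeOf j D ≤ N) ∧
      (C q * X a - C q⁻¹ * X b) * rename (Equiv.swap a b) p - C (q - q⁻¹) * X a * p =
        (X b - X a) * D := by
  obtain ⟨P, hPdef⟩ : ∃ P, P =
    (C q * X a - C q⁻¹ * X b) * rename (Equiv.swap a b) p - C (q - q⁻¹) * X a * p := ⟨_, rfl⟩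
  have hP : aeval (Function.update X b (C ((1 : K) ^ 2) * X a) :
      Fin r → MvPolynomial (Fin r) K) P = 0 := by
    obtain ⟨F, hF⟩ : ∃ F : Fin r → MvPolynomial (Fin r) K,
      F = Function.update X b (C ((1 : K) ^ 2) * X a) := ⟨_, rfl⟩
    have hFa : F a = X a := by rw [hF, Function.update_of_ne hab]
    have hFb : F b = X a := by rw [hF, Function.update_self, one_pow, C_1, one_mul]
    have hcomp : F ∘ (Equiv.swap a b) = F := by
      funext j
      by_cases h : j = a
      · rw [h, Function.comp_apply, Equiv.swap_apply_left, hFa, hFb]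
      · by_cases h' : j = b
        · rw [h', Function.comp_apply, Equiv.swap_apply_right, hFa, hFb]
        · rw [Function.comp_apply, Equiv.swap_apply_of_ne_of_ne h h']
    rw [← hF, hPdef, map_sub, map_mul, map_mul, map_mul, map_sub, map_mul, map_mul, aeval_rename,
      hcomp, aeval_X, aeval_X, hFa, hFb]
    simp only [map_sub, algHom_C, algebraMap_eq]
    ring
  have hdvd := qForm_dvd_sub_aeval (one_ne_zero (α := K)) a b P
  rw [hP, sub_zero] at hdvd
  obtain ⟨D, hD⟩ := hdvd
  have hren : ∀ j, degreeOf j (rename (Equiv.swap a b) p) ≤ N := fun j => by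
    have := degreeOf_rename_of_injective (p := p) (Equiv.swap a b).injective (Equiv.swap a b j)
    rw [Equiv.swap_apply_self] at this
    rw [this]; exact hp _
  have hX : ∀ (j : Fin r) (c : K) (i : Fin r), i = a ∨ i = b →
      degreeOf j (C c * X i) ≤ if j = a ∨ j = b then 1 else 0 := fun j c i hi => by
    refine (degreeOf_C_mul_le _ _ _).trans ((degreeOf_X j i).trans_le ?_)
    by_cases hj : j = i
    · rw [if_pos hj, if_pos (hj ▸ hi)]
    · rw [if_neg hj]; exact Nat.zero_le _
  have hle : ∀ j, degreeOf j P ≤ (if j = a ∨ j = b then 1 else 0) + N := fun j => by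
    rw [hPdef]
    refine (degreeOf_sub_le j _ _).trans (max_le ?_ ?_)
    · exact (degreeOf_mul_le j _ _).trans (add_le_add ((degreeOf_sub_le j _ _).trans
        (max_le (hX j q a (Or.inl rfl)) (hX j q⁻¹ b (Or.inr rfl)))) (hren j))
    · exact (degreeOf_mul_le j _ _).trans (add_le_add (hX j _ a (Or.inl rfl)) (hp j))
  refine ⟨-D, fun j => ?_, ?_⟩
  · rw [degreeOf_neg]
    by_cases hD0 : D = 0
    · rw [hD0, degreeOf_zero]; exact Nat.zero_le _
    have hdeg : degreeOf j P = degreeOf j (qForm (1 : K) a b) + degreeOf j D := by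
      rw [hD, degreeOf_mul_eq (qForm_ne_zero one_ne_zero hab) hD0]
    rw [degreeOf_qForm one_ne_zero hab] at hdeg
    have := hle j
    omega
  · rw [← hPdef, hD, qForm, inv_one, C_1]
    ring

/-- A function of the spectral parameters that is `∏ w_j ^ (-n)` times a polynomial of degree at most
`2 n` in each variable. -/
def IsRegular (A : GenericPoint K (2 * n + 1) → K) : Prop :=
  ∃ p : MvPolynomial (Fin (2 * n + 1)) K, (∀ j, degreeOf j p ≤ 2 * n) ∧
    ∀ w, A w = (∏ j, w.1 j ^ n)⁻¹ * eval w.1 p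

namespace IsRegular

variable {A B : GenericPoint K (2 * n + 1) → K}

theorem sub (hA : IsRegular A) (hB : IsRegular B) : IsRegular fun w => A w - B w := by
  obtain ⟨p, h1, h2⟩ := hA
  obtain ⟨p', h1', h2'⟩ := hB
  exact ⟨p - p', fun j => (degreeOf_sub_le j p p').trans (max_le (h1 j) (h1' j)), fun w => by
    show A w - B w = _
    rw [h2, h2', map_sub, mul_sub]⟩

theorem mul_const (hA : IsRegular A) (c : K) : IsRegular fun w => A w * c := by
  obtain ⟨p, h1, h2⟩ := hA
  exact ⟨C c * p, fun j => (degreeOf_C_mul_le p j c).trans (h1 j), fun w => by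
    show A w * c = _
    rw [h2, map_mul, eval_C]; ring⟩

theorem sum {ι : Type*} (s : Finset ι) {A : ι → GenericPoint K (2 * n + 1) → K}
    (hA : ∀ i ∈ s, IsRegular (A i)) : IsRegular fun w => ∑ i ∈ s, A i w := by
  choose p h1 h2 using hA
  refine ⟨∑ i ∈ s.attach, p i.1 i.2, fun j => (degreeOf_sum_le j _ _).trans
    (Finset.sup_le fun i _ => h1 i.1 i.2 j), fun w => ?_⟩
  show ∑ i ∈ s, A i w = _
  rw [← Finset.sum_attach, map_sum, Finset.mul_sum]
  exact Finset.sum_congr rfl fun (i : {i // i ∈ s}) _ => h2 i.1 i.2 w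

theorem baseFunction {q : K} (hq : q ≠ 0) : IsRegular (baseFunction n q) :=
  ⟨qVandermonde (2 * n + 1) q, fun j => (degreeOf_qVandermonde hq j).le, fun _ => rfl⟩

theorem invertOp (hA : IsRegular A) (b : Fin (2 * n + 1)) : IsRegular (invertOp b A) := by
  obtain ⟨p, h1, h2⟩ := hA
  obtain ⟨p', h1', h2'⟩ := exists_reversal one_ne_zero b p h1
  refine ⟨p', h1', fun w => ?_⟩
  have hb := w.2.1 b
  have h3 : (invert b w).1 = Function.update w.1 b (1 / (1 * w.1 b)) := by simp [invert]
  rw [invertOp_apply, h2, h2' _ hb, ← h3, prod_invert_pow, mul_inv, inv_inv]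
  ring

/-- Divided differences preserve regularity. -/
theorem exchangeOp (hA : IsRegular A) (q : K) {a b : Fin (2 * n + 1)} (hab : a ≠ b) :
    IsRegular (exchangeOp q a b A) := by
  obtain ⟨p, h1, h2⟩ := hA
  obtain ⟨D, hD, hD'⟩ := exists_dividedDifference q hab p h1
  refine ⟨D, hD, fun w => ?_⟩
  have h4 : ∏ j, (swap a b w).1 j ^ n = ∏ j, w.1 j ^ n :=
    Equiv.prod_comp (Equiv.swap a b) fun j => w.1 j ^ n
  have h5 : w.1 b - w.1 a ≠ 0 := sub_ne_zero.2 (w.2.2 b a hab.symm).1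
  have h3 := congrArg (eval w.1) hD'
  simp only [map_sub, map_mul, eval_C, eval_X, eval_rename] at h3
  have hr : eval (w.1 ∘ Equiv.swap a b) p = eval (swap a b w).1 p := rfl
  rw [hr] at h3
  rw [exchangeOp_apply, h2, h2, h4, div_eq_iff h5]
  linear_combination (∏ j, w.1 j ^ n)⁻¹ * h3

theorem creation {q : K} (hA : IsRegular A) : ∀ k < 2 * n + 1,
    IsRegular (creation (heckeOp n q) (DqKZ.invertOp (Fin.last (2 * n))) k A)
  | 0, _ => hA.invertOp _
  | k + 1, hk => (creation hA k (by omega)).exchangeOp q (by simp; omega)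

theorem spinFamily {q : K} : ∀ (m : ℕ) (_ : m ≤ 2 * n + 1) (ε : Fin m → Bool)
    {A : GenericPoint K (2 * n + 1) → K} (_ : IsRegular A),
    IsRegular (spinFamily (heckeOp n q) (DqKZ.invertOp (Fin.last (2 * n))) m ε A)
  | 0, _, _, _, h => h
  | m + 1, hm, ε, A, h => by
    simp only [DqKZ.spinFamily]
    split_ifs
    · exact spinFamily m (by omega) _ h
    · exact spinFamily m (by omega) _ (h.creation m (by omega))

theorem spinSolution {q : K} (hq : q ≠ 0) (ε : Fin (2 * n + 1) → Bool) :
    IsRegular (spinSolution n q ε) :=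
  spinFamily _ le_rfl ε (IsRegular.baseFunction hq)

/-- The coordinates are computed recursively from the components, with constant coefficients. -/
theorem coord {q : K} {v : (Fin (2 * n + 1) → Bool) → GenericPoint K (2 * n + 1) → K}
    (hv : ∀ ε, IsRegular (v ε)) : ∀ π, IsRegular fun w => coord q (fun ε => v ε w) π := by
  have key : ∀ (m : ℕ) (π : OpenLinkPattern (2 * n + 1)), closerMass π = m →
      IsRegular fun w => DqKZ.coord q (fun ε => v ε w) π := by
    intro m
    induction m using Nat.strong_induction_on with
    | _ m ih =>
      intro π hπ
      simp only [coord_eq _ _ π]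
      exact (hv _).sub (IsRegular.sum _ fun π' hπ' =>
        (ih (closerMass π') (hπ ▸ (Finset.mem_filter.1 hπ').2) π' rfl).mul_const _)
  exact fun π => key _ π rfl

end IsRegular

end

/-! ### The polynomial solution -/

section

variable {K : Type*} [Field K] {n : ℕ}

open GenericPoint

theorem spinVector_mul {r : ℕ} (q c : K) (v : OpenLinkPattern r → K) (ε : Fin r → Bool) :
    spinVector q (fun π => c * v π) ε = c * spinVector q v ε := by
  simp only [spinVector, Finset.mul_sum, mul_assoc]

/-- A linear relation between vectors of link patterns can be checked in the spin chain. -/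
theorem row_of_spinVector {r : ℕ} {q : K} (M : Matrix (OpenLinkPattern r) (OpenLinkPattern r) K)
    {a b c : K} {v v' : OpenLinkPattern r → K}
    (h : ∀ ε, a * spinVector q v' ε = b * spinVector q v ε + c * spinVector q (M.mulVec v) ε)
    (ρ : OpenLinkPattern r) : a * v' ρ = b * v ρ + c * ∑ ρ', M ρ ρ' * v ρ' := by
  have h1 : (fun ρ => a * v' ρ) = fun ρ => b * v ρ + c * M.mulVec v ρ := by
    refine spinVector_injective q (funext fun ε => ?_)
    have h2 : spinVector q (fun ρ => b * v ρ + c * M.mulVec v ρ) ε =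
        b * spinVector q v ε + c * spinVector q (M.mulVec v) ε := by
      rw [← spinVector_mul, ← spinVector_mul]
      simp only [spinVector, add_mul, Finset.sum_add_distrib]
    rw [spinVector_mul, h, h2]
  exact congrFun h1 ρ

/-- `Ψ` is the vector of polynomials which represents the solution in the spin chain, up to the
factor `∏ w_j ^ n`. -/
structure IsGroundVector (q : K) (Ψ : PolyVector K n) : Prop where
  degree : ∀ π j, degreeOf j (Ψ π) ≤ 2 * n
  eq : ∀ (w : GenericPoint K (2 * n + 1)) ε,
    spinVector q (value Ψ w.1) ε = (∏ j, w.1 j ^ n) * spinSolution n q ε w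

theorem exists_isGroundVector [CharZero K] {q : K} (hq : q ≠ 0) :
    ∃ Ψ : PolyVector K n, IsGroundVector q Ψ := by
  choose Ψ h1 h2 using IsRegular.coord (q := q) fun ε => IsRegular.spinSolution (n := n) hq ε
  refine ⟨Ψ, h1, fun w ε => ?_⟩
  have h3 : value Ψ w.1 =
      fun π => (∏ j, w.1 j ^ n) * coord q (fun ε => spinSolution n q ε w) π := by
    funext π
    have h4 : coord q (fun ε => spinSolution n q ε w) π = _ := h2 π w
    rw [h4, mul_inv_cancel_left₀ (prod_pow_ne_zero w n)]
    rfl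
  rw [h3, spinVector_mul, spinVector_coord_spinSolution hq]

/-- The component `ε` of the spin vector of a vector of polynomials. -/
noncomputable def spinPoly (q : K) (Ψ : PolyVector K n) (ε : Fin (2 * n + 1) → Bool) :
    MvPolynomial (Fin (2 * n + 1)) K :=
  ∑ π, C (spinTensor q (colored π) ε) * Ψ π

theorem eval_spinPoly (q : K) (Ψ : PolyVector K n) (ε : Fin (2 * n + 1) → Bool)
    (w : Fin (2 * n + 1) → K) : eval w (spinPoly q Ψ ε) = spinVector q (value Ψ w) ε := by
  simp only [spinPoly, spinVector, value, map_sum, map_mul, eval_C, mul_comm]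

namespace IsGroundVector

variable {q : K} {Ψ : PolyVector K n}

theorem degreeOf_spinPoly (hΨ : IsGroundVector q Ψ) (ε : Fin (2 * n + 1) → Bool)
    (j : Fin (2 * n + 1)) : degreeOf j (spinPoly q Ψ ε) ≤ 2 * n :=
  (degreeOf_sum_le j _ _).trans (Finset.sup_le fun π _ =>
    (degreeOf_C_mul_le _ _ _).trans (hΨ.degree π j))

/-- The exchange relation at all points, by continuation from the generic ones. -/
theorem exchange [CharZero K] (hΨ : IsGroundVector q Ψ) (hq : q ≠ 0) (i : Fin (2 * n))
    (ε : Fin (2 * n + 1) → Bool) (w : Fin (2 * n + 1) → K) :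
    (q * w i.castSucc - q⁻¹ * w i.succ) *
        spinVector q (value Ψ fun j => w (Equiv.swap i.castSucc i.succ j)) ε =
      (q * w i.succ - q⁻¹ * w i.castSucc) * spinVector q (value Ψ w) ε +
        (w i.succ - w i.castSucc) * spinE q i.castSucc i.succ (spinVector q (value Ψ w)) ε := by
  have key : qForm q i.castSucc i.succ *
        rename (Equiv.swap i.castSucc i.succ) (spinPoly q Ψ ε) =
      qForm q i.succ i.castSucc * spinPoly q Ψ ε + (X i.succ - X i.castSucc) *
        (C (arcWeight q false (ε i.castSucc) (ε i.succ)) *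
          (-C q * spinPoly q Ψ (setTwo ε i.castSucc i.succ true false) +
            spinPoly q Ψ (setTwo ε i.castSucc i.succ false true))) := by
    refine eq_of_eval_genericPoint fun w => ?_
    have h := (isSpinSolution_spinSolution (n := n) hq).exchange i (Nat.zero_le _) ε w
    have hr : eval (w.1 ∘ Equiv.swap i.castSucc i.succ) (spinPoly q Ψ ε) =
      eval (swap i.castSucc i.succ w).1 (spinPoly q Ψ ε) := rfl
    have hp : ∏ j, (swap i.castSucc i.succ w).1 j ^ n = ∏ j, w.1 j ^ n :=
      Equiv.prod_comp (Equiv.swap i.castSucc i.succ) fun j => w.1 j ^ n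
    simp only [map_mul, map_add, map_sub, map_neg, eval_C, eval_X, eval_qForm, eval_rename]
    rw [hr]
    simp only [eval_spinPoly, hΨ.eq, hp]
    rw [spinE] at h
    linear_combination (∏ j, w.1 j ^ n) * h
  have h := congrArg (eval w) key
  simp only [map_mul, map_add, map_sub, map_neg, eval_C, eval_X, eval_qForm, eval_rename,
    eval_spinPoly] at h
  exact h

/-- The inversion relation at all points with nonzero last coordinate. -/
theorem inversion [CharZero K] (hΨ : IsGroundVector q Ψ) (hq : q ≠ 0)
    (ε : Fin (2 * n + 1) → Bool) {w : Fin (2 * n + 1) → K} (hw : w (Fin.last _) ≠ 0) :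
    w (Fin.last _) ^ (2 * n) * spinVector q
        (value Ψ (Function.update w (Fin.last _) (1 / w (Fin.last _)))) ε =
      spinVector q (value Ψ w) (flip (Fin.last _) ε) := by
  obtain ⟨p, -, hp⟩ := exists_reversal (one_ne_zero (α := K)) (Fin.last (2 * n)) (spinPoly q Ψ ε)
    (hΨ.degreeOf_spinPoly ε)
  have key : p = spinPoly q Ψ (flip (Fin.last _) ε) := by
    refine eq_of_eval_genericPoint fun w => ?_
    have hl := w.2.1 (Fin.last (2 * n))
    have h1 := (isSpinSolution_spinSolution (n := n) hq).inversion ε w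
    have h2 : Function.update w.1 (Fin.last (2 * n)) (1 / (1 * w.1 (Fin.last (2 * n)))) =
      (invert (Fin.last _) w).1 := by simp [invert]
    rw [hp _ hl, h2, eval_spinPoly, eval_spinPoly, hΨ.eq, hΨ.eq, h1, prod_invert_pow,
      ← mul_assoc, mul_inv_cancel_left₀ (pow_ne_zero _ hl)]
  have h := hp w hw
  rw [key, eval_spinPoly, eval_spinPoly, one_mul] at h
  exact h.symm

theorem spinPoly_true [CharZero K] (hΨ : IsGroundVector q Ψ) :
    spinPoly q Ψ (fun _ => true) = qVandermonde (2 * n + 1) q := by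
  refine eq_of_eval_genericPoint fun w => ?_
  rw [eval_spinPoly, hΨ.eq, spinSolution_true, baseFunction,
    mul_inv_cancel_left₀ (prod_pow_ne_zero w n)]

theorem base [CharZero K] (hΨ : IsGroundVector q Ψ) :
    Ψ (allOpen _) = qVandermonde (2 * n + 1) q := by
  refine eq_of_eval_genericPoint fun w => ?_
  have h1 : closerSpin (allOpen (2 * n + 1)) = fun _ => true := by
    funext p
    simp [closerSpin, allOpen]
  have h2 := spinVector_closerSpin q (value Ψ w.1) (allOpen (2 * n + 1))
  have h3 : closerMass (allOpen (2 * n + 1)) = 0 := by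
    refine Finset.sum_eq_zero fun p hp => absurd (closerSpin_eq_false.2 hp) ?_
    rw [h1]; simp
  rw [h3, Finset.filter_false_of_mem fun _ _ => Nat.not_lt_zero _, Finset.sum_empty, add_zero, h1,
    ← eval_spinPoly, hΨ.spinPoly_true] at h2
  exact h2.symm

theorem partialDegree_eq [CharZero K] (hΨ : IsGroundVector q Ψ) (hq : q ≠ 0)
    (j : Fin (2 * n + 1)) : partialDegree Ψ j = 2 * n := by
  refine le_antisymm (Finset.sup_le fun π _ => hΨ.degree π j) ?_
  have := degreeOf_le_partialDegree Ψ j (allOpen _)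
  rwa [hΨ.base, degreeOf_qVandermonde hq] at this

end IsGroundVector

end

/-! ### The boundary equations -/

section

variable {K : Type*} [Field K] {n : ℕ}

open GenericPoint

namespace IsSpinSolution

variable {q : K} {k : ℕ} {A B : (Fin (2 * n + 1) → Bool) → GenericPoint K (2 * n + 1) → K}

/-- Relations of the spin chain away from the first point are compatible with multiplication by a
function of the first variable. -/
theorem mul_first (hA : IsSpinSolution q 1 A) (hn : 1 ≤ n) (f : K → K) :
    IsSpinSolution q 1 fun ε w => f (w.1 0) * A ε w where
  exchange i hi ε w := by
    have h0 : (swap i.castSucc i.succ w).1 0 = w.1 0 :=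
      swap_of_ne w (by simp [Fin.ext_iff]; omega) (by simp [Fin.ext_iff])
    have h := hA.exchange i hi ε w
    rw [h0]
    simp only [spinE] at h ⊢
    linear_combination f (w.1 0) * h
  inversion ε w := by
    have h0 : (invert (Fin.last (2 * n)) w).1 0 = w.1 0 :=
      invert_of_ne w (by simp [Fin.ext_iff]; omega)
    rw [h0, hA.inversion]

/-- The boundary generator at the first point commutes with the relations away from it. -/
theorem spinEZero (hA : IsSpinSolution q 1 A) (hn : 1 ≤ n) :
    IsSpinSolution q 1 fun ε w => spinEZero q (fun ε' => A ε' w) ε where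
  exchange i hi ε w := by
    have ha : i.castSucc ≠ 0 := by simp [Fin.ext_iff]; omega
    have hb : i.succ ≠ 0 := by simp [Fin.ext_iff]
    have hset : ∀ x y z, setTwo (Function.update ε 0 z) i.castSucc i.succ x y =
        Function.update (setTwo ε i.castSucc i.succ x y) 0 z := fun x y z => by
      rw [setTwo, setTwo, Function.update_comm ha.symm, Function.update_comm hb.symm]
    have h1 := hA.exchange i hi (Function.update ε 0 true) w
    have h2 := hA.exchange i hi (Function.update ε 0 false) w
    simp only [spinE, DqKZ.spinEZero, hset, Function.update_of_ne ha, Function.update_of_ne hb]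
      at h1 h2 ⊢
    linear_combination -q⁻¹ * h1 - q * h2
  inversion ε w := by
    have hl : Fin.last (2 * n) ≠ 0 := by simp [Fin.ext_iff]; omega
    simp only [DqKZ.spinEZero, hA.inversion, flip, Function.update_of_ne hl]
    rw [Function.update_comm hl, Function.update_comm hl]

end IsSpinSolution

namespace IsGroundVector

variable {q : K} {Ψ : PolyVector K n}

/-- The reflection of the first variable preserves the relations away from the first point. -/
theorem isSpinSolution_reflect [CharZero K] (hΨ : IsGroundVector q Ψ) (hq : q ≠ 0) (hn : 1 ≤ n) :
    IsSpinSolution q 1 fun ε w => (∏ j, w.1 j ^ n)⁻¹ *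
      spinVector q (value Ψ (Function.update w.1 0 (1 / (q ^ 6 * w.1 0)))) ε where
  exchange i hi ε w := by
    have ha : i.castSucc ≠ 0 := by simp [Fin.ext_iff]; omega
    have hb : i.succ ≠ 0 := by simp [Fin.ext_iff]
    have h0 : (swap i.castSucc i.succ w).1 0 = w.1 0 := swap_of_ne w ha.symm hb.symm
    have hp : ∏ j, (swap i.castSucc i.succ w).1 j ^ n = ∏ j, w.1 j ^ n :=
      Equiv.prod_comp (Equiv.swap i.castSucc i.succ) fun j => w.1 j ^ n
    have hc : Function.update (swap i.castSucc i.succ w).1 0 (1 / (q ^ 6 * w.1 0)) =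
        fun j => Function.update w.1 0 (1 / (q ^ 6 * w.1 0)) (Equiv.swap i.castSucc i.succ j) := by
      funext j
      by_cases hj : j = 0
      · rw [hj, Equiv.swap_apply_of_ne_of_ne ha.symm hb.symm, Function.update_self,
          Function.update_self]
      · have : Equiv.swap i.castSucc i.succ j ≠ 0 := fun h => hj (by
          rw [← Equiv.swap_apply_self i.castSucc i.succ j, h,
            Equiv.swap_apply_of_ne_of_ne ha.symm hb.symm])
        rw [Function.update_of_ne hj, Function.update_of_ne this]
        rfl
    have h := hΨ.exchange hq i ε (Function.update w.1 0 (1 / (q ^ 6 * w.1 0)))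
    rw [h0, hp, hc]
    simp only [spinE, Function.update_of_ne ha, Function.update_of_ne hb] at h ⊢
    linear_combination (∏ j, w.1 j ^ n)⁻¹ * h
  inversion ε w := by
    have hl : Fin.last (2 * n) ≠ 0 := by simp [Fin.ext_iff]; omega
    have h0 : (invert (Fin.last (2 * n)) w).1 0 = w.1 0 := invert_of_ne w hl.symm
    have hw := w.2.1 (Fin.last (2 * n))
    have h := hΨ.inversion hq ε (w := Function.update w.1 0 (1 / (q ^ 6 * w.1 0)))
      (by rwa [Function.update_of_ne hl])
    rw [Function.update_of_ne hl, Function.update_comm hl.symm] at h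
    have hc : (invert (Fin.last (2 * n)) w).1 =
      Function.update w.1 (Fin.last (2 * n)) (1 / w.1 (Fin.last (2 * n))) := by simp [invert]
    rw [h0, prod_invert_pow, ← h, hc, mul_inv, inv_inv]
    ring

/-- The equation of the boundary generator for the components whose first spin is `+`: at the
component with all spins `+` it is the interpolation formula for the component with one spin `-`. -/
theorem affine_of_true [CharZero K] (hΨ : IsGroundVector q Ψ) (hq : q ≠ 0) (hn : 1 ≤ n)
    {ε : Fin (2 * n + 1) → Bool} (hε : ε 0 = true) {w : Fin (2 * n + 1) → K} (hw : w 0 ≠ 0) :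
    (q - q⁻¹ * (q ^ 6 * w 0 ^ 2)) * ((q ^ 3 * w 0) ^ (2 * n) *
        spinVector q (value Ψ (Function.update w 0 (1 / (q ^ 6 * w 0)))) ε) =
      (q * (q ^ 6 * w 0 ^ 2) - q⁻¹) * spinVector q (value Ψ w) ε +
        (q ^ 6 * w 0 ^ 2 - 1) * spinEZero q (spinVector q (value Ψ w)) ε := by
  -- the difference of both sides solves the relations away from the first point
  have hs := (isSpinSolution_spinSolution (n := n) hq).mono (Nat.zero_le 1)
  have hG := (((hΨ.isSpinSolution_reflect hq hn).mul_first hn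
    fun x => (q - q⁻¹ * (q ^ 6 * x ^ 2)) * (q ^ 3 * x) ^ (2 * n)).sub
      (hs.mul_first hn fun x => q * (q ^ 6 * x ^ 2) - q⁻¹)).sub
      ((hs.spinEZero hn).mul_first hn fun x => q ^ 6 * x ^ 2 - 1)
  have hGε := hG.eq_zero hq (ε₀ := fun _ => true) (ε := ε) (by
    funext w
    have h1 := spinSolution_flip_zero hq w
    have h2 : flip 0 (fun _ : Fin (2 * n + 1) => true) = Function.update (fun _ => true) 0 false := rfl
    have h3 : Function.update (fun _ : Fin (2 * n + 1) => true) 0 true = fun _ => true := by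
      rw [Function.update_eq_self_iff]
    have hw := w.2.1 0
    have h4 : (∏ j, Function.update w.1 0 (1 / (q ^ 6 * w.1 0)) j ^ n)⁻¹ =
        (q ^ 3 * w.1 0) ^ (2 * n) * (∏ j, w.1 j ^ n)⁻¹ := by
      rw [← Finset.mul_prod_erase _ _ (Finset.mem_univ (0 : Fin (2 * n + 1))),
        ← Finset.mul_prod_erase _ (fun j => w.1 j ^ n) (Finset.mem_univ (0 : Fin (2 * n + 1))),
        Finset.prod_congr rfl fun j hj => by
          rw [Function.update_of_ne (Finset.ne_of_mem_erase hj)], Function.update_self, one_div,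
        inv_pow, mul_inv, inv_inv, mul_inv]
      have h5 : (q ^ 3 * w.1 0) ^ (2 * n) = (q ^ 6 * w.1 0) ^ n * w.1 0 ^ n := by
        rw [← mul_pow, pow_mul]
        ring
      rw [h5]
      have := pow_ne_zero n hw
      field_simp
    rw [baseValue, h4, ← hΨ.spinPoly_true, eval_spinPoly, h2] at h1
    simp only [Pi.sub_apply, Pi.zero_apply, spinEZero, h3, spinSolution_true]
    generalize (∏ j, w.1 j ^ n)⁻¹ = Q at *
    linear_combination h1) (fun i hi => by rw [Fin.ext (a := i) (b := 0) (by simpa using hi), hε])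
  obtain ⟨p, -, hp⟩ := exists_reversal (pow_ne_zero 6 hq) 0 (spinPoly q Ψ ε)
    (hΨ.degreeOf_spinPoly ε)
  have key : (C q - C q⁻¹ * (C (q ^ 6) * X 0 ^ 2)) * (C (q ^ 3) ^ (2 * n) * p) =
      (C q * (C (q ^ 6) * X 0 ^ 2) - C q⁻¹) * spinPoly q Ψ ε + (C (q ^ 6) * X 0 ^ 2 - 1) *
        (-C q⁻¹ * spinPoly q Ψ (Function.update ε 0 true) -
          C q * spinPoly q Ψ (Function.update ε 0 false)) := by
    refine eq_of_eval_genericPoint fun w => ?_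
    have h1 := congrFun hGε w
    have h2 := prod_pow_ne_zero w n
    simp only [Pi.sub_apply, Pi.zero_apply, spinEZero] at h1
    simp only [map_mul, map_sub, map_add, map_neg, map_pow, map_one, eval_C, eval_X,
      hp _ (w.2.1 0), eval_spinPoly, hΨ.eq]
    generalize ∏ j, w.1 j ^ n = Q at *
    generalize spinVector q (value Ψ (Function.update w.1 0 (1 / (q ^ 6 * w.1 0)))) ε = F at *
    have h3 : F = Q * (Q⁻¹ * F) := (mul_inv_cancel_left₀ h2 F).symm
    rw [h3]
    generalize Q⁻¹ * F = F' at *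
    rw [mul_pow] at h1
    linear_combination Q * h1
  have h := congrArg (eval w) key
  simp only [map_mul, map_sub, map_add, map_neg, map_pow, map_one, eval_C, eval_X,
    hp _ hw, eval_spinPoly] at h
  rw [spinEZero, mul_pow]
  linear_combination h

/-- The equation of the boundary generator. -/
theorem affine [CharZero K] (hΨ : IsGroundVector q Ψ) (hq : q ≠ 0) (hn : 1 ≤ n)
    (ε : Fin (2 * n + 1) → Bool) {w : Fin (2 * n + 1) → K} (hw : w 0 ≠ 0) :
    (q - q⁻¹ * (q ^ 6 * w 0 ^ 2)) * ((q ^ 3 * w 0) ^ (2 * n) *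
        spinVector q (value Ψ (Function.update w 0 (1 / (q ^ 6 * w 0)))) ε) =
      (q * (q ^ 6 * w 0 ^ 2) - q⁻¹) * spinVector q (value Ψ w) ε +
        (q ^ 6 * w 0 ^ 2 - 1) * spinEZero q (spinVector q (value Ψ w)) ε := by
  rcases hε : ε 0 with _ | _
  swap
  · exact hΨ.affine_of_true hq hn hε hw
  -- comparing the equation for first spin `+` at `w` and at its reflection shows that the image of the
  -- boundary generator is invariant, which gives the components with first spin `-`
  obtain ⟨x, hx⟩ : ∃ x, x = 1 / (q ^ 6 * w 0) := ⟨_, rfl⟩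
  have hx0 : x ≠ 0 := by rw [hx]; exact one_div_ne_zero (mul_ne_zero (pow_ne_zero 6 hq) hw)
  have h1 := hΨ.affine_of_true hq hn (ε := Function.update ε 0 true) (by simp) hw
  have h2 := hΨ.affine_of_true hq hn (ε := Function.update ε 0 true) (by simp)
    (w := Function.update w 0 x) (by simpa using hx0)
  have hxx : 1 / (q ^ 6 * x) = w 0 := by rw [hx]; field_simp
  have hε' : Function.update ε 0 false = ε := by rw [Function.update_eq_self_iff, hε]
  simp only [Function.update_self, hxx, Function.update_idem, Function.update_eq_self] at h2
  simp only [← hx, spinEZero, Function.update_idem, hε'] at h1 h2 ⊢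
  obtain ⟨u, hu⟩ : ∃ u, u = q ^ 6 * w 0 ^ 2 := ⟨_, rfl⟩
  have hu0 : u ≠ 0 := by rw [hu]; positivity
  have hu' : q ^ 6 * x ^ 2 = u⁻¹ := by rw [hx, hu]; field_simp
  have ha : (q ^ 3 * w 0) ^ (2 * n) = u ^ n := by rw [pow_mul, hu]; ring
  have ha' : (q ^ 3 * x) ^ (2 * n) = (u ^ n)⁻¹ := by rw [pow_mul, ← inv_pow, ← hu']; ring
  rw [hu', ha'] at h2
  rw [← hu, ha] at h1 ⊢
  have hun := pow_ne_zero n hu0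
  by_cases hu1 : u = 1
  · have : x = w 0 := by
      rw [hx, div_eq_iff (mul_ne_zero (pow_ne_zero 6 hq) hw)]
      linear_combination -hu1 + hu
    rw [this, Function.update_eq_self, hu1]
    ring
  have hu1' := sub_ne_zero.2 hu1
  generalize u ^ n = a at *
  generalize spinVector q (value Ψ w) (Function.update ε 0 true) = V at *
  generalize spinVector q (value Ψ w) ε = V' at *
  generalize spinVector q (value Ψ (Function.update w 0 x)) (Function.update ε 0 true) = F at *
  generalize spinVector q (value Ψ (Function.update w 0 x)) ε = F' at *
  have h3 : (q * u - q⁻¹) * V = (q - q⁻¹ * u) * (a * F) + (1 - u) * (a * (-q⁻¹ * F - q * F')) := by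
    field_simp at h2 ⊢
    linear_combination h2
  have h4 : a * (-q⁻¹ * F - q * F') = -q⁻¹ * V - q * V' := by
    apply mul_left_cancel₀ hu1'
    linear_combination h1 + h3
  apply mul_left_cancel₀ hq
  have h6 : q * q⁻¹ = 1 := mul_inv_cancel₀ hq
  linear_combination (-(q - q⁻¹ * u)) * h4 - q⁻¹ * h1

/-- The equation of the last node follows from an exchange between two inversions. -/
theorem last [CharZero K] (hΨ : IsGroundVector q Ψ) (hq : q ≠ 0) (hn : 1 ≤ n)
    (ε : Fin (2 * n + 1) → Bool) {w : Fin (2 * n + 1) → K} (hw : ∀ j, w j ≠ 0) :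
    (q - q⁻¹ * spectral q w .last) * weight q (2 * n) (2 * n) w .last *
        spinVector q (value Ψ (reflect q w .last)) ε =
      (q * spectral q w .last - q⁻¹) * spinVector q (value Ψ w) ε + (spectral q w .last - 1) *
        spinVector q ((generator q .last).mulVec (value Ψ w)) ε := by
  obtain ⟨i, hi1, hi2⟩ : ∃ i : Fin (2 * n), i.castSucc = penult n ∧ i.succ = Fin.last _ :=
    ⟨⟨2 * n - 1, by omega⟩, rfl, by simp [Fin.ext_iff]; omega⟩
  have hne : penult n ≠ Fin.last _ := by rw [← hi1, ← hi2]; exact Fin.castSucc_lt_succ.ne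
  have hE : ∀ v : OpenLinkPattern (2 * n + 1) → K,
      spinVector q ((generator q .last).mulVec v) ε =
        spinE q (penult n) (Fin.last _) (fun ε' => spinVector q v (flip (Fin.last _) ε'))
          (flip (Fin.last _) ε) := by
    intro v
    rw [generator, ← Matrix.mulVec_mulVec, ← Matrix.mulVec_mulVec, spinVector_sMatrix, ← hi1, ← hi2,
      spinVector_eMatrix hq, hi2]
    congr 1
    funext ε'
    exact spinVector_sMatrix q v ε'
  obtain ⟨w₁, hw₁⟩ : ∃ w₁, w₁ = Function.update w (Fin.last _) (1 / w (Fin.last _)) := ⟨_, rfl⟩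
  have hl := hw (Fin.last _)
  have hp := hw (penult n)
  have h1 : ∀ ε', w (Fin.last _) ^ (2 * n) * spinVector q (value Ψ w₁) ε' =
      spinVector q (value Ψ w) (flip (Fin.last _) ε') := fun ε' => by
    rw [hw₁]; exact hΨ.inversion hq ε' hl
  have hflip : flip (Fin.last _) (flip (Fin.last _) ε) = ε := by
    simp [flip]
  have h2 := hΨ.exchange hq i (flip (Fin.last _) ε) w₁
  obtain ⟨w₂, hw₂⟩ : ∃ w₂, w₂ = fun j => w₁ (Equiv.swap i.castSucc i.succ j) := ⟨_, rfl⟩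
  have hw₁l : w₁ (Fin.last _) = 1 / w (Fin.last _) := by rw [hw₁, Function.update_self]
  have hw₁p : w₁ (penult n) = w (penult n) := by rw [hw₁, Function.update_of_ne hne]
  have hw₂l : w₂ (Fin.last _) = w (penult n) := by
    simp only [hw₂, ← hi2, Equiv.swap_apply_right]
    rw [hi1, hw₁p]
  have h3 := hΨ.inversion hq ε (w := w₂) (by rwa [hw₂l])
  have hr : Function.update w₂ (Fin.last _) (1 / w (penult n)) = reflect q w .last := by
    funext j
    rw [reflect]
    by_cases hj : j = Fin.last _
    · rw [hj, Function.update_self, Function.update_self]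
    rw [Function.update_of_ne hj, Function.update_of_ne hj]
    by_cases hj' : j = penult n
    · rw [hj', Function.update_self, hw₂]
      simp only
      rw [← hi1, Equiv.swap_apply_left, hi2, hw₁l]
    · rw [Function.update_of_ne hj', hw₂]
      simp only
      rw [Equiv.swap_apply_of_ne_of_ne (by rwa [hi1]) (by rwa [hi2]), hw₁, Function.update_of_ne hj]
  rw [hw₂l, hr] at h3
  rw [← hw₂, hi1, hi2, hw₁l, hw₁p] at h2
  have h4 : w (Fin.last _) ^ (2 * n) * spinE q (penult n) (Fin.last _) (spinVector q (value Ψ w₁))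
      (flip (Fin.last _) ε) = spinE q (penult n) (Fin.last _)
        (fun ε' => spinVector q (value Ψ w) (flip (Fin.last _) ε')) (flip (Fin.last _) ε) := by
    simp only [spinE, ← h1]
    ring
  have h5 := h1 (flip (Fin.last _) ε)
  rw [hflip] at h5
  rw [hE, ← h4, ← h5, weight, spectral, mul_pow]
  rw [← h3] at h2
  generalize spinVector q (value Ψ (reflect q w .last)) ε = R at *
  generalize spinE q (penult n) (Fin.last _) (spinVector q (value Ψ w₁)) (flip (Fin.last _) ε) = E
    at *
  generalize spinVector q (value Ψ w₁) (flip (Fin.last _) ε) = V at *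
  generalize w (penult n) ^ (2 * n) = P, w (Fin.last _) ^ (2 * n) = L at *
  clear h1 h3 h4 h5 hr
  generalize w (penult n) = x, w (Fin.last _) = y at *
  field_simp at h2 ⊢
  linear_combination L * h2

theorem satisfiesInversion [CharZero K] (hΨ : IsGroundVector q Ψ) (hq : q ≠ 0) :
    SatisfiesInversion Ψ := by
  intro w hw
  rw [hΨ.partialDegree_eq hq]
  refine spinVector_injective q (funext fun ε => ?_)
  have h1 : (w (Fin.last _) ^ (2 * n))⁻¹ • (sMatrix K n).mulVec (value Ψ w) =
      fun π => (w (Fin.last _) ^ (2 * n))⁻¹ * (sMatrix K n).mulVec (value Ψ w) π := rfl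
  rw [h1, spinVector_mul, spinVector_sMatrix, ← hΨ.inversion hq ε (hw _),
    inv_mul_cancel_left₀ (pow_ne_zero _ (hw _))]

theorem isSolution [CharZero K] (hΨ : IsGroundVector q Ψ) (hq : q ≠ 0) (hn : 1 ≤ n) :
    IsSolution q Ψ := by
  rw [isSolution_iff hq, hΨ.partialDegree_eq hq, hΨ.partialDegree_eq hq]
  intro g w hw hu
  refine row_of_spinVector (q := q) _ fun ε => ?_
  cases g with
  | affine =>
    rw [generator, spinVector_eZeroMatrix hq, mul_assoc]
    exact hΨ.affine hq hn ε (hw 0)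
  | bulk i =>
    rw [generator, spinVector_eMatrix hq]
    have h := hΨ.exchange hq i ε w
    have h0 := hw i.castSucc
    simp only [weight, spectral, reflect, mul_one]
    generalize spinVector q (value Ψ fun j => w (Equiv.swap i.castSucc i.succ j)) ε = A at *
    field_simp
    field_simp at h
    linear_combination h
  | last => exact hΨ.last hq hn ε hw

end IsGroundVector

end

end DqKZ

theorem mainTheorem4 {K : Type*} [Field K] [CharZero K] (q : K) (hq : q ≠ 0) (hq4 : q ^ 4 ≠ 1)
    (n : ℕ) (hn : 1 ≤ n) :
    ∃ Ψ : DqKZ.PolyVector K n,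
      DqKZ.IsSolution q Ψ ∧
      DqKZ.SatisfiesInversion Ψ ∧
      -- the base entry and its total degree `r (r - 1) / 2`, where `r = 2 n + 1`
      Ψ (DqKZ.allOpen _) =
        ∏ i : Fin (2 * n + 1), ∏ j ∈ Finset.Ioi i,
          (MvPolynomial.C q * MvPolynomial.X i - MvPolynomial.C q⁻¹ * MvPolynomial.X j) ∧
      (Ψ (DqKZ.allOpen _)).totalDegree = (2 * n + 1) * (2 * n) / 2 ∧
      -- the degree in each variable is `r - 1`
      (∀ j, DqKZ.partialDegree Ψ j = 2 * n) ∧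
      -- all other entries are obtained in a triangular way
      DqKZ.IsTriangular q Ψ ∧
      -- minimality, and uniqueness up to a scalar in the minimal degree
      ∀ Φ : DqKZ.PolyVector K n, DqKZ.IsSolution q Φ → Φ ≠ 0 →
        Φ (DqKZ.allOpen _) ≠ 0 ∧
        (2 * n + 1) * (2 * n) / 2 ≤ (Φ (DqKZ.allOpen _)).totalDegree ∧
        (∀ j, 2 * n ≤ DqKZ.partialDegree Φ j) ∧
        ((∃ j, DqKZ.partialDegree Φ j = 2 * n) → ∃ c : K, Φ = fun π => MvPolynomial.C c * Ψ π) := by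
  obtain ⟨Ψ, hΨ⟩ := DqKZ.exists_isGroundVector (n := n) hq
  have hsol := hΨ.isSolution hq hn
  have hbase := hΨ.base
  have hdeg := hΨ.partialDegree_eq hq
  refine ⟨Ψ, hsol, hΨ.satisfiesInversion hq, hbase, ?_, hdeg,
    DqKZ.isTriangular_of_isSolution hq hsol,
    fun Φ hΦ hne => DqKZ.minimality hq hq4 hsol hbase hdeg hΦ hne⟩
  rw [hbase, DqKZ.totalDegree_qVandermonde hq, Nat.add_sub_cancel]
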